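/- Let $X$ be a locally finite semi-homogeneous tree (the valency of a vertex depends only on its type, adjacent vertices having different types) with vertex set $V_X$, in which every vertex has valency at least $2$ and some vertex has valency at least $3$. Endow $\mathrm{Aut}(X)$ with the topology of uniform convergence on finite subsets, and let $G$ be a closed locally $\infty$-transitive subgroup of $\mathrm{Aut}(X)$, i.e. for every vertex $v$ and every $n\ge 0$ the stabilizer $K_v=\mathrm{Stab}_G(v)$ is transitive on the sphere of radius $n$ around $v$. For $\xi\in\partial_\infty X$, let $D_\xi$ be the group of the elements of $G$ that fix $\xi$ and stabilize each horosphere centred at $\xi$. For every vertex $v$ there is a unique $K_v$-invariant Borel probability measure $\mu_v$ on $\partial_\infty X$, and its stabilizer in $G$ is $K_v$. Consider the following spaces with their natural $G$-actions. 1. $\overline V_X^{\rm geom}$, the closure of $V_X$ in $\overline X^{\rm geom}=X\sqcup\partial_\infty X$ (with the cone topology). 2. $\overline V_X^{\rm pol}$, defined as follows. Let $L$ be any geodesic line in $X$ (there are such lines), $\overline L$ its closure in $\overline X^{\rm geom}$, and $N_L=\mathrm{Stab}_G(L)$; for $x\in\overline L$ put $G_x=\mathrm{Stab}_G(x)$ if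 $x\in L$ and $G_x=D_x$ if $x\in\partial_\infty X$. Let $\overline X^{\rm pol}$ be the quotient space of $G\times\overline L$ by the equivalence relation: $(g,x)\sim(h,y)$ if and only if there is $n\in N_L$ with $y=n.x$ and $g^{-1}hn\in G_x$; $G$ acts by $h.[g,x]=[hg,x]$. Then $\overline V_X^{\rm pol}$ is the closure in $\overline X^{\rm pol}$ of the set of all $[g,x]$ with $g\in G$ and $x$ a vertex of $L$. 3. $\overline V_X^{\rm gp}$, the closure of $\{K_v\}_{v\in V_X}$ in the space of closed subgroups of $G$ with the Chabauty topology; $G$ acts by conjugation. 4. $\overline V_X^{\rm meas}$, the closure of $\{\mu_v\}_{v\in V_X}$ in the space of Borel probability measures on $\partial_\infty X$ with the weak topology; $G$ acts by push-forward. Then $\overline V_X^{\rm geom}$ is a compactification of the discrete set $V_X$ (it is compact and Hausdorff, and $V_X$ is discrete in it), and $$\overline V_X^{\rm geom}=V_X\sqcup\partial_\infty X,\qquad \overline V_X^{\rm gp}=\{K_v\}_{v\in V_X}\sqcup\{D_\xi\}_{\xi\in\partial_\infty X},\qquad \overline V_X^{\rm meas}=\{\mu_v\}_{v\in V_X}\sqcup\{\delta_\xi\}_{\xi\in\partial_\infty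 X}.$$ Moreover there are $G$-equivariant homeomorphisms from $\overline V_X^{\rm geom}$ onto $\overline V_X^{\rm pol}$ (for each $L$), given by $g.x\mapsto[g,x]$ for $g\in G$ and $x\in\overline L$ with $g.x\in\overline V_X^{\rm geom}$; onto $\overline V_X^{\rm gp}$, given by $v\mapsto K_v$ and $\xi\mapsto D_\xi$; and onto $\overline V_X^{\rm meas}$, given by $v\mapsto\mu_v$ and $\xi\mapsto\delta_\xi$. In particular the four spaces are $G$-equivariantly homeomorphic compactifications of $V_X$. -/

import Mathlib

open Set Filter Topology MeasureTheory
open scoped Pointwise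

namespace TreeComp

variable {V : Type*}

/-! ### Automorphism groups of graphs -/

section Automorphisms

variable (X : SimpleGraph V)

/-- `X` is semi-homogeneous: for some `2`-colouring of the vertices by types (adjacent vertices
have distinct types), the valency of a vertex depends only on its type. -/
def IsSemiHomogeneous [X.LocallyFinite] : Prop :=
  ∃ (type : X.Coloring (Fin 2)) (d : Fin 2 → ℕ), ∀ v, X.degree v = d (type v)

/-- The topology of uniform convergence on finite subsets on `Aut(X)`, that is, the topology of
pointwise convergence, the vertex set being discrete. -/
instance autTopology : TopologicalSpace (X ≃g X) :=
  TopologicalSpace.induced (fun g v => g v)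
    (@Pi.topologicalSpace V (fun _ => V) (fun _ => ⊥))

variable {X}

lemma isOpen_eval (v w : V) : IsOpen {g : X ≃g X | g v = w} := by
  let _ : TopologicalSpace V := ⊥
  have : DiscreteTopology V := ⟨rfl⟩
  have h : Continuous (fun (g : X ≃g X) => (fun u => g u : V → V)) := continuous_induced_dom
  have h2 : Continuous (fun g : X ≃g X => g v) := (continuous_apply v).comp h
  exact (isOpen_discrete {w}).preimage h2

lemma continuous_to_aut {Y : Type*} [TopologicalSpace Y] {f : Y → (X ≃g X)}
    (hf : ∀ v w, IsOpen {y | f y v = w}) : Continuous f := by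
  let _ : TopologicalSpace V := ⊥
  have : DiscreteTopology V := ⟨rfl⟩
  refine continuous_induced_rng.2 (continuous_pi fun v => ?_)
  refine continuous_discrete_rng.2 fun w => ?_
  exact hf v w

instance autIsTopologicalGroup : IsTopologicalGroup (X ≃g X) where
  continuous_mul := by
    refine continuous_to_aut fun v w => ?_
    have : {p : (X ≃g X) × (X ≃g X) | (p.1 * p.2) v = w}
        = ⋃ u, {g : X ≃g X | g u = w} ×ˢ {h : X ≃g X | h v = u} := by
      ext ⟨g, h⟩
      simp
    rw [this]
    exact isOpen_iUnion fun u => (isOpen_eval u w).prod (isOpen_eval v u)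
  continuous_inv := by
    refine continuous_to_aut fun v w => ?_
    have : {g : X ≃g X | g⁻¹ v = w} = {g : X ≃g X | g w = v} := by
      ext g
      constructor
      · intro h
        change g⁻¹ v = w at h
        change g w = v
        rw [← h, RelIso.apply_inv_self]
      · intro h
        change g w = v at h
        change g⁻¹ v = w
        rw [← h, RelIso.inv_apply_self]
    rw [this]
    exact isOpen_eval w v

/-- `G` is locally `∞`-transitive: for every vertex `v` and every `n`, the stabilizer of `v` in
`G` is transitive on the sphere of radius `n` centred at `v`. -/
def IsLocallyInftyTransitive (G : Subgroup (X ≃g X)) : Prop :=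
  ∀ (v : V) (n : ℕ) (x y : V), X.dist v x = n → X.dist v y = n →
    ∃ g ∈ G, g v = v ∧ g x = y

lemma edist_map_le (g : X ≃g X) (v w : V) : X.edist (g v) (g w) ≤ X.edist v w := by
  by_cases h : X.Reachable v w
  · obtain ⟨p, hp⟩ := h.exists_walk_length_eq_edist
    rw [← hp]
    have := SimpleGraph.edist_le (p.map g.toHom)
    simpa using this
  · rw [SimpleGraph.edist_eq_top_of_not_reachable h]
    exact le_top

lemma edist_map (g : X ≃g X) (v w : V) : X.edist (g v) (g w) = X.edist v w := by
  refine le_antisymm (edist_map_le g v w) ?_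
  have := edist_map_le g⁻¹ (g v) (g w)
  rwa [RelIso.inv_apply_self, RelIso.inv_apply_self] at this

lemma dist_map (g : X ≃g X) (v w : V) : X.dist (g v) (g w) = X.dist v w := by
  unfold SimpleGraph.dist
  rw [edist_map]

end Automorphisms

/-! ### The boundary at infinity -/

section Boundary

variable (X : SimpleGraph V)

/-- Geodesic rays (issued from vertices and parametrized by the distance to the origin). -/
structure GeodesicRay where
  toFun : ℕ → V
  dist_eq : ∀ m k : ℕ, X.dist (toFun m) (toFun (m + k)) = k

/-- Geodesic lines (parametrized by arc length, through vertices at integer times). -/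
structure GeodesicLine where
  toFun : ℤ → V
  dist_eq : ∀ (m : ℤ) (k : ℕ), X.dist (toFun m) (toFun (m + k)) = k

/-- Two rays are asymptotic when they stay at bounded distance from each other. -/
instance raySetoid : Setoid (GeodesicRay X) where
  r r s := ∃ C : ℕ, ∀ n, X.edist (r.toFun n) (s.toFun n) ≤ C
  iseqv :=
    { refl := fun r => ⟨0, fun n => by simp⟩
      symm := fun ⟨C, h⟩ => ⟨C, fun n => by rw [SimpleGraph.edist_comm]; exact h n⟩
      trans := fun ⟨C, h⟩ ⟨D, k⟩ => ⟨C + D, fun n => by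
        rw [Nat.cast_add]
        exact SimpleGraph.edist_triangle.trans (add_le_add (h n) (k n))⟩ }

/-- The boundary at infinity `∂_∞ X`: geodesic rays up to asymptoticity. -/
def Boundary : Type _ := Quotient (raySetoid X)

variable {X}

/-- The boundary point defined by a ray. -/
def GeodesicRay.endpoint (r : GeodesicRay X) : Boundary X := Quotient.mk _ r

instance : MulAction (X ≃g X) (GeodesicRay X) where
  smul g r := ⟨fun n => g (r.toFun n), fun m k => by rw [dist_map, r.dist_eq]⟩
  one_smul _ := rfl
  mul_smul _ _ _ := rfl

instance : MulAction (X ≃g X) (Boundary X) where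
  smul g := Quotient.map (fun r => g • r) fun r s ⟨C, h⟩ =>
    ⟨C, fun n => (edist_map g (r.toFun n) (s.toFun n)).trans_le (h n)⟩
  one_smul ξ := by
    induction ξ using Quotient.inductionOn
    rfl
  mul_smul g h ξ := by
    induction ξ using Quotient.inductionOn
    rfl

/-- `S` is (the set of vertices of) a horosphere centred at `ξ`, i.e. a level set of the Busemann
function `v ↦ lim (d(v, r(n)) - n)` of a ray `r` with endpoint `ξ`. -/
def IsHorosphere (ξ : Boundary X) (S : Set V) : Prop :=
  ∃ r : GeodesicRay X, r.endpoint = ξ ∧ ∃ c : ℤ,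
    S = {v | ∀ᶠ n : ℕ in atTop, (X.dist v (r.toFun n) : ℤ) - n = c}

/-- The subgroup `D_ξ` of `G`: the elements which fix `ξ` and stabilize each horosphere centred
at `ξ`. -/
def horosphereStabilizer (G : Subgroup (X ≃g X)) (ξ : Boundary X) : Subgroup G where
  carrier := {g | g • ξ = ξ ∧ ∀ S : Set V, IsHorosphere ξ S → g • S = S}
  one_mem' := ⟨one_smul _ _, fun S _ => one_smul _ _⟩
  mul_mem' := fun {a b} ha hb =>
    ⟨by rw [mul_smul, hb.1, ha.1], fun S hS => by rw [mul_smul, hb.2 S hS, ha.2 S hS]⟩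
  inv_mem' := fun {a} ha =>
    ⟨by rw [inv_smul_eq_iff, ha.1], fun S hS => by rw [inv_smul_eq_iff, ha.2 S hS]⟩

end Boundary

/-! ### The geometric compactification -/

section Geometric

variable (X : SimpleGraph V)

/-- The geometric realization of the graph `X`, in barycentric coordinates: a point is a
convex combination of one vertex or of two adjacent vertices. -/
@[ext]
structure Realization where
  coord : V → ℝ
  nonneg : ∀ v, 0 ≤ coord v
  exists_simplex : ∃ s : Finset V, s.card ≤ 2 ∧ X.IsClique s ∧
    (∀ v ∉ s, coord v = 0) ∧ ∑ v ∈ s, coord v = 1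

/-- The topology given by the barycentric coordinates; for a graph this is also the topology of
the length metric with edges of length one. -/
instance : TopologicalSpace (Realization X) :=
  TopologicalSpace.induced Realization.coord inferInstance

variable {X}

open Classical in
/-- A vertex, as a point of the realization. -/
noncomputable def Realization.ofVertex (v : V) : Realization X where
  coord w := if w = v then 1 else 0
  nonneg w := by
    split_ifs <;> norm_num
  exists_simplex := ⟨{v}, by simp, by simp, fun w hw => by simpa using hw, by simp⟩

instance : MulAction (X ≃g X) (Realization X) where
  smul g p :=
    { coord := fun v => p.coord (g⁻¹ v)
      nonneg := fun v => p.nonneg _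
      exists_simplex := by
        obtain ⟨s, hs, hc, h0, h1⟩ := p.exists_simplex
        refine ⟨s.map g.toEquiv.toEmbedding, by simpa using hs, ?_, ?_, ?_⟩
        · rintro a ha b hb hab
          simp only [Finset.coe_map, mem_image] at ha hb
          obtain ⟨a, ha, rfl⟩ := ha
          obtain ⟨b, hb, rfl⟩ := hb
          exact g.map_adj_iff.2 (hc ha hb fun h => hab (by rw [h]))
        · intro v hv
          refine h0 _ fun h => hv ?_
          exact Finset.mem_map.2 ⟨g⁻¹ v, h, RelIso.apply_inv_self g v⟩
        · rw [Finset.sum_map]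
          refine Eq.trans ?_ h1
          refine Finset.sum_congr rfl fun v _ => ?_
          exact congrArg p.coord (RelIso.inv_apply_self g v) }
  one_smul _ := rfl
  mul_smul _ _ _ := rfl

variable (X) in
/-- The set underlying the geometric compactification: points of the realization of the tree,
together with the points at infinity. -/
inductive GeomComp
  | point (p : Realization X)
  | boundary (ξ : Boundary X)

/-- A vertex, as a point of the geometric compactification. -/
noncomputable def GeomComp.vertex (v : V) : GeomComp X := .point (.ofVertex v)

instance : MulAction (X ≃g X) (GeomComp X) where
  smul g x := match x with
    | .point p => .point (g • p)
    | .boundary ξ => .boundary (g • ξ)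
  one_smul x := match x with
    | .point p => congrArg GeomComp.point (one_smul _ p)
    | .boundary ξ => congrArg GeomComp.boundary (one_smul _ ξ)
  mul_smul g h x := match x with
    | .point p => congrArg GeomComp.point (mul_smul g h p)
    | .boundary ξ => congrArg GeomComp.boundary (mul_smul g h ξ)

variable (X) in
/-- The vertices on the side of `b` when the edge `[a;b]` of a tree is removed. -/
def halfTree (a b : V) : Set V := {v | X.dist v b < X.dist v a}

/-- The shadow of the edge `[a;b]` seen from `a`: all points and all points at infinity which
are reached from `a` by a geodesic whose germ at `a` is that of `[a;b]`. In other words, it is the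
component containing `b` of the complement of `a`. -/
def shadow (a b : V) : Set (GeomComp X) :=
  {x | match x with
    | .point p => ∃ v ∈ halfTree X a b, 0 < p.coord v
    | .boundary ξ => ∃ r : GeodesicRay X, r.endpoint = ξ ∧
        ∀ᶠ n in atTop, r.toFun n ∈ halfTree X a b}

variable (X) in
/-- The cone topology: it is generated by the open subsets of the tree and the shadows of
its oriented edges. -/
instance coneTopology : TopologicalSpace (GeomComp X) :=
  TopologicalSpace.generateFrom
    ({W | ∃ U : Set (Realization X), IsOpen U ∧ W = GeomComp.point '' U} ∪
      {W | ∃ a b, X.Adj a b ∧ W = shadow a b})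

variable (X) in
/-- The geometric compactification of the set of vertices: its closure in the geometric
compactification of the tree. -/
def geomVertices : Set (GeomComp X) := closure (range GeomComp.vertex)

/-- The topology on the boundary, induced by the cone topology. -/
instance : TopologicalSpace (Boundary X) :=
  TopologicalSpace.induced GeomComp.boundary (coneTopology X)

instance : MeasurableSpace (Boundary X) := borel _

instance : BorelSpace (Boundary X) := ⟨rfl⟩

lemma mem_halfTree_map (g : X ≃g X) (a b v : V) :
    g v ∈ halfTree X a b ↔ v ∈ halfTree X (g⁻¹ a) (g⁻¹ b) := by
  have h (c : V) : X.dist (g v) c = X.dist v (g⁻¹ c) := by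
    rw [← dist_map g v, RelIso.apply_inv_self]
  simp only [halfTree, mem_ofPred_eq, h]

lemma continuous_smul_realization (g : X ≃g X) :
    Continuous (fun p : Realization X => g • p) := by
  refine continuous_induced_rng.2 (continuous_pi fun v => ?_)
  exact (continuous_apply (g⁻¹ v)).comp continuous_induced_dom

lemma smul_mem_shadow (g : X ≃g X) (a b : V) (x : GeomComp X) :
    g • x ∈ shadow a b ↔ x ∈ shadow (g⁻¹ a) (g⁻¹ b) := by
  rcases x with p | ξ
  · constructor
    · rintro ⟨v, hv, hp⟩
      refine ⟨g⁻¹ v, ?_, hp⟩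
      rwa [← mem_halfTree_map, RelIso.apply_inv_self]
    · rintro ⟨v, hv, hp⟩
      refine ⟨g v, (mem_halfTree_map g a b v).2 hv, ?_⟩
      change 0 < p.coord (g⁻¹ (g v))
      rwa [RelIso.inv_apply_self]
  · constructor
    · rintro ⟨r, hr, h⟩
      refine ⟨g⁻¹ • r, ?_, h.mono fun n hn => ?_⟩
      · change g⁻¹ • r.endpoint = ξ
        rw [hr]
        exact inv_smul_smul g ξ
      · rw [← mem_halfTree_map]
        change g (g⁻¹ (r.toFun n)) ∈ _
        rwa [RelIso.apply_inv_self]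
    · rintro ⟨r, hr, h⟩
      refine ⟨g • r, ?_, h.mono fun n hn => (mem_halfTree_map g a b _).2 hn⟩
      change g • r.endpoint = g • ξ
      rw [hr]

instance : ContinuousConstSMul (X ≃g X) (GeomComp X) where
  continuous_const_smul g := by
    refine continuous_generateFrom_iff.2 ?_
    rintro W (⟨U, hU, rfl⟩ | ⟨a, b, hab, rfl⟩)
    · refine TopologicalSpace.isOpen_generateFrom_of_mem (Or.inl
        ⟨_, hU.preimage (continuous_smul_realization g), ?_⟩)
      ext x
      rcases x with p | ξ
      · constructor
        · rintro ⟨q, hq, h⟩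
          have h : q = g • p := GeomComp.point.inj h
          exact ⟨p, by simpa [← h] using hq, rfl⟩
        · rintro ⟨q, hq, h⟩
          have h : q = p := GeomComp.point.inj h
          exact ⟨g • q, hq, by rw [h]; rfl⟩
      · constructor
        · rintro ⟨q, hq, h⟩
          cases h
        · rintro ⟨q, hq, h⟩
          cases h
    · refine TopologicalSpace.isOpen_generateFrom_of_mem (Or.inr
        ⟨g⁻¹ a, g⁻¹ b, (g⁻¹).map_adj_iff.2 hab, ?_⟩)
      ext x
      exact smul_mem_shadow g a b x

instance : ContinuousConstSMul (X ≃g X) (Boundary X) where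
  continuous_const_smul g :=
    continuous_induced_rng.2
      ((continuous_const_smul g).comp (continuous_induced_dom (f := GeomComp.boundary (X := X))))

end Geometric

/-! ### The polyhedral compactification -/

section Polyhedral

variable {X : SimpleGraph V}

/-- The geodesic line `L`, as a set of points of the tree. -/
def GeodesicLine.points (L : GeodesicLine X) : Set (GeomComp X) :=
  {x | ∃ p : Realization X, x = .point p ∧ ∀ v, p.coord v ≠ 0 → v ∈ range L.toFun}

/-- The closure `L̄` of the geodesic line `L` in the geometric compactification. -/
def GeodesicLine.closed (L : GeodesicLine X) : Set (GeomComp X) := closure L.points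

/-- The subgroup `G_x`: the stabilizer `K_x` if `x` is a point of the tree, and
the group `D_x` if `x` is a point at infinity. -/
def pointGroup (G : Subgroup (X ≃g X)) : GeomComp X → Subgroup G
  | .point p => MulAction.stabilizer G p
  | .boundary ξ => horosphereStabilizer G ξ

/-- The relation on `G × L̄`: `(g, x) ∼ (h, y)` when there is `n ∈ N_L = Stab_G(L)` such that
`y = n.x` and `g⁻¹ h n ∈ G_x`. -/
def polRel (G : Subgroup (X ≃g X)) (L : GeodesicLine X) (a b : G × L.closed) : Prop :=
  ∃ n ∈ MulAction.stabilizer G L.points,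
    (b.2 : GeomComp X) = n • (a.2 : GeomComp X) ∧ a.1⁻¹ * b.1 * n ∈ pointGroup G (a.2 : GeomComp X)

lemma isHorosphere_smul (g : X ≃g X) {ξ : Boundary X} {S : Set V} (hS : IsHorosphere ξ S) :
    IsHorosphere (g • ξ) (g • S) := by
  obtain ⟨r, rfl, c, rfl⟩ := hS
  refine ⟨g • r, rfl, c, ?_⟩
  ext v
  rw [mem_smul_set_iff_inv_smul_mem]
  have h (n : ℕ) : X.dist (g⁻¹ • v) (r.toFun n) = X.dist v ((g • r).toFun n) := by
    rw [← dist_map g]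
    change X.dist (g (g⁻¹ v)) _ = _
    rw [RelIso.apply_inv_self]
    rfl
  simp only [mem_ofPred_eq, h]

lemma conj_mem_pointGroup (G : Subgroup (X ≃g X)) (n k : G) (x : GeomComp X)
    (hk : k ∈ pointGroup G x) : n * k * n⁻¹ ∈ pointGroup G (n • x) := by
  rcases x with p | ξ
  · have hk : k • p = p := hk
    change (n * k * n⁻¹) • n • p = n • p
    rw [mul_smul, inv_smul_smul, mul_smul, hk]
  · have hk : k • ξ = ξ ∧ ∀ S : Set V, IsHorosphere ξ S → k • S = S := hk
    change (n * k * n⁻¹) • n • ξ = n • ξ ∧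
      ∀ S : Set V, IsHorosphere (n • ξ) S → (n * k * n⁻¹) • S = S
    refine ⟨by rw [mul_smul, inv_smul_smul, mul_smul, hk.1], fun S hS => ?_⟩
    have h := isHorosphere_smul (n⁻¹ : G).1 hS
    have h' : IsHorosphere ξ (n⁻¹ • S) := by
      have e : (n⁻¹ : G).1 • n • ξ = ξ := inv_smul_smul n ξ
      rw [e] at h
      exact h
    rw [mul_smul, mul_smul, hk.2 _ h', smul_inv_smul]

/-- The relation `∼` is an equivalence relation. -/
instance polSetoid (G : Subgroup (X ≃g X)) (L : GeodesicLine X) : Setoid (G × L.closed) where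
  r := polRel G L
  iseqv :=
    { refl := fun a => ⟨1, one_mem _, (one_smul _ _).symm, by
        rw [inv_mul_cancel, one_mul]
        exact one_mem _⟩
      symm := by
        rintro ⟨g, x⟩ ⟨h, y⟩ ⟨n, hn, hy, hk⟩
        dsimp only at hy hk
        refine ⟨n⁻¹, inv_mem hn, by dsimp only; rw [hy, inv_smul_smul], ?_⟩
        have := conj_mem_pointGroup G n _ _ (inv_mem hk)
        dsimp only
        rw [hy]
        convert this using 1
        group
      trans := by
        rintro ⟨g, x⟩ ⟨h, y⟩ ⟨k, z⟩ ⟨n, hn, hy, hg⟩ ⟨m, hm, hz, hh⟩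
        dsimp only at hy hg hz hh
        refine ⟨m * n, mul_mem hm hn, by dsimp only; rw [hz, hy, mul_smul], ?_⟩
        dsimp only
        have e : x = n⁻¹ • (y : GeomComp X) := by rw [hy, inv_smul_smul]
        have := conj_mem_pointGroup G n⁻¹ _ _ hh
        rw [← e] at this
        convert mul_mem hg this using 1
        group }

/-- The polyhedral compactification `(G × L̄) / ∼` of the tree, with the quotient topology. -/
def PolComp (G : Subgroup (X ≃g X)) (L : GeodesicLine X) : Type _ := Quotient (polSetoid G L)

instance (G : Subgroup (X ≃g X)) (L : GeodesicLine X) : TopologicalSpace (PolComp G L) :=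
  inferInstanceAs (TopologicalSpace (Quotient _))

/-- The class `[g, x]`. -/
def PolComp.mk {G : Subgroup (X ≃g X)} {L : GeodesicLine X} (g : G) (x : L.closed) :
    PolComp G L := Quotient.mk _ (g, x)

/-- The action `h.[g, x] = [hg, x]`. -/
def polAction (G : Subgroup (X ≃g X)) (L : GeodesicLine X) (h : G) : PolComp G L → PolComp G L :=
  Quotient.map (fun a => (h * a.1, a.2)) fun a b ⟨n, hn, hy, hk⟩ => ⟨n, hn, hy, by
    dsimp only
    convert hk using 1
    group⟩

/-- The polyhedral compactification of the set of vertices: the closure of the set of vertices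
in the polyhedral compactification of the tree. -/
def polVertices (G : Subgroup (X ≃g X)) (L : GeodesicLine X) : Set (PolComp G L) :=
  closure {q | ∃ (g : G) (x : L.closed), (∃ v, (x : GeomComp X) = .vertex v) ∧ q = .mk g x}

end Polyhedral

/-! ### The group-theoretic compactification -/

section Chabauty

variable (Γ : Type*) [Group Γ] [TopologicalSpace Γ]

/-- The entourage `P(C, W)` between closed subgroups. -/
def chabautyRel (C W : Set Γ) (F F' : ClosedSubgroup Γ) : Prop :=
  (F : Set Γ) ∩ C ⊆ W * (F' : Set Γ) ∧ (F' : Set Γ) ∩ C ⊆ W * (F : Set Γ)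

/-- The Chabauty topology on the closed subgroups of (the locally compact group) `Γ`, i.e. the
topology of the uniform structure for which the sets `P(C, W)`, for `C` compact and `W` a
neighbourhood of `1`, form a fundamental system of entourages. -/
instance chabautyTopology : TopologicalSpace (ClosedSubgroup Γ) where
  IsOpen U := ∀ F ∈ U, ∃ C : Set Γ, IsCompact C ∧ ∃ W ∈ 𝓝 (1 : Γ),
    ∀ F', chabautyRel Γ C W F F' → F' ∈ U
  isOpen_univ := fun _ _ => ⟨∅, isCompact_empty, univ, univ_mem, fun _ _ => mem_univ _⟩
  isOpen_inter := fun U₁ U₂ h₁ h₂ F hF => by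
    obtain ⟨C₁, hC₁, W₁, hW₁, k₁⟩ := h₁ F hF.1
    obtain ⟨C₂, hC₂, W₂, hW₂, k₂⟩ := h₂ F hF.2
    refine ⟨C₁ ∪ C₂, hC₁.union hC₂, W₁ ∩ W₂, inter_mem hW₁ hW₂, fun F' hF' => ⟨?_, ?_⟩⟩
    · exact k₁ F' ⟨fun x hx => mul_subset_mul_right inter_subset_left (hF'.1 ⟨hx.1, Or.inl hx.2⟩),
        fun x hx => mul_subset_mul_right inter_subset_left (hF'.2 ⟨hx.1, Or.inl hx.2⟩)⟩
    · exact k₂ F' ⟨fun x hx => mul_subset_mul_right inter_subset_right (hF'.1 ⟨hx.1, Or.inr hx.2⟩),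
        fun x hx => mul_subset_mul_right inter_subset_right (hF'.2 ⟨hx.1, Or.inr hx.2⟩)⟩
  isOpen_sUnion := fun 𝒮 h F ⟨U, hU, hF⟩ => by
    obtain ⟨C, hC, W, hW, k⟩ := h U hU F hF
    exact ⟨C, hC, W, hW, fun F' hF' => ⟨U, hU, k F' hF'⟩⟩

variable {Γ} in
/-- The action of `Γ` on its closed subgroups by conjugation: `g.H = g H g⁻¹`. -/
def conjAction [IsTopologicalGroup Γ] (g : Γ) (H : ClosedSubgroup Γ) : ClosedSubgroup Γ where
  toSubgroup := H.toSubgroup.map (MulAut.conj g).toMonoidHom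
  isClosed' := by
    have h : Continuous (fun x : Γ => g⁻¹ * x * g) := by fun_prop
    have : ((H.toSubgroup.map (MulAut.conj g).toMonoidHom : Subgroup Γ) : Set Γ)
        = (fun x : Γ => g⁻¹ * x * g) ⁻¹' (H : Set Γ) := by
      ext x
      constructor
      · rintro ⟨y, hy, rfl⟩
        change g⁻¹ * (g * y * g⁻¹) * g ∈ H
        have e : g⁻¹ * (g * y * g⁻¹) * g = y := by group
        rw [e]
        exact hy
      · intro hx
        refine ⟨g⁻¹ * x * g, hx, ?_⟩
        change g * (g⁻¹ * x * g) * g⁻¹ = x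
        group
    exact (congrArg IsClosed this).mpr (H.isClosed'.preimage h)

variable {X : SimpleGraph V}

/-- The stabilizer `K_v` of a vertex `v` in `G`, as a closed subgroup of `G`. -/
def vertexStabilizer (G : Subgroup (X ≃g X)) (v : V) : ClosedSubgroup G where
  toSubgroup := MulAction.stabilizer G v
  isClosed' := by
    have : IsClosed {g : X ≃g X | g v = v} := by
      rw [← isOpen_compl_iff]
      have : {g : X ≃g X | g v = v}ᶜ = ⋃ w ∈ {w | w ≠ v}, {g : X ≃g X | g v = w} := by
        ext g
        simp
      rw [this]
      exact isOpen_biUnion fun w _ => isOpen_eval v w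
    exact this.preimage continuous_subtype_val

/-- The group-theoretic compactification of the set of vertices. -/
def gpVertices (G : Subgroup (X ≃g X)) : Set (ClosedSubgroup G) :=
  closure (range (vertexStabilizer G))

end Chabauty

/-! ### Probability measures on the boundary -/

section Measures

variable {X : SimpleGraph V}

/-- The action of `G` on the probability measures on the boundary, by push-forward. -/
noncomputable def measAction (G : Subgroup (X ≃g X)) (g : G)
    (ν : ProbabilityMeasure (Boundary X)) : ProbabilityMeasure (Boundary X) :=
  ν.map (f := fun ξ => g • ξ) (continuous_const_smul (g : X ≃g X)).measurable.aemeasurable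

end Measures

/-! ### Compactifications and equivariant homeomorphisms -/

/-- The closure of the image of `ι : S → Y` is a compactification of the discrete set `S`. -/
def IsCompactification {S Y : Type*} [TopologicalSpace Y] (ι : S → Y) : Prop :=
  IsCompact (closure (range ι)) ∧ T2Space (closure (range ι)) ∧
    @IsEmbedding S Y ⊥ _ ι

/-- `A` and `B` are stable under the given actions of `Γ`, and `f : A → B` is equivariant. -/
def IsEquivariant {Γ Y Z : Type*} (α : Γ → Y → Y) (β : Γ → Z → Z) {A : Set Y} {B : Set Z}
    (f : A → B) : Prop :=
  (∀ g, ∀ z ∈ B, β g z ∈ B) ∧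
    ∀ (g : Γ) (y : A), ∃ h : α g y ∈ A, (f ⟨α g y, h⟩ : Z) = β g (f y)

end TreeComp

/-! All four spaces are compared with one combinatorial model, the space `Horo X` of abstract
Busemann cocycles `c : V → V → ℤ`: additive, equal to `±1` on edges, and with at most one descending
edge (`c a b = 1`) at each vertex. If some vertex has no descending edge, then `c` is the difference
of distances to this vertex (`Horo.eq_vertex_of_forall_adj`). Otherwise, following the descending
edges gives a ray whose Busemann cocycle is `c` (`Horo.exists_ray_of_step`). Cocycles of rays
coincide exactly when the rays are asymptotic, so `Horo X` is the disjoint union of `V` and the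
boundary. Being closed in a product of finite intervals, it is compact and Hausdorff. Local
finiteness makes vertices isolated. The shadow of an edge corresponds to the clopen set `c a b = 1`
(`Horo.toGeom_mem_shadow`), so `Horo X` is homeomorphic to `geomVertices X`.

For groups and measures it then suffices (`Horo.exists_homeo`) to give a continuous injective
equivariant map from `Horo X` to a Hausdorff space. The input on `G` is strong transitivity
(`exists_smul_line`): transitivity on spheres gives elements matching two lines on finite windows,
and compactness of vertex stabilizers gives a single element for the whole lines.

Groups: `K_v` and `D_ξ` are both the group of those `g` with `c (g • u) u = 0` for all `u`. This
condition is closed in `(c, g)`, which is half of Chabauty continuity. For the other half, a point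
near the end of a ray is `h • y` with `h` close to `1` and `y` far on the ray or its endpoint. An
element `g` of `D_ξ` fixes the ray far away, so `h g h⁻¹` belongs to the group of `h • y`, and it
differs from `g` by a small commutator. Injectivity uses branching, which produces elements of one
group moving the other point.

Measures: `μ_v` is the image of the Haar measure of `K_v` under an orbit map. Invariance gives equal
mass to all cylinders of the same depth, whence uniqueness. Branching makes these masses decay
geometrically, whence convergence to Dirac masses. Injectivity on vertices is a mass count
(`IsStabilizerInvariant.eq_of_both`).

Polyhedral compactification: `[g, x] ↦ g.x` is continuous. By strong transitivity it is injective on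
`polVertices G L`, which is the image of the product of a vertex stabilizer and a closed half-line,
hence compact. The map is thus a homeomorphism onto the Hausdorff space `geomVertices X`. -/

namespace TreeComp

/-! ### Distances and geodesics in a tree. -/

section TreeMetric

variable {V : Type*} {X : SimpleGraph V}

lemma exists_adj_dist_eq (hX : X.Connected) {u v : V} (h : u ≠ v) :
    ∃ w, X.Adj u w ∧ X.dist u v = X.dist w v + 1 := by
  obtain ⟨p, hp⟩ := hX.exists_walk_length_eq_dist u v
  cases p with
  | nil => exact (h rfl).elim
  | cons hadj q =>
    rename_i w
    refine ⟨w, hadj, le_antisymm ?_ ?_⟩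
    · have := hX.dist_triangle (u := u) (v := w) (w := v)
      rw [SimpleGraph.dist_eq_one_iff_adj.2 hadj] at this
      omega
    · rw [← hp, SimpleGraph.Walk.length_cons]
      exact Nat.add_le_add_right (SimpleGraph.dist_le q) 1

/-- Both neighbours start a shortest walk from `a` to `w`. Shortest walks are paths, and a tree has
only one path between two vertices. -/
lemma adj_unique_of_dist (hX : X.IsTree) {a b b' w : V} (hb : X.Adj a b) (hb' : X.Adj a b')
    (h : X.dist a w = X.dist b w + 1) (h' : X.dist a w = X.dist b' w + 1) : b = b' := by
  obtain ⟨p, hp⟩ := hX.connected.exists_walk_length_eq_dist b w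
  obtain ⟨q, hq⟩ := hX.connected.exists_walk_length_eq_dist b' w
  have h1 : (SimpleGraph.Walk.cons hb p).IsPath :=
    SimpleGraph.Walk.isPath_of_length_eq_dist _ (by rw [SimpleGraph.Walk.length_cons, hp, h])
  have h2 : (SimpleGraph.Walk.cons hb' q).IsPath :=
    SimpleGraph.Walk.isPath_of_length_eq_dist _ (by rw [SimpleGraph.Walk.length_cons, hq, h'])
  have := (hX.existsUnique_path a w).unique h1 h2
  cases this
  rfl

lemma dist_adj_cases (hX : X.IsTree) {a b : V} (hab : X.Adj a b) (w : V) :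
    X.dist a w = X.dist b w + 1 ∨ X.dist b w = X.dist a w + 1 := by
  have := hX.dist_eq_dist_add_one_of_adj w hab
  rwa [SimpleGraph.dist_comm (u := w), SimpleGraph.dist_comm (u := w)] at this

/-- The first steps from `a` towards `z` and `z'` both approach `b`, so they coincide; the rest is
induction along the geodesic. -/
lemma eq_of_dist_add (hX : X.IsTree) {a b z z' : V} (hz : X.dist a z + X.dist z b = X.dist a b)
    (hz' : X.dist a z' + X.dist z' b = X.dist a b) (h : X.dist a z = X.dist a z') : z = z' := by
  induction hn : X.dist a z generalizing a with
  | zero =>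
    exact ((hX.connected.dist_eq_zero_iff).1 hn).symm.trans
      ((hX.connected.dist_eq_zero_iff).1 (h ▸ hn))
  | succ n ih =>
    have ha : a ≠ z := by rintro rfl; simp at hn
    have ha' : a ≠ z' := by rintro rfl; rw [SimpleGraph.dist_self] at h; omega
    obtain ⟨c, hc, hcd⟩ := exists_adj_dist_eq hX.connected ha
    obtain ⟨c', hc', hcd'⟩ := exists_adj_dist_eq hX.connected ha'
    have h1 := hX.connected.dist_triangle (u := c) (v := z) (w := b)
    have h1' := hX.connected.dist_triangle (u := c') (v := z') (w := b)
    have h2 := dist_adj_cases hX hc b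
    have h2' := dist_adj_cases hX hc' b
    have : c = c' := adj_unique_of_dist hX hc hc' (w := b) (by omega) (by omega)
    subst this
    exact ih (a := c) (by omega) (by omega) (by omega) (by omega)

end TreeMetric

/-! ### Rays and lines. -/

section Geodesics

variable {V : Type*} {X : SimpleGraph V}

lemma GeodesicRay.dist_of_le (r : GeodesicRay X) {m n : ℕ} (h : m ≤ n) :
    X.dist (r.toFun m) (r.toFun n) = n - m := by
  obtain ⟨k, rfl⟩ := Nat.exists_eq_add_of_le h
  rw [r.dist_eq]
  omega

lemma GeodesicRay.adj (r : GeodesicRay X) (n : ℕ) : X.Adj (r.toFun n) (r.toFun (n + 1)) :=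
  SimpleGraph.dist_eq_one_iff_adj.1 (r.dist_eq n 1)

@[ext]
lemma GeodesicRay.ext {r s : GeodesicRay X} (h : ∀ n, r.toFun n = s.toFun n) : r = s := by
  cases r
  cases s
  congr
  exact funext h

lemma GeodesicLine.dist_natAbs (L : GeodesicLine X) (m n : ℤ) :
    X.dist (L.toFun m) (L.toFun n) = (n - m).natAbs := by
  rcases le_total m n with h | h
  · have := L.dist_eq m (n - m).toNat
    rw [Int.toNat_of_nonneg (by omega)] at this
    rw [show m + (n - m) = n by ring] at this
    omega
  · have := L.dist_eq n (m - n).toNat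
    rw [Int.toNat_of_nonneg (by omega)] at this
    rw [show n + (m - n) = m by ring, SimpleGraph.dist_comm] at this
    omega

/-- The distance to a fixed vertex eventually increases by one at each step of a ray. -/
lemma GeodesicRay.eventually_dist_succ (hX : X.IsTree) (r : GeodesicRay X) (u : V) :
    ∀ᶠ n in atTop, X.dist (r.toFun (n + 1)) u = X.dist (r.toFun n) u + 1 := by
  have key : ∀ n, X.dist (r.toFun (n + 1)) u = X.dist (r.toFun n) u + 1 →
      X.dist (r.toFun (n + 2)) u = X.dist (r.toFun (n + 1)) u + 1 := by
    intro n hn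
    rcases dist_adj_cases hX (r.adj (n + 1)) u with h | h
    -- A step approaching `u` right after a step away from it would have to backtrack, which a ray
    -- never does.
    · have := adj_unique_of_dist hX (r.adj (n + 1)) (r.adj n).symm h hn
      have h2 := r.dist_of_le (m := n) (n := n + 1 + 1) (by omega)
      rw [this, SimpleGraph.dist_self] at h2
      omega
    · exact h
  -- A ray cannot approach `u` at more than `X.dist (r.toFun 0) u` consecutive steps.
  have ex : ∃ n, X.dist (r.toFun (n + 1)) u = X.dist (r.toFun n) u + 1 := by
    by_contra! h
    have : ∀ n, X.dist (r.toFun n) u + n = X.dist (r.toFun 0) u := by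
      intro n
      induction n with
      | zero => rfl
      | succ n ih =>
        rcases dist_adj_cases hX (r.adj n) u with h1 | h1
        · omega
        · exact (h n h1).elim
    have := this (X.dist (r.toFun 0) u + 1)
    omega
  obtain ⟨N, hN⟩ := ex
  refine eventually_atTop.2 ⟨N, fun n hn => ?_⟩
  induction n, hn using Nat.le_induction with
  | base => exact hN
  | succ n _ ih => exact key n ih

end Geodesics

/-! ### Busemann cocycles and their classification. -/

section Horo

variable {V : Type*}

/-- Abstract Busemann cocycles of a tree: from each vertex at most one edge descends. -/
structure IsHoro (X : SimpleGraph V) (c : V → V → ℤ) : Prop where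
  add : ∀ u v w, c u v + c v w = c u w
  adj : ∀ a b, X.Adj a b → c a b = 1 ∨ c a b = -1
  unique : ∀ a b b', X.Adj a b → X.Adj a b' → c a b = 1 → c a b' = 1 → b = b'

/-- The space of Busemann cocycles. -/
structure Horo (X : SimpleGraph V) where
  toFun : V → V → ℤ
  isHoro : IsHoro X toFun

namespace Horo

variable {X : SimpleGraph V}

instance : CoeFun (Horo X) (fun _ => V → V → ℤ) := ⟨Horo.toFun⟩

instance : TopologicalSpace (Horo X) := TopologicalSpace.induced toFun inferInstance

@[ext]
lemma ext {c d : Horo X} (h : ∀ u v, c u v = d u v) : c = d := by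
  cases c
  cases d
  congr
  exact funext fun u => funext fun v => h u v

lemma add (c : Horo X) (u v w : V) : c u v + c v w = c u w := c.isHoro.add u v w

lemma self (c : Horo X) (u : V) : c u u = 0 := by
  have := c.add u u u
  omega

lemma swap (c : Horo X) (u v : V) : c v u = -c u v := by
  have := c.add u v u
  rw [c.self] at this
  omega

lemma le_dist (hX : X.Connected) (c : Horo X) (u v : V) : |c u v| ≤ X.dist u v := by
  have key : ∀ {u v : V} (p : X.Walk u v), |c u v| ≤ p.length := by
    intro u v p
    induction p with
    | nil => simp [c.self]
    | cons h q ih =>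
      rename_i a b d
      have h1 := c.add a b d
      have h2 := c.isHoro.adj a b h
      rw [SimpleGraph.Walk.length_cons]
      push_cast
      rw [abs_le] at ih ⊢
      omega
  obtain ⟨p, hp⟩ := hX.exists_walk_length_eq_dist u v
  rw [← hp]
  exact key p

/-- Once an edge has been climbed from `a` to `b`, the only descending edge at `b` leads back to
`a`. Every continuation without backtracking therefore climbs too, and so on up to `x`. -/
lemma ascend (hX : X.IsTree) (c : Horo X) {a b x : V} (hab : X.Adj a b) (h : c a b = -1)
    (hx : X.dist a x = X.dist b x + 1) : c a x = -X.dist a x := by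
  induction hn : X.dist b x generalizing a b with
  | zero =>
    rw [← (hX.connected.dist_eq_zero_iff).1 hn]
    have h2 := SimpleGraph.dist_eq_one_iff_adj.2 hab
    rw [h, h2]
    rfl
  | succ n ih =>
    have hb : b ≠ x := by rintro rfl; simp at hn
    obtain ⟨d, hd, hdx⟩ := exists_adj_dist_eq hX.connected hb
    have h1 : c b d = -1 := by
      refine (c.isHoro.adj b d hd).resolve_left fun h1 => ?_
      have := c.isHoro.unique b d a hd hab.symm h1 (by rw [c.swap, h]; rfl)
      subst this
      omega
    have h2 := ih hd h1 hdx (by omega)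
    have h3 := c.add a b x
    omega

lemma eq_of_adj (hX : X.Connected) {c d : Horo X} (h : ∀ a b, X.Adj a b → c a b = d a b) :
    c = d := by
  ext u v
  obtain ⟨p⟩ := hX u v
  induction p with
  | nil => rw [c.self, d.self]
  | cons hadj q ih =>
    rw [← c.add _ _ _, ← d.add _ _ _, ih, h _ _ hadj]

/-- The cocycle of a vertex. -/
noncomputable def vertex [hX : Fact X.IsTree] (w : V) : Horo X :=
  ⟨fun u v => X.dist u w - X.dist v w,
    { add := fun u v w => by ring
      adj := fun a b hab => by
        rcases dist_adj_cases hX.out hab w with h | h <;> omega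
      unique := fun a b b' hb hb' h h' =>
        adj_unique_of_dist hX.out hb hb' (w := w) (by omega) (by omega) }⟩

lemma vertex_apply [Fact X.IsTree] (w u v : V) :
    (vertex w : Horo X) u v = X.dist u w - X.dist v w := rfl

lemma vertex_injective [hX : Fact X.IsTree] : Function.Injective (vertex : V → Horo X) := by
  intro v w h
  have h1 : (vertex v : Horo X) v w = (vertex w : Horo X) v w := by rw [h]
  rw [vertex_apply, vertex_apply, SimpleGraph.dist_self, SimpleGraph.dist_self,
    SimpleGraph.dist_comm] at h1
  exact (hX.out.connected.dist_eq_zero_iff).1 (by omega)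

/-- `dist u v - dist u' v` is eventually constant along a ray. -/
lemma exists_limit (hX : X.IsTree) (r : GeodesicRay X) (u v : V) :
    ∃ k : ℤ, ∀ᶠ n in atTop, (X.dist u (r.toFun n) : ℤ) - X.dist v (r.toFun n) = k := by
  obtain ⟨N, hN⟩ := eventually_atTop.1
    ((r.eventually_dist_succ hX u).and (r.eventually_dist_succ hX v))
  refine ⟨(X.dist u (r.toFun N) : ℤ) - X.dist v (r.toFun N),
    eventually_atTop.2 ⟨N, fun n hn => ?_⟩⟩
  induction n, hn using Nat.le_induction with
  | base => rfl
  | succ n hn ih =>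
    have := hN n hn
    rw [← ih, SimpleGraph.dist_comm (u := u), SimpleGraph.dist_comm (u := v), this.1, this.2,
      SimpleGraph.dist_comm (u := u), SimpleGraph.dist_comm (u := v)]
    push_cast
    ring

/-- The Busemann cocycle of a ray. -/
noncomputable def ofRay [hX : Fact X.IsTree] (r : GeodesicRay X) : Horo X :=
  have h := fun u v => (exists_limit hX.out r u v).choose_spec
  ⟨fun u v => (exists_limit hX.out r u v).choose,
    { add := fun u v w => by
        obtain ⟨n, ⟨h1, h2⟩, h3⟩ := (((h u v).and (h v w)).and (h u w)).exists
        rw [← h1, ← h2, ← h3]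
        ring
      adj := fun a b hab => by
        obtain ⟨n, h1⟩ := (h a b).exists
        rw [← h1]
        rcases dist_adj_cases hX.out hab (r.toFun n) with h | h <;> omega
      unique := fun a b b' hb hb' k k' => by
        obtain ⟨n, h1, h2⟩ := ((h a b).and (h a b')).exists
        rw [k] at h1
        rw [k'] at h2
        exact adj_unique_of_dist hX.out hb hb' (w := r.toFun n) (by omega) (by omega) }⟩

variable [hX : Fact X.IsTree]

lemma ofRay_eventually (r : GeodesicRay X) (u v : V) :
    ∀ᶠ n in atTop, (X.dist u (r.toFun n) : ℤ) - X.dist v (r.toFun n) = ofRay r u v :=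
  (exists_limit hX.out r u v).choose_spec

lemma ofRay_eq_of_eventually {r : GeodesicRay X} {u v : V} {k : ℤ}
    (h : ∀ᶠ n in atTop, (X.dist u (r.toFun n) : ℤ) - X.dist v (r.toFun n) = k) :
    ofRay r u v = k := by
  obtain ⟨n, h1, h2⟩ := ((ofRay_eventually r u v).and h).exists
  omega

lemma ofRay_ray (r : GeodesicRay X) (m n : ℕ) :
    ofRay r (r.toFun m) (r.toFun n) = n - m := by
  refine ofRay_eq_of_eventually (eventually_atTop.2 ⟨m + n, fun k hk => ?_⟩)
  rw [r.dist_of_le (by omega), r.dist_of_le (by omega)]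
  omega

/-- All edges at `w` climb, so `ascend` computes `c w u` for every `u`, and additivity gives the
other values. -/
lemma eq_vertex_of_forall_adj {c : Horo X} {w : V} (hw : ∀ b, X.Adj w b → c w b ≠ 1) :
    c = vertex w := by
  have key : ∀ u, c w u = -X.dist w u := by
    intro u
    by_cases hu : w = u
    · subst hu
      simp [c.self]
    · obtain ⟨b, hb, hbu⟩ := exists_adj_dist_eq hX.out.connected hu
      exact c.ascend hX.out hb ((c.isHoro.adj w b hb).resolve_left (hw b hb)) hbu
  ext u v
  rw [vertex_apply, ← c.add u w v, c.swap w u, key, key, SimpleGraph.dist_comm (v := u),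
    SimpleGraph.dist_comm (v := v)]
  ring

lemma vertex_or_step (c : Horo X) : (∃ w, c = vertex w) ∨ ∀ a, ∃ b, X.Adj a b ∧ c a b = 1 := by
  by_cases h : ∀ a, ∃ b, X.Adj a b ∧ c a b = 1
  · exact Or.inr h
  push Not at h
  obtain ⟨w, hw⟩ := h
  exact Or.inl ⟨w, eq_vertex_of_forall_adj hw⟩

lemma eventually_apply_eq_dist (c : Horo X) (r : GeodesicRay X)
    (h : ∀ n, c (r.toFun n) (r.toFun (n + 1)) = 1) (u : V) :
    ∀ᶠ n in atTop, c u (r.toFun n) = X.dist u (r.toFun n) := by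
  obtain ⟨N, hN⟩ := eventually_atTop.1 (r.eventually_dist_succ hX.out u)
  refine eventually_atTop.2 ⟨N + 1, fun n hn => ?_⟩
  obtain ⟨n, rfl⟩ : ∃ m, n = m + 1 := ⟨n - 1, by omega⟩
  rw [c.swap, c.ascend hX.out (r.adj n).symm (by rw [c.swap, h]) (hN n (by omega)),
    SimpleGraph.dist_comm, neg_neg]

/-- Iterate the choice of a descending edge from `v`. After `k` steps `c` has gained `k`, and
`le_dist` bounds this gain by the distance, so the path is geodesic. -/
lemma exists_ray_of_step {c : Horo X} (h : ∀ a, ∃ b, X.Adj a b ∧ c a b = 1) (v : V) :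
    ∃ r : GeodesicRay X, r.toFun 0 = v ∧ c = ofRay r := by
  choose σ hσ hc using h
  have key : ∀ m k : ℕ, c (σ^[m] v) (σ^[m + k] v) = k := by
    intro m k
    induction k with
    | zero => simp [c.self]
    | succ k ih =>
      rw [← c.add _ (σ^[m + k] v), ih, ← add_assoc, Function.iterate_succ_apply', hc]
      push_cast
      rfl
  have hle : ∀ m k : ℕ, X.dist (σ^[m] v) (σ^[m + k] v) ≤ k := by
    intro m k
    induction k with
    | zero => simp
    | succ k ih =>
      have := hX.out.connected.dist_triangle (u := σ^[m] v) (v := σ^[m + k] v)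
        (w := σ^[m + (k + 1)] v)
      have h1 : X.dist (σ^[m + k] v) (σ^[m + (k + 1)] v) = 1 := by
        rw [← add_assoc, Function.iterate_succ_apply']
        exact SimpleGraph.dist_eq_one_iff_adj.2 (hσ _)
      omega
  let r : GeodesicRay X :=
    ⟨fun n => σ^[n] v, fun m k => by
      have h1 := c.le_dist hX.out.connected (σ^[m] v) (σ^[m + k] v)
      rw [key, abs_of_nonneg (by omega)] at h1
      have := hle m k
      omega⟩
  refine ⟨r, rfl, ?_⟩
  -- Far along the ray `c u (r n)` is a distance, so `c u v` is the difference of distances defining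
  -- the Busemann cocycle.
  have far := c.eventually_apply_eq_dist r fun n => key n 1
  ext u v
  symm
  refine ofRay_eq_of_eventually ?_
  filter_upwards [far u, far v] with n h1 h2
  have h3 := c.add u (r.toFun n) v
  have h4 := c.swap v (r.toFun n)
  rw [← h1, ← h2]
  omega

lemma cases (c : Horo X) : (∃ w, c = vertex w) ∨ ∃ r, c = ofRay r := by
  refine c.vertex_or_step.imp_right fun h => ?_
  obtain ⟨r, -, hr⟩ := exists_ray_of_step h hX.out.connected.nonempty.some
  exact ⟨r, hr⟩

end Horo

end Horo

namespace Horo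

/-! ### Asymptotic rays and their cocycles. -/

section Rays

variable {V : Type*} {X : SimpleGraph V} [hX : Fact X.IsTree]

/-- The vertex at a given distance from `u` on the geodesic from `u` towards a point is unique. -/
lemma eq_of_apply_eq_dist (c : Horo X) {u v v' : V} (h : c u v = X.dist u v)
    (h' : c u v' = X.dist u v') (hd : X.dist u v = X.dist u v') : v = v' := by
  have hcon := hX.out.connected
  induction hn : X.dist u v generalizing u with
  | zero =>
    exact ((hcon.dist_eq_zero_iff).1 hn).symm.trans ((hcon.dist_eq_zero_iff).1 (hd ▸ hn))
  | succ n ih =>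
    have step : ∀ {z}, c u z = X.dist u z → X.dist u z = n + 1 →
        ∃ b, X.Adj u b ∧ c u b = 1 ∧ c b z = X.dist b z ∧ X.dist b z = n := by
      intro z hz hzn
      have hu : u ≠ z := by rintro rfl; simp at hzn
      obtain ⟨b, hb, hbz⟩ := exists_adj_dist_eq hcon hu
      have h1 := abs_le.1 (c.le_dist hcon b z)
      have h2 := c.isHoro.adj u b hb
      have h3 := c.add u b z
      refine ⟨b, hb, by omega, by omega, by omega⟩
    obtain ⟨b, hb, hb1, hb2, hb3⟩ := step h hn
    obtain ⟨b', hb', hb1', hb2', hb3'⟩ := step h' (by omega)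
    have := c.isHoro.unique u b b' hb hb' hb1 hb1'
    subst this
    exact ih hb2 hb2' (by omega) hb3

/-- Seen from the origin of the ray, its cocycle is unbounded above, while that of `w` never exceeds
the distance to `w`. -/
lemma ofRay_ne_vertex (r : GeodesicRay X) (w : V) : ofRay r ≠ vertex w := by
  intro h
  have h1 := ofRay_ray r 0 (X.dist (r.toFun 0) w + 1)
  rw [h, vertex_apply] at h1
  push_cast at h1
  omega

lemma exists_step_ofRay (r : GeodesicRay X) (a : V) : ∃ b, X.Adj a b ∧ ofRay r a b = 1 :=
  (vertex_or_step (ofRay r)).resolve_left (fun ⟨w, hw⟩ => ofRay_ne_vertex r w hw) a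

lemma exists_ray_from (r : GeodesicRay X) (v : V) :
    ∃ s : GeodesicRay X, s.toFun 0 = v ∧ ofRay r = ofRay s :=
  exists_ray_of_step (exists_step_ofRay r) v

lemma ray_mem (r : GeodesicRay X) (n : ℕ) :
    ofRay r (r.toFun 0) (r.toFun n) = X.dist (r.toFun 0) (r.toFun n) := by
  rw [ofRay_ray, r.dist_of_le (Nat.zero_le n)]
  simp

lemma eq_ray_of_apply_eq_dist (r : GeodesicRay X) {v : V}
    (h : ofRay r (r.toFun 0) v = X.dist (r.toFun 0) v) :
    r.toFun (X.dist (r.toFun 0) v) = v := by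
  refine eq_of_apply_eq_dist (ofRay r) (ray_mem r _) h ?_
  rw [r.dist_of_le (Nat.zero_le _)]
  simp

lemma ray_unique {r s : GeodesicRay X} (h : ofRay r = ofRay s) (h0 : r.toFun 0 = s.toFun 0) :
    r = s := by
  ext n
  refine eq_of_apply_eq_dist (ofRay r) (ray_mem r n) ?_ ?_
  · rw [h, h0, ray_mem]
  · rw [r.dist_of_le (Nat.zero_le n), h0, s.dist_of_le (Nat.zero_le n)]

/-- Two rays with the same Busemann cocycle eventually merge. -/
lemma exists_merge {r s : GeodesicRay X} (h : ofRay r = ofRay s) :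
    ∃ i j, ∀ k, r.toFun (i + k) = s.toFun (j + k) := by
  have hr : ∀ n, ofRay r (r.toFun n) (r.toFun (n + 1)) = 1 := fun n => by
    rw [ofRay_ray]
    push_cast
    ring
  -- At this `r i` the cocycle from the origin of `s` attains the bound of `le_dist`. The same then
  -- holds at all later points of `r`, which forces them onto `s`.
  obtain ⟨i, hi⟩ := ((ofRay r).eventually_apply_eq_dist r hr (s.toFun 0)).exists
  refine ⟨i, X.dist (s.toFun 0) (r.toFun i), fun k => ?_⟩
  have h1 := (ofRay r).add (s.toFun 0) (r.toFun i) (r.toFun (i + k))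
  have h2 := ofRay_ray r i (i + k)
  have h3 := hX.out.connected.dist_triangle (u := s.toFun 0) (v := r.toFun i) (w := r.toFun (i + k))
  have h4 := (abs_le.1 ((ofRay r).le_dist hX.out.connected (s.toFun 0) (r.toFun (i + k)))).2
  have h5 := r.dist_eq i k
  push_cast at h2
  have h6 := eq_ray_of_apply_eq_dist s (v := r.toFun (i + k)) (by rw [← h]; omega)
  rw [← h6]
  congr 1
  omega

lemma endpoint_eq_of_ofRay_eq {r s : GeodesicRay X} (h : ofRay r = ofRay s) :
    r.endpoint = s.endpoint := by
  have hcon := hX.out.connected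
  obtain ⟨i, j, hij⟩ := exists_merge h
  -- After the merging time the two points differ by the shift between `i` and `j`. Before it, going
  -- through the two origins costs at most `2 * i` plus the distance between them.
  refine Quotient.sound ⟨2 * (i + j) + X.dist (r.toFun 0) (s.toFun 0), fun n => ?_⟩
  rw [← (hcon _ _).coe_dist_eq_edist, Nat.cast_le]
  rcases le_or_gt i n with hn | hn
  · obtain ⟨k, rfl⟩ := Nat.exists_eq_add_of_le hn
    rw [hij]
    rcases le_total (j + k) (i + k) with hk | hk
    · rw [s.dist_of_le hk]
      omega
    · rw [SimpleGraph.dist_comm, s.dist_of_le hk]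
      omega
  · have h1 := hcon.dist_triangle (u := r.toFun n) (v := r.toFun 0) (w := s.toFun n)
    have h2 := hcon.dist_triangle (u := r.toFun 0) (v := s.toFun 0) (w := s.toFun n)
    rw [SimpleGraph.dist_comm (v := r.toFun 0), r.dist_of_le (Nat.zero_le n)] at h1
    rw [s.dist_of_le (Nat.zero_le n)] at h2
    omega

lemma ofRay_eq_of_endpoint_eq {r s : GeodesicRay X} (h : r.endpoint = s.endpoint) :
    ofRay r = ofRay s := by
  have hcon := hX.out.connected
  obtain ⟨C, hC⟩ : ∃ C : ℕ, ∀ n, X.edist (r.toFun n) (s.toFun n) ≤ C := Quotient.exact h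
  have hC' : ∀ n, X.dist (r.toFun n) (s.toFun n) ≤ C := fun n => by
    have := hC n
    rwa [← (hcon _ _).coe_dist_eq_edist, Nat.cast_le] at this
  have key : ∀ a b, X.Adj a b → ofRay r a b = 1 → ofRay s a b = 1 := by
    intro a b hab h1
    refine ((ofRay s).isHoro.adj a b hab).resolve_right fun h2 => ?_
    -- If `[a;b]` descends for `r` and climbs for `s`, it separates `r n` from `s n`. The geodesic
    -- between them passes through `a`, so it is longer than `C` for such `n`.
    obtain ⟨n, ⟨hr, hs⟩, hn⟩ := (((ofRay_eventually r a b).and (ofRay_eventually s a b)).and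
      (eventually_ge_atTop (C + X.dist a (r.toFun 0) + 1))).exists
    have h3 := (vertex (s.toFun n)).ascend hX.out (x := r.toFun n) hab
      (by rw [vertex_apply, hs, h2]) (by omega)
    rw [vertex_apply] at h3
    have h4 := hC' n
    have h5 := hcon.dist_triangle (u := r.toFun 0) (v := a) (w := r.toFun n)
    rw [r.dist_of_le (Nat.zero_le n), SimpleGraph.dist_comm] at h5
    omega
  refine eq_of_adj hcon fun a b hab => ?_
  rcases (ofRay r).isHoro.adj a b hab with h1 | h1
  · rw [h1, key a b hab h1]
  · rw [h1, (ofRay s).swap b a, key b a hab.symm (by rw [(ofRay r).swap a b, h1, neg_neg])]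

end Rays

/-! ### Action of automorphisms on cocycles, and compactness. -/

section Action

variable {V : Type*} {X : SimpleGraph V}

instance : MulAction (X ≃g X) (Horo X) where
  smul g c := ⟨fun u v => c (g⁻¹ u) (g⁻¹ v),
    { add := fun _ _ _ => c.add _ _ _
      adj := fun _ _ hab => c.isHoro.adj _ _ ((g⁻¹).map_adj_iff.2 hab)
      unique := fun _ _ _ hb hb' h h' => (g⁻¹).injective
        (c.isHoro.unique _ _ _ ((g⁻¹).map_adj_iff.2 hb) ((g⁻¹).map_adj_iff.2 hb') h h') }⟩
  one_smul _ := rfl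
  mul_smul _ _ _ := rfl

lemma smul_apply (g : X ≃g X) (c : Horo X) (u v : V) : (g • c) u v = c (g⁻¹ u) (g⁻¹ v) := rfl

lemma smul_apply_apply (g : X ≃g X) (c : Horo X) (u v : V) : (g • c) (g u) (g v) = c u v := by
  rw [smul_apply, RelIso.inv_apply_self, RelIso.inv_apply_self]

lemma smul_vertex [Fact X.IsTree] (g : X ≃g X) (w : V) :
    g • (vertex w : Horo X) = vertex (g w) := by
  ext u v
  rw [smul_apply, vertex_apply, vertex_apply, ← dist_map g, ← dist_map g (g⁻¹ v),
    RelIso.apply_inv_self, RelIso.apply_inv_self]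

lemma smul_ofRay [Fact X.IsTree] (g : X ≃g X) (r : GeodesicRay X) :
    g • ofRay r = ofRay (g • r) := by
  ext u v
  symm
  refine ofRay_eq_of_eventually ((ofRay_eventually r (g⁻¹ u) (g⁻¹ v)).mono fun n hn => ?_)
  rw [smul_apply, ← hn, ← dist_map g (g⁻¹ u), ← dist_map g (g⁻¹ v),
    RelIso.apply_inv_self, RelIso.apply_inv_self]
  rfl

lemma isInducing_toFun : IsInducing (toFun : Horo X → V → V → ℤ) := ⟨rfl⟩

lemma toFun_injective : Function.Injective (toFun : Horo X → V → V → ℤ) :=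
  fun c d h => ext fun u v => by rw [h]

lemma continuous_eval (u v : V) : Continuous fun c : Horo X => c u v :=
  (continuous_apply v).comp ((continuous_apply u).comp isInducing_toFun.continuous)

lemma continuous_rng {Y : Type*} [TopologicalSpace Y] {f : Y → Horo X}
    (h : ∀ u v, Continuous fun y => f y u v) : Continuous f :=
  continuous_induced_rng.2 (continuous_pi fun u => continuous_pi fun v => h u v)

instance : T2Space (Horo X) :=
  (IsEmbedding.mk isInducing_toFun toFun_injective).t2Space

lemma eventually_apply_eq (c₀ : Horo X) (u v : V) : ∀ᶠ c : Horo X in 𝓝 c₀, c u v = c₀ u v :=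
  (continuous_eval u v).continuousAt.eventually (p := fun k => k = c₀ u v) (by simp)

lemma isClopen_setOf_apply_eq (u v : V) (k : ℤ) : IsClopen {c : Horo X | c u v = k} :=
  (isClopen_discrete {k}).preimage (continuous_eval u v)

lemma isClosed_setOf_isHoro : IsClosed {c : V → V → ℤ | IsHoro X c} := by
  have ev : ∀ u v, Continuous fun c : V → V → ℤ => c u v := fun u v =>
    (continuous_apply v).comp (continuous_apply u)
  have : {c : V → V → ℤ | IsHoro X c} =
      (⋂ u, ⋂ v, ⋂ w, {c | c u v + c v w = c u w}) ∩
      (⋂ a, ⋂ b, ⋂ (_ : X.Adj a b), {c | c a b = 1 ∨ c a b = -1}) ∩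
      (⋂ a, ⋂ b, ⋂ b', ⋂ (_ : X.Adj a b), ⋂ (_ : X.Adj a b'),
        {c | c a b = 1 → c a b' = 1 → b = b'}) := by
    ext c
    simp only [mem_inter_iff, mem_iInter, mem_ofPred_eq]
    exact ⟨fun h => ⟨⟨h.add, h.adj⟩, h.unique⟩, fun h => ⟨h.1.1, h.1.2, h.2⟩⟩
  rw [this]
  refine ((isClosed_iInter fun u => isClosed_iInter fun v => isClosed_iInter fun w =>
    isClosed_eq ((ev u v).add (ev v w)) (ev u w)).inter
    (isClosed_iInter fun a => isClosed_iInter fun b => isClosed_iInter fun _ => ?_)).inter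
    (isClosed_iInter fun a => isClosed_iInter fun b => isClosed_iInter fun b' =>
      isClosed_iInter fun _ => isClosed_iInter fun _ => ?_)
  · exact (isClosed_discrete {k : ℤ | k = 1 ∨ k = -1}).preimage (ev a b)
  · exact (isClosed_discrete {k : ℤ × ℤ | k.1 = 1 → k.2 = 1 → b = b'}).preimage
      ((ev a b).prodMk (ev a b'))

lemma isClosedEmbedding_toFun : IsClosedEmbedding (toFun : Horo X → V → V → ℤ) where
  toIsEmbedding := ⟨isInducing_toFun, toFun_injective⟩
  isClosed_range := by
    convert isClosed_setOf_isHoro (X := X) using 1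
    ext c
    exact ⟨fun ⟨d, hd⟩ => hd ▸ d.isHoro, fun h => ⟨⟨c, h⟩, rfl⟩⟩

/-- By `le_dist` the value at `(u, v)` lies in a finite interval, so Tychonoff applies to the closed
set of cocycles. -/
instance [hX : Fact X.IsTree] : CompactSpace (Horo X) := by
  refine ⟨?_⟩
  have hK : IsCompact (Set.pi univ fun u : V => Set.pi univ fun v : V =>
      Icc (-(X.dist u v : ℤ)) (X.dist u v)) :=
    isCompact_univ_pi fun u => isCompact_univ_pi fun v => isCompact_Icc
  have := (isClosedEmbedding_toFun (X := X)).isCompact_preimage hK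
  convert this
  symm
  rw [eq_univ_iff_forall]
  intro c u _ v _
  exact abs_le.1 (c.le_dist hX.out.connected u v)

end Action

end Horo

/-! ### Joint continuity of the action on cocycles. -/

section AutTopology

variable {V : Type*} {X : SimpleGraph V}

lemma eventually_eval_eq (g₀ : X ≃g X) (u : V) : ∀ᶠ g : X ≃g X in 𝓝 g₀, g u = g₀ u :=
  (isOpen_eval u (g₀ u)).mem_nhds rfl

lemma eventually_inv_eval_eq (g₀ : X ≃g X) (u : V) :
    ∀ᶠ g : X ≃g X in 𝓝 g₀, g⁻¹ u = g₀⁻¹ u :=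
  (continuous_inv.tendsto g₀).eventually (eventually_eval_eq g₀⁻¹ u)

instance : ContinuousSMul (X ≃g X) (Horo X) where
  continuous_smul := by
    refine Horo.continuous_rng fun u v => continuous_iff_continuousAt.2 fun ⟨g₀, c₀⟩ => ?_
    have h : Continuous fun p : (X ≃g X) × Horo X => p.2 (g₀⁻¹ u) (g₀⁻¹ v) :=
      (Horo.continuous_eval _ _).comp continuous_snd
    refine h.continuousAt.congr ?_
    rw [nhds_prod_eq]
    refine (((eventually_inv_eval_eq g₀ u).and (eventually_inv_eval_eq g₀ v)).prod_inl _).mono ?_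
    rintro ⟨g, c⟩ ⟨h1, h2⟩
    change c (g₀⁻¹ u) (g₀⁻¹ v) = c (g⁻¹ u) (g⁻¹ v)
    rw [← h1, ← h2]

end AutTopology

/-! ### Vertices among the points of the geometric realization. -/

section Realization

variable {V : Type*} {X : SimpleGraph V}

namespace Realization

lemma ofVertex_coord_self (w : V) : (ofVertex w : Realization X).coord w = 1 := by
  simp [ofVertex]

lemma ofVertex_coord_pos {w v : V} : 0 < (ofVertex w : Realization X).coord v ↔ v = w := by
  by_cases h : v = w <;> simp [ofVertex, h]

lemma ofVertex_coord_of_ne {w v : V} (h : v ≠ w) : (ofVertex w : Realization X).coord v = 0 := by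
  simp [ofVertex, h]

lemma continuous_coord (v : V) : Continuous fun p : Realization X => p.coord v :=
  (continuous_apply v).comp continuous_induced_dom

lemma smul_coord (g : X ≃g X) (p : Realization X) (v : V) : (g • p).coord v = p.coord (g⁻¹ v) :=
  rfl

lemma smul_ofVertex (g : X ≃g X) (w : V) :
    g • (ofVertex w : Realization X) = ofVertex (g w) := by
  ext v
  rw [smul_coord]
  by_cases h : v = g w
  · subst h
    rw [RelIso.inv_apply_self, ofVertex_coord_self, ofVertex_coord_self]
  · rw [ofVertex_coord_of_ne h, ofVertex_coord_of_ne]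
    rintro rfl
    exact h (RelIso.apply_inv_self g v).symm

lemma ofVertex_injective : Function.Injective (ofVertex : V → Realization X) := by
  intro v w h
  have : 0 < (ofVertex w : Realization X).coord v := by
    rw [← h]
    exact ofVertex_coord_pos.2 rfl
  exact ofVertex_coord_pos.1 this

lemma exists_coord_mem_Ioo {p : Realization X} (h : ∀ w, p ≠ ofVertex w) :
    ∃ v, 0 < p.coord v ∧ p.coord v < 1 := by
  classical
  obtain ⟨s, -, -, h0, h1⟩ := p.exists_simplex
  obtain ⟨v, hv, hv0⟩ : ∃ v ∈ s, 0 < p.coord v := by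
    by_contra! hs
    have := Finset.sum_nonpos hs
    linarith
  refine ⟨v, hv0, lt_of_not_ge fun hv1 => h v ?_⟩
  have hs := Finset.add_sum_erase s p.coord hv
  have hnn : ∀ u ∈ s.erase v, 0 ≤ p.coord u := fun u _ => p.nonneg u
  have hsum := Finset.sum_nonneg hnn
  have hz : ∀ u ∈ s.erase v, p.coord u = 0 :=
    (Finset.sum_eq_zero_iff_of_nonneg hnn).1 (by linarith)
  ext u
  by_cases hu : u = v
  · subst hu
    rw [ofVertex_coord_self]
    linarith
  · rw [ofVertex_coord_of_ne hu]
    by_cases hus : u ∈ s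
    · exact hz u (Finset.mem_erase.2 ⟨hu, hus⟩)
    · exact h0 u hus

/-- A point is not a vertex exactly when some coordinate lies strictly between `0` and `1`. This
makes vertices and points at infinity together a closed set. -/
lemma isOpen_setOf_ne_ofVertex : IsOpen {p : Realization X | ∀ w, p ≠ ofVertex w} := by
  have : {p : Realization X | ∀ w, p ≠ ofVertex w} =
      ⋃ v, {p | 0 < p.coord v} ∩ {p | p.coord v < 1} := by
    ext p
    simp only [mem_iUnion, mem_inter_iff, mem_ofPred_eq]
    refine ⟨exists_coord_mem_Ioo, ?_⟩
    rintro ⟨v, h0, h1⟩ w rfl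
    rw [ofVertex_coord_pos] at h0
    subst h0
    rw [ofVertex_coord_self] at h1
    exact lt_irrefl _ h1
  rw [this]
  exact isOpen_iUnion fun v => (isOpen_lt continuous_const (continuous_coord v)).inter
    (isOpen_lt (continuous_coord v) continuous_const)

end Realization

instance : ContinuousSMul (X ≃g X) (Realization X) where
  continuous_smul := by
    refine continuous_induced_rng.2 (continuous_pi fun v =>
      continuous_iff_continuousAt.2 fun ⟨g₀, p₀⟩ => ?_)
    have h : Continuous fun q : (X ≃g X) × Realization X => q.2.coord (g₀⁻¹ v) :=
      (Realization.continuous_coord _).comp continuous_snd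
    refine h.continuousAt.congr ?_
    rw [nhds_prod_eq]
    refine ((eventually_inv_eval_eq g₀ v).prod_inl _).mono ?_
    rintro ⟨g, p⟩ h1
    change p.coord (g₀⁻¹ v) = p.coord (g⁻¹ v)
    rw [← h1]

end Realization

/-! ### The cone topology and its identification with the space of cocycles. -/

section Geometric

variable {V : Type*} {X : SimpleGraph V}

lemma GeomComp.vertex_injective : Function.Injective (GeomComp.vertex : V → GeomComp X) :=
  fun _ _ h => Realization.ofVertex_injective (GeomComp.point.inj h)

lemma GeomComp.smul_vertex (g : X ≃g X) (w : V) :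
    g • (GeomComp.vertex w : GeomComp X) = .vertex (g w) :=
  congrArg GeomComp.point (Realization.smul_ofVertex g w)

lemma isOpen_shadow {a b : V} (h : X.Adj a b) : IsOpen (shadow a b : Set (GeomComp X)) :=
  TopologicalSpace.isOpen_generateFrom_of_mem (Or.inr ⟨a, b, h, rfl⟩)

lemma isOpen_image_point {U : Set (Realization X)} (h : IsOpen U) :
    IsOpen (GeomComp.point '' U) :=
  TopologicalSpace.isOpen_generateFrom_of_mem (Or.inl ⟨U, h, rfl⟩)

instance : ContinuousSMul (X ≃g X) (GeomComp X) where
  continuous_smul := by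
    refine continuous_generateFrom_iff.2 ?_
    rintro W (⟨U, hU, rfl⟩ | ⟨a, b, hab, rfl⟩)
    · rw [isOpen_iff_mem_nhds]
      rintro ⟨g₀, x₀⟩ ⟨p, hp, h⟩
      rcases x₀ with q₀ | ξ
      · have hq : p = g₀ • q₀ := GeomComp.point.inj h
        subst hq
        have h1 : {z : (X ≃g X) × Realization X | z.1 • z.2 ∈ U} ∈ 𝓝 (g₀, q₀) :=
          (hU.preimage continuous_smul).mem_nhds hp
        rw [nhds_prod_eq, mem_prod_iff] at h1
        obtain ⟨A, hA, B, hB, hAB⟩ := h1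
        obtain ⟨B', hB', hB'o, hqB'⟩ := mem_nhds_iff.1 hB
        refine mem_of_superset (prod_mem_nhds hA ((isOpen_image_point hB'o).mem_nhds
          ⟨q₀, hqB', rfl⟩)) ?_
        rintro ⟨g, x⟩ ⟨hg, q, hq, rfl⟩
        exact ⟨g • q, hAB (a := (g, q)) ⟨hg, hB' hq⟩, rfl⟩
      · cases h
    · rw [isOpen_iff_mem_nhds]
      rintro ⟨g₀, x₀⟩ h
      have h' : x₀ ∈ shadow (g₀⁻¹ a) (g₀⁻¹ b) := (smul_mem_shadow g₀ a b x₀).1 h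
      refine mem_of_superset (prod_mem_nhds
        ((eventually_inv_eval_eq g₀ a).and (eventually_inv_eval_eq g₀ b))
        ((isOpen_shadow ((g₀⁻¹).map_adj_iff.2 hab)).mem_nhds h')) ?_
      rintro ⟨g, x⟩ ⟨⟨h1, h2⟩, hx⟩
      refine (smul_mem_shadow g a b x).2 ?_
      rwa [h1, h2]

lemma vertex_mem_shadow {a b w : V} :
    (GeomComp.vertex w : GeomComp X) ∈ shadow a b ↔ w ∈ halfTree X a b := by
  constructor
  · rintro ⟨v, hv, h⟩
    rwa [← Realization.ofVertex_coord_pos.1 h]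
  · exact fun h => ⟨w, h, Realization.ofVertex_coord_pos.2 rfl⟩

namespace Horo

variable [hX : Fact X.IsTree]

open Classical in
/-- The point of the geometric compactification with a given Busemann cocycle. -/
noncomputable def toGeom (c : Horo X) : GeomComp X :=
  if h : ∃ w, c = vertex w then .vertex h.choose
  else .boundary (c.cases.resolve_left h).choose.endpoint

lemma toGeom_vertex (w : V) : toGeom (vertex w : Horo X) = .vertex w := by
  have h : ∃ v, (vertex w : Horo X) = vertex v := ⟨w, rfl⟩
  rw [toGeom, dif_pos h, ← vertex_injective h.choose_spec]

lemma toGeom_ofRay (r : GeodesicRay X) : toGeom (ofRay r) = .boundary r.endpoint := by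
  have h : ¬∃ w, ofRay r = vertex w := fun ⟨w, hw⟩ => ofRay_ne_vertex r w hw
  rw [toGeom, dif_neg h, ← endpoint_eq_of_ofRay_eq ((ofRay r).cases.resolve_left h).choose_spec]

lemma toGeom_smul (g : X ≃g X) (c : Horo X) : toGeom (g • c) = g • toGeom c := by
  rcases c.cases with ⟨w, rfl⟩ | ⟨r, rfl⟩
  · rw [smul_vertex, toGeom_vertex, toGeom_vertex, GeomComp.smul_vertex]
  · rw [smul_ofRay, toGeom_ofRay, toGeom_ofRay]
    rfl

lemma toGeom_injective : Function.Injective (toGeom : Horo X → GeomComp X) := by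
  intro c d h
  rcases c.cases with ⟨w, rfl⟩ | ⟨r, rfl⟩ <;> rcases d.cases with ⟨w', rfl⟩ | ⟨r', rfl⟩ <;>
    simp only [toGeom_vertex, toGeom_ofRay] at h
  · rw [GeomComp.vertex_injective h]
  · cases h
  · cases h
  · exact ofRay_eq_of_endpoint_eq (GeomComp.boundary.inj h)

lemma vertex_apply_eq_one_iff {a b : V} (hab : X.Adj a b) (w : V) :
    (vertex w : Horo X) a b = 1 ↔ w ∈ halfTree X a b := by
  rw [vertex_apply, halfTree, mem_ofPred_eq, SimpleGraph.dist_comm (u := w),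
    SimpleGraph.dist_comm (u := w)]
  have := dist_adj_cases hX.out hab w
  omega

lemma eventually_mem_halfTree_iff {a b : V} (hab : X.Adj a b) (r : GeodesicRay X) :
    (∀ᶠ n in atTop, r.toFun n ∈ halfTree X a b) ↔ ofRay r a b = 1 := by
  constructor
  · intro h
    refine ofRay_eq_of_eventually (h.mono fun n hn => ?_)
    exact (vertex_apply_eq_one_iff hab _).2 hn
  · intro h
    refine (ofRay_eventually r a b).mono fun n hn => ?_
    rw [h] at hn
    exact (vertex_apply_eq_one_iff hab _).1 hn

/-- The dictionary between the two topologies: a point lies in the shadow of an edge when its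
cocycle descends along this edge. -/
lemma toGeom_mem_shadow {a b : V} (hab : X.Adj a b) (c : Horo X) :
    toGeom c ∈ shadow a b ↔ c a b = 1 := by
  rcases c.cases with ⟨w, rfl⟩ | ⟨r, rfl⟩
  · rw [toGeom_vertex, vertex_mem_shadow, vertex_apply_eq_one_iff hab]
  · rw [toGeom_ofRay]
    constructor
    · rintro ⟨s, hs, h⟩
      rw [← ofRay_eq_of_endpoint_eq hs]
      exact (eventually_mem_halfTree_iff hab s).1 h
    · exact fun h => ⟨r, rfl, (eventually_mem_halfTree_iff hab r).2 h⟩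

/-- The cocycle of `w` is characterized by having no descending edge at `w`, which is a finite
number of conditions on values. -/
lemma isOpen_singleton_vertex [X.LocallyFinite] (w : V) : IsOpen {(vertex w : Horo X)} := by
  have : {(vertex w : Horo X)} = ⋂ b ∈ X.neighborFinset w, {c : Horo X | c w b = -1} := by
    ext c
    simp only [mem_singleton_iff, mem_iInter, mem_ofPred_eq, SimpleGraph.mem_neighborFinset]
    constructor
    · rintro rfl b hb
      rw [vertex_apply, SimpleGraph.dist_self, SimpleGraph.dist_eq_one_iff_adj.2 hb.symm]
      rfl
    · intro h
      refine eq_vertex_of_forall_adj fun b hb => ?_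
      rw [h b hb]
      decide
  rw [this]
  exact isOpen_biInter_finset fun b _ => (isClopen_setOf_apply_eq w b (-1)).isOpen

lemma isOpen_range_vertex [X.LocallyFinite] : IsOpen (range (vertex : V → Horo X)) := by
  rw [← iUnion_singleton_eq_range]
  exact isOpen_iUnion isOpen_singleton_vertex

lemma continuous_toGeom [X.LocallyFinite] : Continuous (toGeom : Horo X → GeomComp X) := by
  refine continuous_generateFrom_iff.2 ?_
  rintro W (⟨U, hU, rfl⟩ | ⟨a, b, hab, rfl⟩)
  · have : toGeom ⁻¹' (GeomComp.point '' U) =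
        ⋃ w ∈ {w | Realization.ofVertex w ∈ U}, {(vertex w : Horo X)} := by
      ext c
      simp only [mem_preimage, mem_iUnion, mem_singleton_iff, mem_ofPred_eq]
      constructor
      · rintro ⟨p, hp, h⟩
        rcases c.cases with ⟨w, rfl⟩ | ⟨r, rfl⟩
        · rw [toGeom_vertex] at h
          have : p = Realization.ofVertex w := GeomComp.point.inj h
          exact ⟨w, this ▸ hp, rfl⟩
        · rw [toGeom_ofRay] at h
          cases h
      · rintro ⟨w, hw, rfl⟩
        exact ⟨_, hw, (toGeom_vertex w).symm⟩
    rw [this]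
    exact isOpen_biUnion fun w _ => isOpen_singleton_vertex w
  · have : toGeom ⁻¹' (shadow a b) = {c : Horo X | c a b = 1} :=
      Set.ext fun c => toGeom_mem_shadow hab c
    rw [this]
    exact (isClopen_setOf_apply_eq a b 1).isOpen

lemma range_toGeom : range (toGeom : Horo X → GeomComp X) =
    range GeomComp.vertex ∪ range GeomComp.boundary := by
  ext x
  constructor
  · rintro ⟨c, rfl⟩
    rcases c.cases with ⟨w, rfl⟩ | ⟨r, rfl⟩
    · rw [toGeom_vertex]
      exact Or.inl ⟨w, rfl⟩
    · rw [toGeom_ofRay]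
      exact Or.inr ⟨_, rfl⟩
  · rintro (⟨w, rfl⟩ | ⟨ξ, rfl⟩)
    · exact ⟨_, toGeom_vertex w⟩
    · induction ξ using Quotient.inductionOn with
      | h r => exact ⟨_, toGeom_ofRay r⟩

lemma tendsto_vertex_ray (r : GeodesicRay X) :
    Tendsto (fun n => (vertex (r.toFun n) : Horo X)) atTop (𝓝 (ofRay r)) := by
  rw [isInducing_toFun.tendsto_nhds_iff, tendsto_pi_nhds]
  intro u
  rw [tendsto_pi_nhds]
  intro v
  exact tendsto_nhds_of_eventually_eq (ofRay_eventually r u v)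

lemma geomVertices_eq_range [X.LocallyFinite] : geomVertices X = range (toGeom : Horo X → _) := by
  refine Subset.antisymm (closure_minimal ?_ ?_) ?_
  · rw [range_toGeom]
    exact subset_union_left
  · rw [← isOpen_compl_iff]
    convert isOpen_image_point (X := X) Realization.isOpen_setOf_ne_ofVertex using 1
    ext x
    rw [range_toGeom]
    rcases x with p | ξ
    · constructor
      · intro h
        refine ⟨p, fun w hw => h (Or.inl ⟨w, ?_⟩), rfl⟩
        rw [hw]
        rfl
      · rintro ⟨q, hq, h⟩ (⟨w, hw⟩ | ⟨η, hη⟩)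
        · have h1 : q = p := GeomComp.point.inj h
          have h2 : Realization.ofVertex w = p := GeomComp.point.inj hw
          exact hq w (h1.trans h2.symm)
        · cases hη
    · constructor
      · intro h
        exact (h (Or.inr ⟨ξ, rfl⟩)).elim
      · rintro ⟨q, -, h⟩
        cases h
  · rintro _ ⟨c, rfl⟩
    rcases c.cases with ⟨w, rfl⟩ | ⟨r, rfl⟩
    · rw [toGeom_vertex]
      exact subset_closure ⟨w, rfl⟩
    · refine mem_closure_of_tendsto ((continuous_toGeom.tendsto _).comp (tendsto_vertex_ray r))
        (Eventually.of_forall fun n => ⟨r.toFun n, (toGeom_vertex _).symm⟩)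

/-- Cocycles are determined by their signs on edges; an edge where the signs differ separates the
two points. -/
lemma exists_adj_apply_ne {c d : Horo X} (h : c ≠ d) :
    ∃ a b, X.Adj a b ∧ c a b = 1 ∧ d b a = 1 := by
  by_contra! hcd
  refine h (eq_of_adj hX.out.connected fun a b hab => ?_)
  have h1 := c.isHoro.adj a b hab
  have h2 := d.isHoro.adj a b hab
  have h3 := hcd a b hab
  have h4 := hcd b a hab.symm
  have h5 := c.swap a b
  have h6 := d.swap a b
  omega

/-- The two opposite shadows of a separating edge overlap only in the interior of this edge, so they
are disjoint on vertices and points at infinity. -/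
instance [X.LocallyFinite] : T2Space (geomVertices X) := by
  refine ⟨?_⟩
  rintro ⟨x, hx⟩ ⟨y, hy⟩ hxy
  obtain ⟨c, rfl⟩ := geomVertices_eq_range.subset hx
  obtain ⟨d, rfl⟩ := geomVertices_eq_range.subset hy
  obtain ⟨a, b, hab, hc, hd⟩ := exists_adj_apply_ne (c := c) (d := d) fun h => hxy (by simp [h])
  refine ⟨Subtype.val ⁻¹' shadow a b, Subtype.val ⁻¹' shadow b a,
    (isOpen_shadow hab).preimage continuous_subtype_val,
    (isOpen_shadow hab.symm).preimage continuous_subtype_val,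
    (toGeom_mem_shadow hab c).2 hc, (toGeom_mem_shadow hab.symm d).2 hd, ?_⟩
  rw [Set.disjoint_left]
  rintro ⟨z, hz⟩ h1 h2
  obtain ⟨e, rfl⟩ := geomVertices_eq_range.subset hz
  have h1 := (toGeom_mem_shadow hab e).1 h1
  have h2 := (toGeom_mem_shadow hab.symm e).1 h2
  have := e.swap a b
  omega

lemma toGeom_mem [X.LocallyFinite] (c : Horo X) : toGeom c ∈ geomVertices X :=
  geomVertices_eq_range.superset ⟨c, rfl⟩

variable (X) in
/-- The space of Busemann cocycles is the geometric compactification of the set of vertices. -/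
noncomputable def homeo [X.LocallyFinite] : Horo X ≃ₜ geomVertices X :=
  Continuous.homeoOfEquivCompactToT2
    (f := Equiv.ofBijective (fun c => (⟨toGeom c, toGeom_mem c⟩ : geomVertices X))
      ⟨fun _ _ h => toGeom_injective (congrArg Subtype.val h), fun ⟨x, hx⟩ => by
        obtain ⟨c, hc⟩ := geomVertices_eq_range.subset hx
        exact ⟨c, Subtype.ext hc⟩⟩)
    (continuous_toGeom.subtype_mk _)

lemma isEmbedding_toGeom [X.LocallyFinite] : IsEmbedding (toGeom : Horo X → GeomComp X) :=
  IsEmbedding.subtypeVal.comp (homeo X).isEmbedding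

/-- The Busemann cocycle of a point at infinity. -/
noncomputable def ofBoundary (ξ : Boundary X) : Horo X :=
  Quotient.lift ofRay (fun _ _ h => ofRay_eq_of_endpoint_eq (Quotient.sound h)) ξ

lemma toGeom_ofBoundary (ξ : Boundary X) : toGeom (ofBoundary ξ) = .boundary ξ := by
  induction ξ using Quotient.inductionOn with
  | h r => exact toGeom_ofRay r

lemma ofBoundary_injective : Function.Injective (ofBoundary : Boundary X → Horo X) := by
  intro ξ η h
  have := congrArg toGeom h
  rw [toGeom_ofBoundary, toGeom_ofBoundary] at this
  exact GeomComp.boundary.inj this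

lemma ofBoundary_smul (g : X ≃g X) (ξ : Boundary X) : ofBoundary (g • ξ) = g • ofBoundary ξ := by
  induction ξ using Quotient.inductionOn with
  | h r => exact (smul_ofRay g r).symm

lemma cases_boundary (c : Horo X) : (∃ w, c = vertex w) ∨ ∃ ξ, c = ofBoundary ξ :=
  c.cases.imp_right fun ⟨r, hr⟩ => ⟨r.endpoint, hr⟩

lemma ofBoundary_ne_vertex (ξ : Boundary X) (w : V) : ofBoundary ξ ≠ vertex w := by
  induction ξ using Quotient.inductionOn with
  | h r => exact ofRay_ne_vertex r w

lemma range_ofBoundary : range (ofBoundary : Boundary X → Horo X) = (range vertex)ᶜ := by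
  ext c
  constructor
  · rintro ⟨ξ, rfl⟩ ⟨w, hw⟩
    exact ofBoundary_ne_vertex ξ w hw.symm
  · intro h
    rcases c.cases_boundary with ⟨w, rfl⟩ | ⟨ξ, rfl⟩
    · exact (h ⟨w, rfl⟩).elim
    · exact ⟨ξ, rfl⟩

lemma isClosedEmbedding_ofBoundary [X.LocallyFinite] :
    IsClosedEmbedding (ofBoundary : Boundary X → Horo X) where
  toIsEmbedding := by
    refine ⟨isEmbedding_toGeom.isInducing.of_comp_iff.1 ?_, ofBoundary_injective⟩
    have : (toGeom ∘ ofBoundary : Boundary X → GeomComp X) = GeomComp.boundary :=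
      funext toGeom_ofBoundary
    rw [this]
    exact ⟨rfl⟩
  isClosed_range := by
    rw [range_ofBoundary]
    exact isOpen_range_vertex.isClosed_compl

instance [X.LocallyFinite] : CompactSpace (Boundary X) :=
  isClosedEmbedding_ofBoundary.compactSpace

instance [X.LocallyFinite] : T2Space (Boundary X) :=
  isClosedEmbedding_ofBoundary.isEmbedding.t2Space

instance [X.LocallyFinite] : ContinuousSMul (X ≃g X) (Boundary X) where
  continuous_smul := by
    refine isClosedEmbedding_ofBoundary.isInducing.continuous_iff.2 ?_
    have : (ofBoundary ∘ fun p : (X ≃g X) × Boundary X => p.1 • p.2) =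
        fun p => p.1 • ofBoundary p.2 := funext fun p => ofBoundary_smul p.1 p.2
    rw [this]
    exact continuous_fst.smul (isClosedEmbedding_ofBoundary.continuous.comp continuous_snd)

/-- Near the endpoint of a ray, cocycles take the same values as that of the ray. -/
lemma exists_forall_apply_eq (r : GeodesicRay X) (u v : V) :
    ∃ N, ∀ n ≥ N, ∀ c : Horo X, c (r.toFun n) (r.toFun (n + 1)) = 1 → c u v = ofRay r u v := by
  obtain ⟨N, hN⟩ := eventually_atTop.1
    ((r.eventually_dist_succ hX.out u).and (r.eventually_dist_succ hX.out v))
  refine ⟨N, fun n hn c hc => ?_⟩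
  have key : ∀ d : Horo X, d (r.toFun n) (r.toFun (n + 1)) = 1 →
      d u v = X.dist (r.toFun (n + 1)) u - X.dist (r.toFun (n + 1)) v := by
    intro d hd
    have h1 : d (r.toFun (n + 1)) (r.toFun n) = -1 := by rw [d.swap, hd]
    have h2 := d.ascend hX.out (r.adj n).symm h1 (hN n hn).1
    have h3 := d.ascend hX.out (r.adj n).symm h1 (hN n hn).2
    have h4 := d.add (r.toFun (n + 1)) u v
    omega
  rw [key c hc, key (ofRay r)]
  rw [ofRay_ray]
  push_cast
  ring

/-- The half-trees beyond the successive edges of `r` shrink to its endpoint: cocycles taken in them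
further and further away converge to `ofRay r`, by `exists_forall_apply_eq`. -/
lemma exists_setOf_apply_subset (r : GeodesicRay X) {U : Set (Horo X)} (hU : U ∈ 𝓝 (ofRay r)) :
    ∃ N, ∀ n ≥ N, {c : Horo X | c (r.toFun n) (r.toFun (n + 1)) = 1} ⊆ U := by
  by_contra! h
  choose n hn hsub using h
  simp only [not_subset] at hsub
  choose c hc hcU using hsub
  have ht : Tendsto c atTop (𝓝 (ofRay r)) := by
    rw [isInducing_toFun.tendsto_nhds_iff, tendsto_pi_nhds]
    intro u
    rw [tendsto_pi_nhds]
    intro v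
    obtain ⟨N, hN⟩ := exists_forall_apply_eq r u v
    exact tendsto_nhds_of_eventually_eq (eventually_atTop.2
      ⟨N, fun k hk => hN (n k) (hk.trans (hn k)) (c k) (hc k)⟩)
  obtain ⟨k, hk⟩ := (ht.eventually hU).exists
  exact hcU k hk

end Horo

end Geometric

/-! ### Finiteness of balls and compactness of stabilizers. -/

section LocallyFinite

variable {V : Type*} {X : SimpleGraph V}

lemma finite_closedBall [X.LocallyFinite] (hX : X.Connected) (v : V) (n : ℕ) :
    {w | X.dist w v ≤ n}.Finite := by
  induction n with
  | zero =>
    refine (finite_singleton v).subset fun w hw => ?_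
    exact (hX.dist_eq_zero_iff).1 (Nat.le_zero.1 hw)
  | succ n ih =>
    refine (ih.union (ih.biUnion fun w _ => (X.neighborFinset w).finite_toSet)).subset ?_
    intro w hw
    by_cases h : w = v
    · left
      simp [h]
    · obtain ⟨u, hu, hd⟩ := exists_adj_dist_eq hX h
      have hw : X.dist w v ≤ n + 1 := hw
      refine Or.inr (mem_biUnion (x := u) (show X.dist u v ≤ n by omega) ?_)
      rw [Finset.mem_coe, SimpleGraph.mem_neighborFinset]
      exact hu.symm

lemma countable_of_connected [X.LocallyFinite] (hX : X.Connected) : Countable V := by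
  have v := hX.nonempty.some
  rw [← countable_univ_iff]
  refine (countable_iUnion fun n => (finite_closedBall hX v n).countable).mono fun w _ => ?_
  exact mem_iUnion.2 ⟨X.dist w v, le_refl (X.dist w v)⟩

/-- If `g v = w`, the images of `u` under `g` and `g⁻¹` stay in finite balls around `w` and `v`.
Recording `g⁻¹` along with `g` makes the range closed, since bijectivity becomes a pointwise
condition. -/
lemma isCompact_setOf_eval_eq [X.LocallyFinite] (hX : X.Connected) (v w : V) :
    IsCompact {g : X ≃g X | g v = w} := by
  let _ : TopologicalSpace V := ⊥
  have : DiscreteTopology V := ⟨rfl⟩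
  let e : (X ≃g X) → (V → V) × (V → V) := fun g => (fun u => g u, fun u => g⁻¹ u)
  have hind : IsInducing (fun g : X ≃g X => (fun u => g u : V → V)) := ⟨rfl⟩
  have hcont : Continuous e :=
    hind.continuous.prodMk (hind.continuous.comp continuous_inv)
  have hemb : IsEmbedding e := by
    refine ⟨IsInducing.of_comp hcont continuous_fst hind, fun g h hgh => ?_⟩
    ext u
    exact congrFun (congrArg Prod.fst hgh) u
  have ev1 : ∀ u, Continuous fun p : (V → V) × (V → V) => p.1 u :=
    fun u => (continuous_apply u).comp continuous_fst
  have ev2 : ∀ u, Continuous fun p : (V → V) × (V → V) => p.2 u :=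
    fun u => (continuous_apply u).comp continuous_snd
  have ev12 : ∀ u, Continuous fun p : (V → V) × (V → V) => p.1 (p.2 u) := fun u =>
    continuous_iff_continuousAt.2 fun p₀ => (ev1 (p₀.2 u)).continuousAt.congr
      (((ev2 u).continuousAt.eventually (p := fun z => z = p₀.2 u) (by simp)).mono
        fun p hp => by dsimp only; rw [hp])
  have ev21 : ∀ u, Continuous fun p : (V → V) × (V → V) => p.2 (p.1 u) := fun u =>
    continuous_iff_continuousAt.2 fun p₀ => (ev2 (p₀.1 u)).continuousAt.congr
      (((ev1 u).continuousAt.eventually (p := fun z => z = p₀.1 u) (by simp)).mono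
        fun p hp => by dsimp only; rw [hp])
  have hrange : IsClosed (range e) := by
    have : range e = (⋂ u, {p | p.1 (p.2 u) = u}) ∩ (⋂ u, {p | p.2 (p.1 u) = u}) ∩
        ⋂ a, ⋂ b, {p | X.Adj (p.1 a) (p.1 b) ↔ X.Adj a b} := by
      ext p
      simp only [mem_inter_iff, mem_iInter, mem_ofPred_eq]
      constructor
      · rintro ⟨g, rfl⟩
        exact ⟨⟨fun u => RelIso.apply_inv_self g u, fun u => RelIso.inv_apply_self g u⟩,
          fun a b => g.map_adj_iff⟩
      · rintro ⟨⟨h1, h2⟩, h3⟩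
        let g : X ≃g X := ⟨⟨p.1, p.2, h2, h1⟩, fun {a b} => h3 a b⟩
        exact ⟨g, rfl⟩
    rw [this]
    refine ((isClosed_iInter fun u => ?_).inter (isClosed_iInter fun u => ?_)).inter
      (isClosed_iInter fun a => isClosed_iInter fun b => ?_)
    · exact isClosed_eq (ev12 u) continuous_const
    · exact isClosed_eq (ev21 u) continuous_const
    · exact (isClosed_discrete {q : V × V | X.Adj q.1 q.2 ↔ X.Adj a b}).preimage
        ((ev1 a).prodMk (ev1 b))
  have hK : IsCompact ((Set.pi univ fun u : V => {z | X.dist z w ≤ X.dist u v}) ×ˢ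
      (Set.pi univ fun u : V => {z | X.dist z v ≤ X.dist u w})) :=
    (isCompact_univ_pi fun u => (finite_closedBall hX w _).isCompact).prod
      (isCompact_univ_pi fun u => (finite_closedBall hX v _).isCompact)
  have hK' := IsClosedEmbedding.isCompact_preimage ⟨hemb, hrange⟩ hK
  refine hK'.of_isClosed_subset ?_ ?_
  · exact isClosed_eq ((continuous_apply v).comp hind.continuous) continuous_const
  · intro g hg
    have hg : g v = w := hg
    refine ⟨fun u _ => ?_, fun u _ => ?_⟩
    · change X.dist (g u) w ≤ _
      rw [← hg, dist_map]
    · change X.dist (g⁻¹ u) v ≤ _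
      rw [← hg, ← dist_map g, RelIso.apply_inv_self]

variable {G : Subgroup (X ≃g X)}

lemma isCompact_setOf_smul_eq [X.LocallyFinite] (hX : X.Connected)
    (hG : IsClosed (G : Set (X ≃g X))) (v w : V) : IsCompact {g : G | g • v = w} :=
  hG.isClosedEmbedding_subtypeVal.isCompact_preimage (isCompact_setOf_eval_eq hX v w)

lemma isClopen_setOf_smul_eq (v w : V) : IsClopen {g : G | g • v = w} := by
  have h : ∀ w, IsOpen {g : G | g • v = w} := fun w =>
    (isOpen_eval v w).preimage continuous_subtype_val
  refine ⟨?_, h w⟩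
  rw [← isOpen_compl_iff]
  have : {g : G | g • v = w}ᶜ = ⋃ u ∈ {u | u ≠ w}, {g : G | g • v = u} := by
    ext g
    simp
  rw [this]
  exact isOpen_biUnion fun u _ => h u

/-- A map between families of vertices which is realized by `G` on finite subfamilies is realized
by an element of `G`. -/
lemma exists_forall_smul_eq [X.LocallyFinite] (hX : X.Connected)
    (hG : IsClosed (G : Set (X ≃g X))) {ι : Type*} [Nonempty ι] (s t : ι → V)
    (h : ∀ F : Finset ι, ∃ g : G, ∀ i ∈ F, g • s i = t i) : ∃ g : G, ∀ i, g • s i = t i := by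
  classical
  let i₀ : ι := Classical.arbitrary ι
  have := (isCompact_setOf_smul_eq hX hG (s i₀) (t i₀)).inter_iInter_nonempty
    (fun i => {g : G | g • s i = t i}) (fun i => (isClopen_setOf_smul_eq _ _).isClosed)
    (fun F => by
      obtain ⟨g, hg⟩ := h (insert i₀ F)
      refine ⟨g, hg i₀ (Finset.mem_insert_self _ _), ?_⟩
      simp only [mem_iInter]
      exact fun i hi => hg i (Finset.mem_insert_of_mem hi))
  obtain ⟨g, -, hg⟩ := this
  exact ⟨g, fun i => mem_iInter.1 hg i⟩

end LocallyFinite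

/-! ### Construction of rays and lines. -/

section Lines

variable {V : Type*} {X : SimpleGraph V}

/-- If the distance to `f 0` dropped just after growing, `f n` and `f (n + 2)` would both be the
neighbour of `f (n + 1)` towards `f 0`. -/
lemma dist_of_forall_ne (hX : X.IsTree) (f : ℕ → V) (hadj : ∀ n, X.Adj (f n) (f (n + 1)))
    (hne : ∀ n, f n ≠ f (n + 2)) (n : ℕ) : X.dist (f 0) (f n) = n := by
  suffices h : X.dist (f 0) (f n) = n ∧ X.dist (f 0) (f (n + 1)) = n + 1 from h.1
  induction n with
  | zero => exact ⟨by simp, SimpleGraph.dist_eq_one_iff_adj.2 (hadj 0)⟩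
  | succ n ih =>
    refine ⟨ih.2, ?_⟩
    rcases dist_adj_cases hX (hadj (n + 1)) (f 0) with h | h
    · refine (hne n ?_).elim
      refine adj_unique_of_dist hX (hadj n).symm (hadj (n + 1)) (w := f 0) ?_ h
      rw [SimpleGraph.dist_comm, ih.2, SimpleGraph.dist_comm, ih.1]
    · rw [SimpleGraph.dist_comm, h, SimpleGraph.dist_comm, ih.2]

lemma exists_adj_ne [X.LocallyFinite] (hleaf : ∀ v, 2 ≤ X.degree v) (a b : V) :
    ∃ c, X.Adj a c ∧ c ≠ b := by
  obtain ⟨c, hc, hcb⟩ := Finset.exists_mem_ne (s := X.neighborFinset a)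
    (by rw [SimpleGraph.card_neighborFinset_eq_degree]; exact hleaf a) b
  exact ⟨c, (X.mem_neighborFinset a c).1 hc, hcb⟩

lemma exists_adj_ne_ne [X.LocallyFinite] {a : V} (ha : 3 ≤ X.degree a) (b b' : V) :
    ∃ c, X.Adj a c ∧ c ≠ b ∧ c ≠ b' := by
  classical
  have h : 0 < ((X.neighborFinset a) \ {b, b'}).card := by
    have h1 := Finset.le_card_sdiff {b, b'} (X.neighborFinset a)
    have h2 : ({b, b'} : Finset V).card ≤ 2 := Finset.card_le_two
    rw [SimpleGraph.card_neighborFinset_eq_degree] at h1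
    omega
  obtain ⟨c, hc⟩ := Finset.card_pos.1 h
  simp only [Finset.mem_sdiff, SimpleGraph.mem_neighborFinset, Finset.mem_insert,
    Finset.mem_singleton, not_or] at hc
  exact ⟨c, hc.1, hc.2.1, hc.2.2⟩

/-- There are two types and the ends of an edge realize both, so one end has the type of the given
branch vertex. -/
lemma three_le_degree_or [X.LocallyFinite] (hsemi : IsSemiHomogeneous X)
    (hline : ∃ v, 3 ≤ X.degree v) {a b : V} (hab : X.Adj a b) :
    3 ≤ X.degree a ∨ 3 ≤ X.degree b := by
  obtain ⟨type, d, hd⟩ := hsemi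
  obtain ⟨v, hv⟩ := hline
  have h := type.valid hab
  rw [hd] at hv
  rw [hd, hd]
  have : type a = type v ∨ type b = type v := by
    have h : type a ≠ type b := h
    generalize type a = x at *
    generalize type b = y at *
    generalize type v = z at *
    omega
  rcases this with h | h <;> rw [h]
  · exact Or.inl hv
  · exact Or.inr hv

lemma exists_ray_of_adj [X.LocallyFinite] (hX : X.IsTree) (hleaf : ∀ v, 2 ≤ X.degree v) {a b : V}
    (hab : X.Adj a b) : ∃ r : GeodesicRay X, r.toFun 0 = a ∧ r.toFun 1 = b := by
  choose σ hσ hσ' using exists_adj_ne hleaf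
  -- `p n` is the `n`-th oriented edge of the path; remembering its origin is what allows the next
  -- step not to backtrack.
  let p : ℕ → V × V := fun n => (fun q : V × V => (q.2, σ q.2 q.1))^[n] (a, b)
  have hp : ∀ n, p (n + 1) = ((p n).2, σ (p n).2 (p n).1) := fun n =>
    Function.iterate_succ_apply' _ _ _
  have hadj : ∀ n, X.Adj (p n).1 (p (n + 1)).1 := by
    intro n
    rw [hp]
    cases n with
    | zero => exact hab
    | succ n =>
      rw [hp]
      exact hσ _ _
  refine ⟨⟨fun n => (p n).1, fun m k => ?_⟩, rfl, rfl⟩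
  refine dist_of_forall_ne hX (fun k => (p (m + k)).1) (fun k => hadj (m + k)) (fun k => ?_) k
  rw [show m + (k + 2) = m + k + 1 + 1 by ring, hp, hp]
  exact (hσ' _ _).symm

/-- Two rays with a common origin and distinct initial edges form a line. -/
lemma exists_line_of_rays (hX : X.IsTree) {r s : GeodesicRay X} (h0 : r.toFun 0 = s.toFun 0)
    (h1 : r.toFun 1 ≠ s.toFun 1) :
    ∃ L : GeodesicLine X, ∀ n : ℕ, L.toFun n = r.toFun n ∧ L.toFun (-n) = s.toFun n := by
  let f : ℤ → V := fun n => if 0 ≤ n then r.toFun n.toNat else s.toFun (-n).toNat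
  have hf : ∀ n : ℕ, f n = r.toFun n := fun n => by simp [f]
  have hf' : ∀ n : ℕ, f (-n) = s.toFun n := fun n => by
    rcases Nat.eq_zero_or_pos n with rfl | hn
    · simp [f, h0]
    · have : ¬(0 : ℤ) ≤ -(n : ℤ) := by omega
      simp only [f, if_neg this, neg_neg, Int.toNat_natCast]
  have hs2 : ∀ (t : GeodesicRay X) n, t.toFun n ≠ t.toFun (n + 2) := fun t n h => by
    have := t.dist_eq n 2
    rw [h, SimpleGraph.dist_self] at this
    omega
  have hadj : ∀ n, X.Adj (f n) (f (n + 1)) := by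
    intro n
    rcases lt_or_ge n 0 with hn | hn
    · obtain ⟨k, rfl⟩ : ∃ k : ℕ, n = -((k + 1 : ℕ) : ℤ) := ⟨(-n).toNat - 1, by omega⟩
      rw [show -((k + 1 : ℕ) : ℤ) + 1 = -(k : ℤ) by push_cast; ring, hf', hf']
      exact (s.adj k).symm
    · obtain ⟨k, rfl⟩ := Int.eq_ofNat_of_zero_le hn
      rw [show (k : ℤ) + 1 = (k + 1 : ℕ) by push_cast; ring, hf, hf]
      exact r.adj k
  have hne : ∀ n, f n ≠ f (n + 2) := by
    intro n
    rcases lt_or_ge n 0 with hn | hn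
    · rcases eq_or_ne n (-1) with rfl | hn1
      · have e1 := hf' 1
        have e2 := hf 1
        push_cast at e1 e2
        rw [show (-1 : ℤ) + 2 = 1 by norm_num, e1, e2]
        exact h1.symm
      · obtain ⟨k, rfl⟩ : ∃ k : ℕ, n = -((k + 2 : ℕ) : ℤ) := ⟨(-n).toNat - 2, by omega⟩
        rw [show -((k + 2 : ℕ) : ℤ) + 2 = -(k : ℤ) by push_cast; ring, hf', hf']
        exact (hs2 s k).symm
    · obtain ⟨k, rfl⟩ := Int.eq_ofNat_of_zero_le hn
      rw [show (k : ℤ) + 2 = (k + 2 : ℕ) by push_cast; ring, hf, hf]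
      exact hs2 r k
  refine ⟨⟨f, fun m k => ?_⟩, fun n => ⟨hf n, hf' n⟩⟩
  have := dist_of_forall_ne hX (fun j : ℕ => f (m + j))
    (fun j => by
      have := hadj (m + j)
      rwa [show m + (j : ℤ) + 1 = m + ((j + 1 : ℕ) : ℤ) by push_cast; ring] at this)
    (fun j => by
      have := hne (m + j)
      rwa [show m + (j : ℤ) + 2 = m + ((j + 2 : ℕ) : ℤ) by push_cast; ring] at this) k
  simpa using this

lemma exists_line_of_ray [X.LocallyFinite] (hX : X.IsTree) (hleaf : ∀ v, 2 ≤ X.degree v)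
    (r : GeodesicRay X) : ∃ L : GeodesicLine X, ∀ n : ℕ, L.toFun n = r.toFun n := by
  obtain ⟨b, hb, hbr⟩ := exists_adj_ne hleaf (r.toFun 0) (r.toFun 1)
  obtain ⟨s, hs0, hs1⟩ := exists_ray_of_adj hX hleaf hb
  obtain ⟨L, hL⟩ := exists_line_of_rays hX (r := r) (s := s) hs0.symm (by rw [hs1]; exact hbr.symm)
  exact ⟨L, fun n => (hL n).1⟩

end Lines

/-! ### Strong transitivity of the group. -/

section Transitivity

variable {V : Type*} {X : SimpleGraph V} {G : Subgroup (X ≃g X)}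

lemma dist_smul (g : G) (v w : V) : X.dist (g • v) (g • w) = X.dist v w := dist_map g.1 v w

lemma IsLocallyInftyTransitive.exists_smul (htrans : IsLocallyInftyTransitive G) {v x y : V}
    (h : X.dist v x = X.dist v y) : ∃ g : G, g • v = v ∧ g • x = y := by
  obtain ⟨g, hg, h1, h2⟩ := htrans v _ x y rfl h.symm
  exact ⟨⟨g, hg⟩, h1, h2⟩

variable [X.LocallyFinite]

/-- `G` is strongly transitive: a geodesic line can be mapped onto any other one, so that a given
vertex is mapped to a given vertex of the same orbit. -/
lemma exists_smul_line (hX : X.IsTree) (hG : IsClosed (G : Set (X ≃g X)))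
    (htrans : IsLocallyInftyTransitive G) (L L' : GeodesicLine X) {i i' : ℤ}
    (h : ∃ g : G, g • L.toFun i = L'.toFun i') :
    ∃ g : G, ∀ n, g • L.toFun (i + n) = L'.toFun (i' + n) := by
  refine exists_forall_smul_eq hX.connected hG (fun n => L.toFun (i + n))
    (fun n => L'.toFun (i' + n)) fun F => ?_
  obtain ⟨N, hN⟩ : ∃ N : ℕ, ∀ n ∈ F, n.natAbs ≤ N :=
    ⟨F.sup Int.natAbs, fun n hn => Finset.le_sup (f := Int.natAbs) hn⟩
  obtain ⟨g₀, h₀⟩ := h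
  -- On the window of radius `N`, place the centre with `g₀`, then the left end by fixing the
  -- centre, then the right end by fixing the left end. The ends determine all the points between
  -- them.
  obtain ⟨k₁, h₁, h₁'⟩ := htrans.exists_smul (v := L'.toFun i') (x := g₀ • L.toFun (i - N))
    (y := L'.toFun (i' - N)) (by
      rw [← h₀, dist_smul, L.dist_natAbs, h₀, L'.dist_natAbs]
      omega)
  obtain ⟨k₂, h₂, h₂'⟩ := htrans.exists_smul (v := L'.toFun (i' - N))
    (x := (k₁ * g₀) • L.toFun (i + N)) (y := L'.toFun (i' + N)) (by
      rw [← h₁', ← mul_smul, dist_smul, L.dist_natAbs, mul_smul, h₁', L'.dist_natAbs]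
      omega)
  refine ⟨k₂ * (k₁ * g₀), fun n hn => ?_⟩
  have hl : (k₂ * (k₁ * g₀)) • L.toFun (i - N) = L'.toFun (i' - N) := by
    rw [mul_smul, mul_smul, h₁', h₂]
  have hr : (k₂ * (k₁ * g₀)) • L.toFun (i + N) = L'.toFun (i' + N) := by
    rw [mul_smul, h₂']
  have hn := hN n hn
  refine eq_of_dist_add hX (a := L'.toFun (i' - N)) (b := L'.toFun (i' + N)) ?_ ?_ ?_
  · rw [← hl, ← hr]
    simp only [dist_smul, L.dist_natAbs]
    omega
  · simp only [L'.dist_natAbs]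
    omega
  · rw [← hl, dist_smul, L.dist_natAbs, hl, L'.dist_natAbs]
    omega

lemma exists_smul_ray (hX : X.IsTree) (hleaf : ∀ v, 2 ≤ X.degree v)
    (hG : IsClosed (G : Set (X ≃g X))) (htrans : IsLocallyInftyTransitive G)
    {r s : GeodesicRay X} (h0 : r.toFun 0 = s.toFun 0) :
    ∃ g : G, ∀ n, g • r.toFun n = s.toFun n := by
  obtain ⟨L, hL⟩ := exists_line_of_ray hX hleaf r
  obtain ⟨L', hL'⟩ := exists_line_of_ray hX hleaf s
  obtain ⟨g, hg⟩ := exists_smul_line hX hG htrans L L' (i := 0) (i' := 0) ⟨1, by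
    have h1 := hL 0
    have h2 := hL' 0
    rw [Nat.cast_zero] at h1 h2
    rw [one_smul, h1, h2, h0]⟩
  refine ⟨g, fun n => ?_⟩
  have := hg n
  rwa [zero_add, hL, hL'] at this

end Transitivity

/-! ### The groups `K_v` and `D_ξ` in terms of cocycles. -/

section PointGroup

variable {V : Type*} {X : SimpleGraph V} {G : Subgroup (X ≃g X)}

namespace Horo

lemma smul_apply_smul (g : G) (c : Horo X) (u v : V) : (g • c) (g • u) (g • v) = c u v :=
  smul_apply_apply g.1 c u v

lemma smul_eq_self_of_apply_eq_zero {g : G} {c : Horo X} (h : ∀ u, c (g • u) u = 0) :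
    g • c = c := by
  ext u v
  obtain ⟨u, rfl⟩ := MulAction.surjective g u
  obtain ⟨v, rfl⟩ := MulAction.surjective g v
  rw [smul_apply_smul]
  change c u v = c (g • u) (g • v)
  have h1 := c.add u v (g • v)
  have h2 := c.add u (g • u) (g • v)
  have h3 := h u
  have h4 := c.swap (g • u) u
  have h5 := c.swap (g • v) v
  have h6 := h v
  omega

lemma continuous_apply_smul (u : V) : Continuous fun p : Horo X × G => p.1 (p.2 • u) u := by
  refine continuous_iff_continuousAt.2 fun ⟨c₀, g₀⟩ => ?_
  have h : Continuous fun p : Horo X × G => p.1 (g₀ • u) u :=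
    (continuous_eval _ _).comp continuous_fst
  refine h.continuousAt.congr ?_
  have h1 : ∀ᶠ g : G in 𝓝 g₀, g • u = g₀ • u :=
    ((isClopen_setOf_smul_eq u (g₀ • u)).isOpen).mem_nhds rfl
  rw [nhds_prod_eq]
  refine (h1.prod_inr _).mono ?_
  rintro ⟨c, g⟩ h2
  have h2 : g • u = g₀ • u := h2
  change c (g₀ • u) u = c (g • u) u
  rw [h2]

variable [hX : Fact X.IsTree]

lemma forall_vertex_apply_smul_eq_zero_iff {g : G} {w : V} :
    (∀ u, (vertex w : Horo X) (g • u) u = 0) ↔ g • w = w := by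
  constructor
  · intro h
    have := h w
    rw [vertex_apply, SimpleGraph.dist_self, Nat.cast_zero, sub_zero, Nat.cast_eq_zero] at this
    exact (hX.out.connected.dist_eq_zero_iff).1 this
  · intro h u
    have := dist_smul g u w
    rw [h] at this
    rw [vertex_apply, this, sub_self]

/-- A common description of both kinds of groups: the elements preserving each level set of the
Busemann function. For a vertex, the level set reduced to this vertex shows that it is fixed. -/
lemma mem_pointGroup_toGeom (g : G) (c : Horo X) :
    g ∈ pointGroup G (toGeom c) ↔ ∀ u, c (g • u) u = 0 := by
  rcases c.cases with ⟨w, rfl⟩ | ⟨r, rfl⟩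
  · rw [toGeom_vertex]
    have h1 : g ∈ pointGroup G (GeomComp.vertex w : GeomComp X) ↔ g • w = w := by
      change g.1 • (Realization.ofVertex w : Realization X) = _ ↔ _
      rw [Realization.smul_ofVertex]
      exact Realization.ofVertex_injective.eq_iff
    exact h1.trans forall_vertex_apply_smul_eq_zero_iff.symm
  · rw [toGeom_ofRay]
    change (g • r.endpoint = r.endpoint ∧ ∀ S : Set V, IsHorosphere r.endpoint S → g • S = S) ↔ _
    constructor
    · rintro ⟨-, hS⟩ u
      obtain ⟨k, hk⟩ : ∃ k : ℤ, ∀ᶠ n : ℕ in atTop, (X.dist u (r.toFun n) : ℤ) - n = k := by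
        refine ⟨ofRay r u (r.toFun 0), (ofRay_eventually r u (r.toFun 0)).mono fun n hn => ?_⟩
        rw [r.dist_of_le (Nat.zero_le n)] at hn
        omega
      have hgu : g • u ∈ g • {v | ∀ᶠ n : ℕ in atTop, (X.dist v (r.toFun n) : ℤ) - n = k} :=
        smul_mem_smul_set hk
      rw [hS _ ⟨r, rfl, k, rfl⟩] at hgu
      have hgu : ∀ᶠ n : ℕ in atTop, (X.dist (g • u) (r.toFun n) : ℤ) - n = k := hgu
      exact ofRay_eq_of_eventually ((hgu.and hk).mono fun n hn => by omega)
    · intro h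
      refine ⟨?_, ?_⟩
      · have h1 := smul_eq_self_of_apply_eq_zero h
        have h2 : g • ofRay r = ofRay (g.1 • r) := smul_ofRay g.1 r
        rw [h2] at h1
        exact endpoint_eq_of_ofRay_eq h1
      · rintro S ⟨s, hs, k, rfl⟩
        rw [← ofRay_eq_of_endpoint_eq hs] at h
        have key : ∀ v, ∀ᶠ n in atTop, X.dist (g • v) (s.toFun n) = X.dist v (s.toFun n) := by
          intro v
          have := ofRay_eventually s (g • v) v
          rw [h v] at this
          exact this.mono fun n hn => by omega
        ext v
        rw [mem_smul_set_iff_inv_smul_mem, mem_ofPred_eq, mem_ofPred_eq]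
        have hv := key (g⁻¹ • v)
        rw [smul_inv_smul] at hv
        refine eventually_congr (hv.mono fun n hn => ?_)
        rw [hn]

lemma smul_eq_self_of_mem {g : G} {c : Horo X} (h : g ∈ pointGroup G (toGeom c)) : g • c = c :=
  smul_eq_self_of_apply_eq_zero ((mem_pointGroup_toGeom g c).1 h)

lemma mem_pointGroup_vertex {g : G} {w : V} :
    g ∈ pointGroup G (toGeom (vertex w : Horo X)) ↔ g • w = w :=
  (mem_pointGroup_toGeom g _).trans forall_vertex_apply_smul_eq_zero_iff

/-- An element fixing a vertex of a ray and belonging to the group of its endpoint fixes the rest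
of the ray. -/
lemma smul_ray_eq_of_mem {g : G} {r : GeodesicRay X} (h : g ∈ pointGroup G (toGeom (ofRay r)))
    {m : ℕ} (hm : g • r.toFun m = r.toFun m) {n : ℕ} (hn : m ≤ n) :
    g • r.toFun n = r.toFun n := by
  have h1 := smul_apply_smul g (ofRay r) (r.toFun m) (r.toFun n)
  rw [smul_eq_self_of_mem h, hm, ofRay_ray] at h1
  have h2 := dist_smul g (r.toFun m) (r.toFun n)
  rw [hm] at h2
  have h3 := r.dist_of_le hn
  refine eq_of_apply_eq_dist (ofRay r) (u := r.toFun m) ?_ ?_ h2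
  · rw [h1, h2, h3]
    omega
  · rw [ofRay_ray, h3]
    omega

/-- An element fixing all the vertices of a ray far away belongs to the group of its endpoint. -/
lemma mem_pointGroup_of_eventually {g : G} {r : GeodesicRay X}
    (h : ∀ᶠ n in atTop, g • r.toFun n = r.toFun n) : g ∈ pointGroup G (toGeom (ofRay r)) := by
  rw [mem_pointGroup_toGeom]
  refine fun u => ofRay_eq_of_eventually (h.mono fun n hn => ?_)
  have := dist_smul g u (r.toFun n)
  rw [hn] at this
  rw [this, sub_self]

/-- The rays `g • r` and `r` merge, so `g` maps some `r i` to some `r j`; preservation of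
horospheres forces `i = j`. -/
lemma exists_smul_ray_eq_of_mem {g : G} {r : GeodesicRay X}
    (h : g ∈ pointGroup G (toGeom (ofRay r))) : ∃ n, g • r.toFun n = r.toFun n := by
  have h1 : ofRay (g.1 • r) = ofRay r :=
    (smul_ofRay g.1 r).symm.trans (smul_eq_self_of_mem h)
  obtain ⟨i, j, hij⟩ := exists_merge h1
  have h2 := hij 0
  rw [add_zero, add_zero] at h2
  have h2 : g • r.toFun i = r.toFun j := h2
  have h3 := (mem_pointGroup_toGeom g _).1 h (r.toFun i)
  rw [h2, ofRay_ray] at h3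
  have : i = j := by omega
  exact ⟨i, by rw [h2, this]⟩

/-- Closedness in both variables is the upper semicontinuity of `c ↦ G_c`, one half of continuity in
the Chabauty topology. -/
lemma isClosed_setOf_mem_pointGroup :
    IsClosed {p : Horo X × G | p.2 ∈ pointGroup G (toGeom p.1)} := by
  simp only [mem_pointGroup_toGeom, ofPred_forall]
  exact isClosed_iInter fun u => isClosed_eq (continuous_apply_smul u) continuous_const

variable (G) in
/-- The closed subgroup `G_x` of `G`. -/
noncomputable def closedGroup (c : Horo X) : ClosedSubgroup G where
  toSubgroup := pointGroup G (toGeom c)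
  isClosed' := isClosed_setOf_mem_pointGroup.preimage (Continuous.prodMk_right c)

lemma closedGroup_vertex (w : V) : closedGroup G (vertex w : Horo X) = vertexStabilizer G w := by
  refine ClosedSubgroup.toSubgroup_injective (Subgroup.ext fun g => ?_)
  exact mem_pointGroup_vertex

lemma closedGroup_ofBoundary (ξ : Boundary X) :
    (closedGroup G (ofBoundary ξ)).toSubgroup = horosphereStabilizer G ξ := by
  change pointGroup G (toGeom (ofBoundary ξ)) = _
  rw [toGeom_ofBoundary]
  rfl

lemma closedGroup_smul (g : G) (c : Horo X) :
    closedGroup G (g • c) = conjAction g (closedGroup G c) := by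
  have e : toGeom (g • c) = g • toGeom c := toGeom_smul g.1 c
  refine ClosedSubgroup.toSubgroup_injective (Subgroup.ext fun k => ?_)
  change k ∈ pointGroup G (toGeom (g • c)) ↔ k ∈ Subgroup.map _ (pointGroup G (toGeom c))
  rw [e]
  constructor
  · intro h
    refine ⟨g⁻¹ * k * g, ?_, ?_⟩
    · have := conj_mem_pointGroup G g⁻¹ k _ h
      rw [inv_smul_smul, inv_inv] at this
      exact this
    · change g * (g⁻¹ * k * g) * g⁻¹ = k
      group
  · rintro ⟨k, hk, rfl⟩
    exact conj_mem_pointGroup G g k _ hk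

end Horo

end PointGroup

/-! ### Continuity and separation in the Chabauty topology. -/

section ChabautyLemmas

lemma continuous_closedSubgroup {Γ Y : Type*} [Group Γ] [TopologicalSpace Γ] [TopologicalSpace Y]
    {f : Y → ClosedSubgroup Γ}
    (h : ∀ y, ∀ C : Set Γ, IsCompact C → ∀ W ∈ 𝓝 (1 : Γ),
      ∀ᶠ z in 𝓝 y, chabautyRel Γ C W (f y) (f z)) : Continuous f := by
  refine ⟨fun U hU => isOpen_iff_mem_nhds.2 fun y hy => ?_⟩
  obtain ⟨C, hC, W, hW, hCW⟩ := hU (f y) hy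
  exact (h y C hC W hW).mono fun z hz => hCW _ hz

/-- `A` is a union of cosets `W * a`, so an element of `A` perturbed by `W` is still in `A`. Two
subgroups close with respect to `(A, W)` thus meet `A` simultaneously. -/
lemma isClopen_setOf_inter_nonempty {Γ : Type*} [Group Γ] [TopologicalSpace Γ] {A : Set Γ}
    (hA : IsCompact A) {W : Subgroup Γ} (hW : (W : Set Γ) ∈ 𝓝 1)
    (hWA : ∀ w ∈ W, ∀ a ∈ A, w * a ∈ A) :
    IsClopen {F : ClosedSubgroup Γ | ((F : Set Γ) ∩ A).Nonempty} := by
  have key : ∀ F F' : Set Γ, F ∩ A ⊆ W * F' → (F ∩ A).Nonempty → (F' ∩ A).Nonempty := by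
    rintro F F' h ⟨a, ha⟩
    obtain ⟨w, hw, f, hf, rfl⟩ := h ha
    refine ⟨f, hf, ?_⟩
    have := hWA w⁻¹ (W.inv_mem hw) _ ha.2
    rwa [inv_mul_cancel_left] at this
  refine ⟨⟨fun F hF => ⟨A, hA, W, hW, fun F' hF' h => hF (key _ _ hF'.2 h)⟩⟩,
    fun F hF => ⟨A, hA, W, hW, fun F' hF' => key _ _ hF'.1 hF⟩⟩

variable {V : Type*} {X : SimpleGraph V} {G : Subgroup (X ≃g X)}

lemma exists_finset_forall_mem {g : G} {U : Set G} (hU : U ∈ 𝓝 g) :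
    ∃ S : Finset V, ∀ h : G, (∀ v ∈ S, h • v = g • v) → h ∈ U := by
  let _ : TopologicalSpace V := ⊥
  have : DiscreteTopology V := ⟨rfl⟩
  have hind : IsInducing (fun (g : G) (v : V) => g • v) :=
    (IsInducing.mk (f := fun (g : X ≃g X) (v : V) => g v) rfl).comp IsInducing.subtypeVal
  rw [hind.nhds_eq_comap, mem_comap] at hU
  obtain ⟨T, hT, hTU⟩ := hU
  rw [nhds_pi, Filter.mem_pi] at hT
  obtain ⟨I, hI, t, ht, hIT⟩ := hT
  refine ⟨hI.toFinset, fun h hh => hTU (hIT fun v hv => ?_)⟩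
  have := mem_of_mem_nhds (ht v)
  rw [← hh v (hI.mem_toFinset.2 hv)] at this
  exact this

lemma t2Space_closedSubgroup [X.LocallyFinite] (hX : X.Connected)
    (hG : IsClosed (G : Set (X ≃g X))) : T2Space (ClosedSubgroup G) := by
  classical
  have sep : ∀ F F' : ClosedSubgroup G, (∃ g ∈ F, g ∉ F') →
      ∃ U : Set (ClosedSubgroup G), IsClopen U ∧ F ∈ U ∧ F' ∉ U := by
    rintro F F' ⟨g, hg, hg'⟩
    obtain ⟨S, hS⟩ := exists_finset_forall_mem (F'.isClosed'.isOpen_compl.mem_nhds hg')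
    have v := hX.nonempty.some
    -- Agreement with `g` on `S` keeps `A` away from `F'`; the extra vertex `v` makes `A` compact
    -- even if `S` is empty.
    let A : Set G := {h | ∀ u ∈ insert v S, h • u = g • u}
    let W : Subgroup G := ⨅ u ∈ insert v S, MulAction.stabilizer G (g • u)
    have hWmem : ∀ w, w ∈ W ↔ ∀ u ∈ insert v S, w • g • u = g • u := by
      intro w
      simp only [W, Subgroup.mem_iInf, MulAction.mem_stabilizer_iff]
    have hA : IsCompact A := by
      refine (isCompact_setOf_smul_eq hX hG v (g • v)).of_isClosed_subset ?_
        fun h hh => hh v (Finset.mem_insert_self _ _)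
      have : A = ⋂ u ∈ insert v S, {h : G | h • u = g • u} := by
        ext h
        simp only [A, mem_iInter, mem_ofPred_eq]
      rw [this]
      exact isClosed_biInter fun u _ => (isClopen_setOf_smul_eq u _).isClosed
    have hW : (W : Set G) ∈ 𝓝 1 := by
      have : (W : Set G) = ⋂ u ∈ insert v S, {w : G | w • g • u = g • u} := by
        ext w
        rw [SetLike.mem_coe, hWmem]
        simp only [mem_iInter, mem_ofPred_eq]
      rw [this]
      exact (isOpen_biInter_finset fun u _ => (isClopen_setOf_smul_eq _ _).isOpen).mem_nhds
        (by simp)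
    refine ⟨_, isClopen_setOf_inter_nonempty hA hW fun w hw a ha u hu => ?_,
      ⟨g, hg, fun u _ => rfl⟩, ?_⟩
    · rw [mul_smul, ha u hu, (hWmem w).1 hw u hu]
    · rintro ⟨h, hh, hhA⟩
      exact hS h (fun u hu => hhA u (Finset.mem_insert_of_mem hu)) hh
  refine ⟨fun F F' hFF' => ?_⟩
  by_cases h : ∃ g ∈ F, g ∉ F'
  · obtain ⟨U, hU, h1, h2⟩ := sep F F' h
    exact ⟨U, Uᶜ, hU.isOpen, hU.compl.isOpen, h1, h2, disjoint_compl_right⟩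
  · have h' : ∃ g ∈ F', g ∉ F := by
      by_contra! h'
      push Not at h
      exact hFF' (SetLike.ext fun g => ⟨h g, h' g⟩)
    obtain ⟨U, hU, h1, h2⟩ := sep F' F h'
    exact ⟨Uᶜ, U, hU.compl.isOpen, hU.isOpen, h2, h1, disjoint_compl_left⟩

end ChabautyLemmas

/-- The ray obtained by removing an initial segment. -/
def GeodesicRay.drop {V : Type*} {X : SimpleGraph V} (r : GeodesicRay X) (m : ℕ) :
    GeodesicRay X :=
  ⟨fun n => r.toFun (m + n), fun i k => by
    rw [← add_assoc]
    exact r.dist_eq _ _⟩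

/-! ### Continuity and injectivity of the map from points to groups. -/

namespace Horo

variable {V : Type*} {X : SimpleGraph V} [X.LocallyFinite] [hX : Fact X.IsTree]
  {G : Subgroup (X ≃g X)}

omit [X.LocallyFinite] in
lemma denseRange_vertex : DenseRange (vertex : V → Horo X) := by
  intro c
  rcases c.cases with ⟨w, rfl⟩ | ⟨r, rfl⟩
  · exact subset_closure ⟨w, rfl⟩
  · exact mem_closure_of_tendsto (tendsto_vertex_ray r) (Eventually.of_forall fun n => ⟨_, rfl⟩)

/-- A continuous injective equivariant map to a Hausdorff space identifies the geometric
compactification of the set of vertices with the closure of the image of this set. -/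
lemma exists_homeo {Z : Type*} [TopologicalSpace Z] [T2Space Z] {F : Horo X → Z}
    (hF : Continuous F) (hinj : Function.Injective F) {ι : V → Z} (hι : ∀ w, F (vertex w) = ι w)
    {β : G → Z → Z} (hβ : ∀ g c, F (g • c) = β g (F c)) :
    closure (range ι) = range F ∧ ∃ f : geomVertices X ≃ₜ closure (range ι),
      IsEquivariant (fun (g : G) x => g • x) β f ∧
      ∀ c (h : toGeom c ∈ geomVertices X), (f ⟨toGeom c, h⟩ : Z) = F c := by
  have hemb : IsClosedEmbedding F := hF.isClosedEmbedding hinj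
  have hcl : closure (range ι) = range F := by
    have : range ι = F '' range vertex := by
      rw [← range_comp]
      exact congrArg range (funext fun w => (hι w).symm)
    rw [this, hemb.isClosedMap.closure_image_eq_of_continuous hF, denseRange_vertex.closure_eq,
      image_univ]
  refine ⟨hcl, (homeo X).symm.trans
    (hemb.isEmbedding.toHomeomorph.trans (Homeomorph.setCongr hcl.symm)), ?_⟩
  have key : ∀ c (h : toGeom c ∈ geomVertices X),
      (((homeo X).symm.trans (hemb.isEmbedding.toHomeomorph.trans (Homeomorph.setCongr hcl.symm)))
        ⟨toGeom c, h⟩ : Z) = F c := by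
    intro c h
    have : (homeo X).symm ⟨toGeom c, h⟩ = c :=
      (homeo X).injective (by rw [Homeomorph.apply_symm_apply]; rfl)
    change F ((homeo X).symm ⟨toGeom c, h⟩) = F c
    rw [this]
  refine ⟨⟨?_, ?_⟩, key⟩
  · intro g z hz
    rw [hcl] at hz ⊢
    obtain ⟨c, rfl⟩ := hz
    exact ⟨g • c, hβ g c⟩
  · rintro g ⟨y, hy⟩
    obtain ⟨c, rfl⟩ := geomVertices_eq_range.subset hy
    have e : g • toGeom c = toGeom (g • c) := (toGeom_smul g.1 c).symm
    have h : g • toGeom c ∈ geomVertices X := e ▸ toGeom_mem _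
    refine ⟨h, ?_⟩
    rw [key c hy, ← hβ, ← key (g • c) (toGeom_mem _)]
    congr 2
    exact Subtype.ext e

omit [X.LocallyFinite] in
lemma ofRay_drop (r : GeodesicRay X) (m : ℕ) : ofRay (r.drop m) = ofRay r := by
  ext u v
  refine ofRay_eq_of_eventually ?_
  have := (tendsto_add_atTop_nat m).eventually (ofRay_eventually r u v)
  refine this.mono fun n hn => ?_
  rwa [add_comm] at hn

omit [X.LocallyFinite] in
lemma smul_vertex' (g : G) (w : V) : g • (vertex w : Horo X) = vertex (g • w) :=
  smul_vertex g.1 w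

omit [X.LocallyFinite] in
lemma isCompact_ray (r : GeodesicRay X) :
    IsCompact (insert (ofRay r) (range fun n => (vertex (r.toFun n) : Horo X))) :=
  (tendsto_vertex_ray r).isCompact_insert_range

/-- The closed ray meets every orbit of the compact stabilizer of its origin. This presents the
whole space as the image of a compact product. -/
lemma exists_smul_eq (hleaf : ∀ v, 2 ≤ X.degree v)
    (hG : IsClosed (G : Set (X ≃g X))) (htrans : IsLocallyInftyTransitive G)
    (r : GeodesicRay X) (c : Horo X) :
    ∃ k : G, k • r.toFun 0 = r.toFun 0 ∧
      ∃ y ∈ insert (ofRay r) (range fun n => (vertex (r.toFun n) : Horo X)), k • y = c := by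
  rcases c.cases with ⟨w, rfl⟩ | ⟨s, rfl⟩
  · obtain ⟨k, hk, hkw⟩ := htrans.exists_smul (v := r.toFun 0)
      (x := r.toFun (X.dist (r.toFun 0) w)) (y := w) (by
        rw [r.dist_of_le (Nat.zero_le _)]
        simp)
    exact ⟨k, hk, _, Or.inr ⟨_, rfl⟩, by rw [smul_vertex', hkw]⟩
  · obtain ⟨s', hs', hs⟩ := exists_ray_from s (r.toFun 0)
    obtain ⟨k, hk⟩ := exists_smul_ray hX.out hleaf hG htrans (r := r) (s := s') hs'.symm
    refine ⟨k, by rw [hk, hs'], _, Or.inl rfl, ?_⟩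
    rw [hs]
    refine (smul_ofRay k.1 r).trans (congrArg ofRay (GeodesicRay.ext hk))

/-- Points close to the endpoint of a ray are obtained from points of the ray by applying an
element of `G` close to the identity. -/
lemma eventually_exists_smul_eq (hleaf : ∀ v, 2 ≤ X.degree v)
    (hG : IsClosed (G : Set (X ≃g X))) (htrans : IsLocallyInftyTransitive G)
    (r : GeodesicRay X) {W : Set G} (hW : W ∈ 𝓝 1) (N : ℕ) :
    ∀ᶠ c in 𝓝 (ofRay r), ∃ h ∈ W, ∃ y : Horo X, h • y = c ∧
      (y = ofRay r ∨ ∃ n ≥ N, y = vertex (r.toFun n)) := by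
  let K : Set G := {k | k • r.toFun 0 = r.toFun 0}
  let R : Set (Horo X) := insert (ofRay r) (range fun n => (vertex (r.toFun n) : Horo X))
  have : CompactSpace K :=
    isCompact_iff_compactSpace.1 (isCompact_setOf_smul_eq hX.out.connected hG _ _)
  have : CompactSpace R := isCompact_iff_compactSpace.1 (isCompact_ray r)
  let f : K × R → Horo X := fun p => p.1.1 • p.2.1
  have hf : Continuous f := by fun_prop
  have hev : ∀ᶠ y : Horo X in 𝓝 (ofRay r), ∀ n < N, y ≠ vertex (r.toFun n) := by
    refine (eventually_all_finite (finite_lt_nat N)).2 fun n _ => ?_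
    exact isOpen_compl_singleton.mem_nhds (ofRay_ne_vertex r _)
  -- The fibre over the endpoint consists of pairs `(k, ofRay r)` with `k` fixing the endpoint. As
  -- `f` is closed, the fibres over nearby points lie close to this one.
  have hp : ∀ p ∈ f ⁻¹' {ofRay r}, ∀ᶠ q : K × R in 𝓝 p,
      (∃ s ∈ K, s • ofRay r = ofRay r ∧ q.1.1 * s⁻¹ ∈ W) ∧
        ∀ n < N, q.2.1 ≠ vertex (r.toFun n) := by
    rintro ⟨⟨k, hk⟩, ⟨y, hy⟩⟩ h
    have hky : k • y = ofRay r := h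
    have hyr : y = ofRay r := by
      rcases hy with hy | ⟨n, hn⟩
      · exact hy
      · have hn : vertex (r.toFun n) = y := hn
        rw [← hn, smul_vertex'] at hky
        exact (ofRay_ne_vertex r _ hky.symm).elim
    subst hyr
    have h1 : ∀ᶠ q : K × R in 𝓝 (⟨k, hk⟩, ⟨ofRay r, hy⟩), q.1.1 * k⁻¹ ∈ W := by
      have hc : Continuous fun q : K × R => q.1.1 * k⁻¹ := by fun_prop
      refine hc.continuousAt.eventually ?_
      change W ∈ 𝓝 (k * k⁻¹)
      rwa [mul_inv_cancel]
    have h2 : ∀ᶠ q : K × R in 𝓝 (⟨k, hk⟩, ⟨ofRay r, hy⟩),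
        ∀ n < N, q.2.1 ≠ vertex (r.toFun n) := by
      have hc : Continuous fun q : K × R => q.2.1 := by fun_prop
      exact (hc.tendsto (⟨k, hk⟩, ⟨ofRay r, hy⟩)).eventually hev
    filter_upwards [h1, h2] with q hq1 hq2
    exact ⟨⟨k, hk, hky, hq1⟩, hq2⟩
  filter_upwards [hf.isClosedMap.eventually_nhds_fiber _ hp] with c hc
  obtain ⟨k, hk, y, hy, rfl⟩ := exists_smul_eq hleaf hG htrans r c
  obtain ⟨⟨s, hs, hsr, hks⟩, hyN⟩ := hc (⟨k, hk⟩, ⟨y, hy⟩) rfl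
  dsimp only at hks hyN
  -- `s` fixes the origin and the endpoint, hence the whole ray. So `k` can be replaced by the small
  -- element `k * s⁻¹` without changing the image of `y`.
  have hfix : ∀ n, s • r.toFun n = r.toFun n := by
    have h1 : ofRay (s.1 • r) = ofRay r := (smul_ofRay s.1 r).symm.trans hsr
    have h2 : s.1 • r = r := ray_unique h1 hs
    intro n
    conv_rhs => rw [← h2]
    rfl
  refine ⟨k * s⁻¹, hks, y, ?_, ?_⟩
  · have : s⁻¹ • y = y := by
      rw [inv_smul_eq_iff]
      rcases hy with rfl | ⟨n, rfl⟩
      · exact hsr.symm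
      · rw [smul_vertex', hfix]
    rw [mul_smul, this]
  · rcases hy with rfl | ⟨n, rfl⟩
    · exact Or.inl rfl
    · exact Or.inr ⟨n, not_lt.1 fun hn => hyN n hn rfl, rfl⟩

lemma eventually_subset_mul_closedGroup (hleaf : ∀ v, 2 ≤ X.degree v)
    (hG : IsClosed (G : Set (X ≃g X))) (htrans : IsLocallyInftyTransitive G)
    (r : GeodesicRay X) {C W : Set G} (hC : IsCompact C) (hW : W ∈ 𝓝 1) :
    ∀ᶠ c in 𝓝 (ofRay r), (closedGroup G (ofRay r) : Set G) ∩ C ⊆ W * (closedGroup G c : Set G) := by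
  suffices h : ∀ᶠ c in 𝓝 (ofRay r), ∀ g ∈ C,
      g ∈ pointGroup G (toGeom (ofRay r)) → g ∈ W * (closedGroup G c : Set G) from
    h.mono fun c hc g hg => hc g hg.2 hg.1
  -- Compactness of `C` reduces the statement to `g` near a given `g₀`.
  refine hC.eventually_forall_of_forall_eventually
    (P := fun c g => g ∈ pointGroup G (toGeom (ofRay r)) → g ∈ W * (closedGroup G c : Set G))
    fun g₀ _ => ?_
  by_cases hg₀ : g₀ ∈ pointGroup G (toGeom (ofRay r))
  · obtain ⟨N, hN⟩ := exists_smul_ray_eq_of_mem hg₀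
    have hcont : Continuous fun p : G × G => p.1 * p.2 * p.1⁻¹ * p.2⁻¹ := by fun_prop
    have h1 : ∀ᶠ p : G × G in 𝓝 (g₀, 1), p.1 * p.2 * p.1⁻¹ * p.2⁻¹ ∈ W := by
      refine hcont.continuousAt.eventually ?_
      change W ∈ 𝓝 (g₀ * 1 * g₀⁻¹ * 1⁻¹)
      simpa using hW
    rw [nhds_prod_eq, eventually_prod_iff] at h1
    obtain ⟨pa, hpa, pb, hpb, hab⟩ := h1
    have h2 : ∀ᶠ g : G in 𝓝 g₀, g • r.toFun N = r.toFun N :=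
      (isClopen_setOf_smul_eq _ _).isOpen.mem_nhds hN
    have h3 := eventually_exists_smul_eq hleaf hG htrans r hpb N
    rw [nhds_prod_eq]
    refine (h3.prod_mk (hpa.and h2)).mono ?_
    rintro ⟨c, g⟩ ⟨⟨h, hh, y, rfl, hy⟩, hg, hgN⟩ hgr
    -- `g` lies in the group of `y`, so `h g h⁻¹` lies in that of `h • y`. The commutator is small
    -- because `h` is small, uniformly for `g` near `g₀`.
    refine ⟨g * h * g⁻¹ * h⁻¹, hab hg hh, h * g * h⁻¹, ?_, by group⟩
    have hgy : g ∈ pointGroup G (toGeom y) := by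
      rcases hy with rfl | ⟨n, hn, rfl⟩
      · exact hgr
      · exact mem_pointGroup_vertex.2 (smul_ray_eq_of_mem hgr hgN hn)
    have := conj_mem_pointGroup G h g _ hgy
    have e : toGeom (h • y) = h • toGeom y := toGeom_smul h.1 y
    rw [← e] at this
    exact this
  · have h1 : ∀ᶠ g : G in 𝓝 g₀, g ∉ pointGroup G (toGeom (ofRay r)) :=
      (closedGroup G (ofRay r)).isClosed'.isOpen_compl.mem_nhds hg₀
    rw [nhds_prod_eq]
    exact (h1.prod_inr _).mono fun p hp hp' => (hp hp').elim

omit [X.LocallyFinite] in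
lemma eventually_subset_mul_closedGroup_self (c₀ : Horo X) {C W : Set G} (hC : IsCompact C)
    (hW : W ∈ 𝓝 1) :
    ∀ᶠ c in 𝓝 c₀, (closedGroup G c : Set G) ∩ C ⊆ W * (closedGroup G c₀ : Set G) := by
  suffices h : ∀ᶠ c in 𝓝 c₀, ∀ g ∈ C,
      g ∈ pointGroup G (toGeom c) → g ∈ W * (closedGroup G c₀ : Set G) from
    h.mono fun c hc g hg => hc g hg.2 hg.1
  refine hC.eventually_forall_of_forall_eventually
    (P := fun c g => g ∈ pointGroup G (toGeom c) → g ∈ W * (closedGroup G c₀ : Set G))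
    fun g₀ _ => ?_
  by_cases hg₀ : g₀ ∈ pointGroup G (toGeom c₀)
  · have h1 : ∀ᶠ g : G in 𝓝 g₀, g * g₀⁻¹ ∈ W := by
      have hc : Continuous fun g : G => g * g₀⁻¹ := by fun_prop
      refine hc.continuousAt.eventually ?_
      change W ∈ 𝓝 (g₀ * g₀⁻¹)
      rwa [mul_inv_cancel]
    rw [nhds_prod_eq]
    exact (h1.prod_inr _).mono fun p hp _ => ⟨p.2 * g₀⁻¹, hp, g₀, hg₀, by group⟩
  · have h1 : ∀ᶠ p : Horo X × G in 𝓝 (c₀, g₀), p.2 ∉ pointGroup G (toGeom p.1) :=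
      isClosed_setOf_mem_pointGroup.isOpen_compl.mem_nhds hg₀
    exact h1.mono fun p hp hp' => (hp hp').elim

lemma continuous_closedGroup (hleaf : ∀ v, 2 ≤ X.degree v)
    (hG : IsClosed (G : Set (X ≃g X))) (htrans : IsLocallyInftyTransitive G) :
    Continuous (closedGroup G : Horo X → ClosedSubgroup G) := by
  refine continuous_closedSubgroup fun c C hC W hW => ?_
  refine Eventually.and ?_ (eventually_subset_mul_closedGroup_self c hC hW)
  rcases c.cases with ⟨w, rfl⟩ | ⟨r, rfl⟩
  · filter_upwards [(isOpen_singleton_vertex w).mem_nhds rfl] with c hc g hg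
    rw [mem_singleton_iff.1 hc]
    exact ⟨1, mem_of_mem_nhds hW, g, hg.1, one_mul g⟩
  · exact eventually_subset_mul_closedGroup hleaf hG htrans r hC hW

/-- The sphere around `v` through `w` contains a vertex in another direction at `v`, and `K_v` is
transitive on it. -/
lemma exists_smul_eq_self_smul_ne (hleaf : ∀ v, 2 ≤ X.degree v)
    (htrans : IsLocallyInftyTransitive G) {v w : V} (h : v ≠ w) :
    ∃ g : G, g • v = v ∧ g • w ≠ w := by
  obtain ⟨b, hb, hbw⟩ := exists_adj_dist_eq hX.out.connected h
  obtain ⟨b', hb', hne⟩ := exists_adj_ne hleaf v b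
  obtain ⟨r, hr0, hr1⟩ := exists_ray_of_adj hX.out hleaf hb'
  have hd : X.dist v (r.toFun (X.dist v w)) = X.dist v w := by
    nth_rw 1 [← hr0]
    rw [r.dist_of_le (Nat.zero_le _), Nat.sub_zero]
  obtain ⟨g, hg, hgw⟩ := htrans.exists_smul hd.symm
  refine ⟨g, hg, fun hw => ?_⟩
  rw [hw] at hgw
  have h1 := r.dist_of_le (m := 1) (n := X.dist v w) (by omega)
  rw [← hgw, hr1] at h1
  rcases dist_adj_cases hX.out hb' w with h2 | h2
  · exact hne (adj_unique_of_dist hX.out hb' hb h2 hbw)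
  · omega

lemma exists_smul_eq_self_smul_ofRay_ne (hleaf : ∀ v, 2 ≤ X.degree v)
    (hG : IsClosed (G : Set (X ≃g X))) (htrans : IsLocallyInftyTransitive G) (v : V)
    (r : GeodesicRay X) : ∃ g : G, g • v = v ∧ g • ofRay r ≠ ofRay r := by
  obtain ⟨s, rfl, hs⟩ := exists_ray_from r v
  obtain ⟨b, hb, hne⟩ := exists_adj_ne hleaf (s.toFun 0) (s.toFun 1)
  obtain ⟨s', hs0, hs1⟩ := exists_ray_of_adj hX.out hleaf hb
  obtain ⟨g, hg⟩ := exists_smul_ray hX.out hleaf hG htrans hs0.symm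
  refine ⟨g, by rw [hg, hs0], fun h => ?_⟩
  have h1 : g • ofRay s = ofRay s' :=
    (smul_ofRay g.1 s).trans (congrArg ofRay (GeodesicRay.ext hg))
  rw [hs, h1] at h
  rw [← hs1, ray_unique h hs0] at hne
  exact hne rfl

/-- On the line joining the two endpoints choose a branch vertex. By strong transitivity some
element fixes the half-line towards the end of `r` and turns the other half-line into a third
direction. -/
lemma exists_mem_smul_ofRay_ne (hsemi : IsSemiHomogeneous X) (hleaf : ∀ v, 2 ≤ X.degree v)
    (hline : ∃ v, 3 ≤ X.degree v) (hG : IsClosed (G : Set (X ≃g X)))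
    (htrans : IsLocallyInftyTransitive G) {r s : GeodesicRay X} (h : ofRay r ≠ ofRay s) :
    ∃ g ∈ pointGroup G (toGeom (ofRay r)), g • ofRay s ≠ ofRay s := by
  obtain ⟨b, a, hba, hr, hs⟩ := exists_adj_apply_ne h
  obtain ⟨s₀, hs₀, hs₀s⟩ := exists_ray_from s a
  have hs₁ : s₀.toFun 1 = b := by
    refine (ofRay s).isHoro.unique a _ _ (by rw [← hs₀]; exact s₀.adj 0) hba.symm ?_ hs
    rw [hs₀s, ← hs₀, ofRay_ray]
    rfl
  obtain ⟨m, hm, hdeg⟩ : ∃ m ≤ 1, 3 ≤ X.degree (s₀.toFun m) := by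
    rcases three_le_degree_or hsemi hline hba with h | h
    · exact ⟨1, le_rfl, by rwa [hs₁]⟩
    · exact ⟨0, by omega, by rwa [hs₀]⟩
  obtain ⟨r₀, hr₀, hr₀r⟩ := exists_ray_from r (s₀.toFun m)
  -- The ray `s₀` climbs with respect to `r` from its first edge on, so at `s₀ m` it leaves in a
  -- direction other than that of `r₀`.
  have hrm : ofRay r (s₀.toFun m) (s₀.toFun (m + 1)) ≠ 1 := by
    have h1 := (ofRay r).ascend hX.out (x := s₀.toFun (m + 1)) hba.symm
      (by rw [(ofRay r).swap b a, hr]) (by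
        rw [← hs₀, ← hs₁, s₀.dist_of_le (Nat.zero_le _), s₀.dist_of_le (by omega)]
        omega)
    have h2 := (ofRay r).add a (s₀.toFun m) (s₀.toFun (m + 1))
    have h3 := abs_le.1 ((ofRay r).le_dist hX.out.connected a (s₀.toFun m))
    rw [← hs₀, s₀.dist_of_le (Nat.zero_le _)] at h1 h3
    rw [← hs₀] at h2
    omega
  have hne : (s₀.drop m).toFun 1 ≠ r₀.toFun 1 := by
    intro h1
    have h2 := ofRay_ray r₀ 0 1
    rw [← hr₀r, ← h1, hr₀] at h2
    exact hrm h2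
  obtain ⟨u, hu, hut, hur⟩ := exists_adj_ne_ne hdeg ((s₀.drop m).toFun 1) (r₀.toFun 1)
  obtain ⟨s', hs'0, hs'1⟩ := exists_ray_of_adj hX.out hleaf hu
  obtain ⟨L, hL⟩ := exists_line_of_rays hX.out (r := s₀.drop m) (s := r₀) hr₀.symm hne
  obtain ⟨L', hL'⟩ := exists_line_of_rays hX.out (r := s') (s := r₀) (hs'0.trans hr₀.symm)
    (by rw [hs'1]; exact hur)
  obtain ⟨g, hg⟩ := exists_smul_line hX.out hG htrans L L' (i := 0) (i' := 0) ⟨1, by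
    have h1 := (hL 0).1
    have h2 := (hL' 0).1
    rw [Nat.cast_zero] at h1 h2
    rw [one_smul, h1, h2, hs'0]
    rfl⟩
  simp only [zero_add] at hg
  refine ⟨g, ?_, fun hgs => ?_⟩
  · rw [hr₀r]
    refine mem_pointGroup_of_eventually (Eventually.of_forall fun n => ?_)
    have := hg (-n)
    rwa [(hL n).2, (hL' n).2] at this
  · have h1 : g • ofRay (s₀.drop m) = ofRay s' := by
      refine (smul_ofRay g.1 _).trans (congrArg ofRay (GeodesicRay.ext fun n => ?_))
      have := hg n
      rwa [(hL n).1, (hL' n).1] at this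
    rw [hs₀s, ← ofRay_drop s₀ m, h1] at hgs
    rw [← hs'1, ray_unique hgs hs'0] at hut
    exact hut rfl

lemma closedGroup_injective (hsemi : IsSemiHomogeneous X) (hleaf : ∀ v, 2 ≤ X.degree v)
    (hline : ∃ v, 3 ≤ X.degree v) (hG : IsClosed (G : Set (X ≃g X)))
    (htrans : IsLocallyInftyTransitive G) :
    Function.Injective (closedGroup G : Horo X → ClosedSubgroup G) := by
  have hvr : ∀ w r, closedGroup G (vertex w) ≠ closedGroup G (ofRay r : Horo X) := by
    intro w r h
    obtain ⟨g, hg, hgr⟩ := exists_smul_eq_self_smul_ofRay_ne hleaf hG htrans w r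
    have h1 : g ∈ closedGroup G (vertex w : Horo X) := mem_pointGroup_vertex.2 hg
    rw [h] at h1
    exact hgr (smul_eq_self_of_mem h1)
  intro c d h
  rcases c.cases with ⟨w, rfl⟩ | ⟨r, rfl⟩ <;> rcases d.cases with ⟨w', rfl⟩ | ⟨r', rfl⟩
  · by_contra hne
    obtain ⟨g, hg, hg'⟩ := exists_smul_eq_self_smul_ne hleaf htrans
      (fun e : w = w' => hne (congrArg vertex e))
    have h1 : g ∈ closedGroup G (vertex w : Horo X) := mem_pointGroup_vertex.2 hg
    rw [h] at h1
    exact hg' (mem_pointGroup_vertex.1 h1)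
  · exact (hvr _ _ h).elim
  · exact (hvr _ _ h.symm).elim
  · by_contra hne
    obtain ⟨g, hg, hg'⟩ := exists_mem_smul_ofRay_ne hsemi hleaf hline hG htrans hne
    have h1 : g ∈ closedGroup G (ofRay r) := hg
    rw [h] at h1
    exact hg' (smul_eq_self_of_mem h1)

end Horo

/-! ### Lines, their closures and their stabilizers. -/

section LineClosure

variable {V : Type*} {X : SimpleGraph V}

namespace GeodesicLine

/-- The positive half of a line. -/
def ray (L : GeodesicLine X) : GeodesicRay X :=
  ⟨fun n => L.toFun n, fun m k => by
    rw [Nat.cast_add]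
    exact L.dist_eq m k⟩

/-- The same line with the opposite orientation. -/
def rev (L : GeodesicLine X) : GeodesicLine X :=
  ⟨fun n => L.toFun (-n), fun m k => by
    rw [L.dist_natAbs]
    omega⟩

lemma range_rev (L : GeodesicLine X) : range L.rev.toFun = range L.toFun :=
  (neg_surjective (G := ℤ)).range_comp L.toFun

lemma points_rev (L : GeodesicLine X) : L.rev.points = L.points := by
  simp only [points, range_rev]

lemma closed_rev (L : GeodesicLine X) : L.rev.closed = L.closed := by
  simp only [closed, points_rev]

lemma vertex_mem_closed_iff (L : GeodesicLine X) {w : V} :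
    (.vertex w : GeomComp X) ∈ L.closed ↔ w ∈ range L.toFun := by
  constructor
  · intro h
    obtain ⟨x, ⟨p, hp, rfl⟩, q, hq, hqL⟩ := mem_closure_iff.1 h
      (GeomComp.point '' {p : Realization X | 0 < p.coord w})
      (isOpen_image_point (isOpen_lt continuous_const (Realization.continuous_coord w)))
      ⟨_, Realization.ofVertex_coord_pos.2 rfl, rfl⟩
    rw [GeomComp.point.inj hq] at hp
    exact hqL w (ne_of_gt hp)
  · intro h
    refine subset_closure ⟨_, rfl, fun v hv => ?_⟩
    by_cases hvw : v = w
    · rwa [hvw]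
    · exact (hv (Realization.ofVertex_coord_of_ne hvw)).elim

lemma mem_stabilizer_points {G : Subgroup (X ≃g X)} (L : GeodesicLine X) {g : G}
    (h : ∀ v, g • v ∈ range L.toFun ↔ v ∈ range L.toFun) :
    g ∈ MulAction.stabilizer G L.points := by
  rw [MulAction.mem_stabilizer_iff]
  ext x
  rw [mem_smul_set_iff_inv_smul_mem]
  rcases x with p | ξ
  · constructor
    · rintro ⟨q, hq, hL⟩
      refine ⟨p, rfl, fun v hv => ?_⟩
      have hq : g.1⁻¹ • p = q := GeomComp.point.inj hq
      have := hL (g⁻¹ • v) (by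
        rw [← hq, Realization.smul_coord]
        change p.coord (g • g⁻¹ • v) ≠ 0
        rwa [smul_inv_smul])
      rwa [← h, smul_inv_smul] at this
    · rintro ⟨q, hq, hL⟩
      refine ⟨g.1⁻¹ • p, rfl, fun v hv => ?_⟩
      rw [GeomComp.point.inj hq, Realization.smul_coord, inv_inv] at hv
      exact (h v).1 (hL _ hv)
  · constructor
    · rintro ⟨q, hq, -⟩
      cases hq
    · rintro ⟨q, hq, -⟩
      cases hq

/-- `L₁` and `L₂` stand for `L` with either orientation, so elements exchanging the ends of `L` are
covered. -/
lemma mem_stabilizer_points_of_forall {G : Subgroup (X ≃g X)} (L : GeodesicLine X) {g : G}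
    {L₁ L₂ : GeodesicLine X} (h₁ : range L₁.toFun = range L.toFun)
    (h₂ : range L₂.toFun = range L.toFun) {i j : ℤ}
    (h : ∀ n, g • L₁.toFun (i + n) = L₂.toFun (j + n)) :
    g ∈ MulAction.stabilizer G L.points := by
  refine L.mem_stabilizer_points fun v => ?_
  nth_rw 1 [← h₂]
  rw [← h₁]
  constructor
  · rintro ⟨n, hn⟩
    refine ⟨i + (n - j), MulAction.injective g ?_⟩
    dsimp only
    rw [h, ← hn]
    congr 1
    ring
  · rintro ⟨n, rfl⟩
    refine ⟨j + (n - i), ?_⟩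
    rw [← h]
    congr 2
    ring

end GeodesicLine

end LineClosure

/-! ### The points at infinity of a line. -/

namespace Horo

variable {V : Type*} {X : SimpleGraph V} [hX : Fact X.IsTree]

/-- The ray from a vertex of `L` towards a limit point of `L` cannot leave `L`, because the shadow
of each of its edges meets `L`. It is therefore one of the two halves of `L`. -/
lemma eq_ray_or_of_mem_closed (L : GeodesicLine X) {r : GeodesicRay X}
    (h : toGeom (ofRay r) ∈ L.closed) : ofRay r = ofRay L.ray ∨ ofRay r = ofRay L.rev.ray := by
  obtain ⟨s, hs0, hs⟩ := exists_ray_from r (L.toFun 0)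
  rw [hs] at h ⊢
  have hall : ∀ n, s.toFun n ∈ range L.toFun := by
    intro n
    induction n with
    | zero => exact ⟨0, hs0.symm⟩
    | succ n ih =>
      obtain ⟨k, hk⟩ := ih
      obtain ⟨x, hx, p, rfl, hp⟩ := mem_closure_iff.1 h _ (isOpen_shadow (s.adj n))
        ((toGeom_mem_shadow (s.adj n) _).2 (by
          rw [ofRay_ray]
          push_cast
          ring))
      obtain ⟨v, hv, hpv⟩ := hx
      obtain ⟨j, rfl⟩ := hp v (ne_of_gt hpv)
      have hv : X.dist (L.toFun j) (s.toFun (n + 1)) < X.dist (L.toFun j) (s.toFun n) := hv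
      rw [SimpleGraph.dist_comm, SimpleGraph.dist_comm (v := s.toFun n)] at hv
      have h1 := dist_adj_cases hX.out (s.adj n) (L.toFun j)
      have hjk : j ≠ k := by
        rintro rfl
        rw [hk, SimpleGraph.dist_self] at hv
        omega
      -- `e` is the direction from `k` to `j`: both the ray and the line step towards `L j`, hence
      -- to the same vertex.
      obtain ⟨e, he, he'⟩ : ∃ e : ℤ, e.natAbs = 1 ∧ (j - k).natAbs = (j - (k + e)).natAbs + 1 := by
        rcases lt_or_gt_of_ne hjk with h2 | h2
        · exact ⟨-1, by omega, by omega⟩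
        · exact ⟨1, by omega, by omega⟩
      refine ⟨k + e, adj_unique_of_dist hX.out (a := s.toFun n) (w := L.toFun j) ?_ (s.adj n) ?_
        (by omega)⟩
      · rw [← hk, ← SimpleGraph.dist_eq_one_iff_adj, L.dist_natAbs]
        omega
      · rw [← hk, L.dist_natAbs, L.dist_natAbs]
        omega
  have habs : ∀ n, s.toFun n = L.toFun n ∨ s.toFun n = L.toFun (-n) := by
    intro n
    obtain ⟨k, hk⟩ := hall n
    have h1 := s.dist_of_le (Nat.zero_le n)
    rw [← hk, hs0, L.dist_natAbs] at h1
    rw [← hk]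
    rcases Int.natAbs_eq k with h2 | h2
    · left
      congr 1
      omega
    · right
      congr 1
      omega
  rcases habs 1 with h1 | h1
  · left
    congr 1
    ext n
    rcases Nat.eq_zero_or_pos n with rfl | hn
    · exact hs0
    · refine (habs n).resolve_right fun h2 => ?_
      have h3 := s.dist_of_le (m := 1) (n := n) hn
      rw [h1, h2, L.dist_natAbs] at h3
      omega
  · right
    congr 1
    ext n
    rcases Nat.eq_zero_or_pos n with rfl | hn
    · exact hs0
    · refine (habs n).resolve_left fun h2 => ?_
      have h3 := s.dist_of_le (m := 1) (n := n) hn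
      rw [h1, h2, L.dist_natAbs] at h3
      omega

variable [X.LocallyFinite]

lemma toGeom_ray_mem_closed (L : GeodesicLine X) : toGeom (ofRay L.ray) ∈ L.closed := by
  have h : Tendsto (fun n => toGeom (vertex (L.ray.toFun n))) atTop (𝓝 (toGeom (ofRay L.ray))) :=
    (continuous_toGeom.tendsto _).comp (tendsto_vertex_ray L.ray)
  refine isClosed_closure.mem_of_tendsto h (Eventually.of_forall fun n => ?_)
  rw [toGeom_vertex]
  exact L.vertex_mem_closed_iff.2 ⟨n, rfl⟩

lemma toGeom_mem_closed_of_mem (L : GeodesicLine X) {y : Horo X}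
    (hy : y ∈ insert (ofRay L.ray) (range fun n => (vertex (L.ray.toFun n) : Horo X))) :
    toGeom y ∈ L.closed := by
  rcases hy with rfl | ⟨n, rfl⟩
  · exact toGeom_ray_mem_closed L
  · dsimp only
    rw [toGeom_vertex]
    exact L.vertex_mem_closed_iff.2 ⟨n, rfl⟩

/-- The vertices and the points at infinity in the closure of a line. -/
lemma cases_of_mem_closed (L : GeodesicLine X) {x : GeomComp X} (hx : x ∈ L.closed)
    (hx' : x ∈ geomVertices X) : (∃ i, x = .vertex (L.toFun i)) ∨
      ∃ L' : GeodesicLine X, range L'.toFun = range L.toFun ∧ L'.closed = L.closed ∧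
        x = toGeom (ofRay L'.ray) := by
  obtain ⟨c, rfl⟩ := geomVertices_eq_range.subset hx'
  rcases c.cases with ⟨w, rfl⟩ | ⟨r, rfl⟩
  · rw [toGeom_vertex] at hx ⊢
    obtain ⟨i, rfl⟩ := L.vertex_mem_closed_iff.1 hx
    exact Or.inl ⟨i, rfl⟩
  · right
    rcases eq_ray_or_of_mem_closed L hx with h | h
    · exact ⟨L, rfl, rfl, by rw [h]⟩
    · exact ⟨L.rev, L.range_rev, L.closed_rev, by rw [h]⟩

end Horo

/-! ### The polyhedral compactification. -/

section Polyhedral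

variable {V : Type*} {X : SimpleGraph V} {G : Subgroup (X ≃g X)}

lemma smul_eq_self_of_mem_pointGroup {g : G} {x : GeomComp X} (h : g ∈ pointGroup G x) :
    g • x = x := by
  rcases x with p | ξ
  · have h : g • p = p := h
    exact congrArg GeomComp.point h
  · exact congrArg GeomComp.boundary h.1

namespace PolComp

/-- The map `[g, x] ↦ g.x`. -/
def toGeom {L : GeodesicLine X} : PolComp G L → GeomComp X :=
  Quotient.lift (fun a : G × L.closed => a.1 • (a.2 : GeomComp X)) (by
    rintro ⟨g, x⟩ ⟨h, y⟩ ⟨n, -, hy, hn⟩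
    dsimp only at hy hn ⊢
    have := smul_eq_self_of_mem_pointGroup hn
    rw [mul_smul, mul_smul, inv_smul_eq_iff, ← hy] at this
    exact this.symm)

variable {L : GeodesicLine X}

lemma toGeom_mk (g : G) (x : L.closed) : toGeom (mk g x) = g • (x : GeomComp X) := rfl

lemma ind {P : PolComp G L → Prop} (h : ∀ g x, P (mk g x)) (q : PolComp G L) : P q :=
  Quotient.inductionOn q fun a => h a.1 a.2

lemma continuous_mk : Continuous fun a : G × L.closed => mk a.1 a.2 := continuous_quot_mk

lemma continuous_toGeom : Continuous (toGeom : PolComp G L → GeomComp X) :=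
  Continuous.quotient_lift (by fun_prop) _

lemma polAction_mk (h g : G) (x : L.closed) : polAction G L h (mk g x) = mk (h * g) x := rfl

lemma toGeom_polAction (h : G) (q : PolComp G L) : toGeom (polAction G L h q) = h • toGeom q := by
  induction q using ind with
  | h g x => rw [polAction_mk, toGeom_mk, toGeom_mk, mul_smul]

lemma smul_mem_geomVertices {g : G} {x : GeomComp X} (h : x ∈ geomVertices X) :
    g • x ∈ geomVertices X := by
  refine map_mem_closure (continuous_const_smul g.1) h ?_
  rintro _ ⟨w, rfl⟩
  exact ⟨g • w, (GeomComp.smul_vertex g.1 w).symm⟩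

lemma smul_mem_geomVertices_iff {g : G} {x : GeomComp X} :
    g • x ∈ geomVertices X ↔ x ∈ geomVertices X := by
  refine ⟨fun h => ?_, smul_mem_geomVertices⟩
  have := smul_mem_geomVertices (g := g⁻¹) h
  rwa [inv_smul_smul] at this

variable [hX : Fact X.IsTree] [X.LocallyFinite]

open Horo in
-- One direction is continuity of `toGeom`. For the other, an end of `L` is a limit of vertices of
-- `L`, and `x ↦ [g, x]` is continuous.
lemma mem_polVertices_iff {q : PolComp G L} : q ∈ polVertices G L ↔ toGeom q ∈ geomVertices X := by
  constructor
  · refine fun h => closure_minimal ?_ (isClosed_closure.preimage continuous_toGeom) h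
    rintro _ ⟨g, x, ⟨v, hv⟩, rfl⟩
    refine smul_mem_geomVertices (x := x.1) ?_
    rw [hv]
    exact subset_closure ⟨v, rfl⟩
  · induction q using ind with
    | h g x =>
      intro h
      obtain ⟨x, hx⟩ := x
      rw [toGeom_mk, smul_mem_geomVertices_iff] at h
      rcases cases_of_mem_closed L hx h with ⟨i, rfl⟩ | ⟨L', -, hL', rfl⟩
      · exact subset_closure ⟨g, _, ⟨_, rfl⟩, rfl⟩
      · have hv : ∀ n, Horo.toGeom (vertex (L'.ray.toFun n)) ∈ L.closed := fun n => by
          rw [toGeom_vertex, ← hL']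
          exact L'.vertex_mem_closed_iff.2 ⟨n, rfl⟩
        have ht : Tendsto (fun n => (⟨_, hv n⟩ : L.closed)) atTop (𝓝 ⟨_, hx⟩) :=
          tendsto_subtype_rng.2
            ((Horo.continuous_toGeom.tendsto _).comp (tendsto_vertex_ray L'.ray))
        have hc : Continuous fun y : L.closed => mk g y :=
          continuous_mk.comp (Continuous.prodMk_right g)
        refine mem_closure_of_tendsto ((hc.tendsto _).comp ht) (Eventually.of_forall fun n => ?_)
        exact ⟨g, _, ⟨_, toGeom_vertex _⟩, rfl⟩

open Horo in
-- The element `h⁻¹ * g` maps `x` to `y`. Strong transitivity gives `n` stabilizing `L` that agrees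
-- with it at `x`, or on a subray towards `x`, so `g⁻¹ * h * n` fixes that vertex or subray.
lemma polRel_of_smul_eq (hG : IsClosed (G : Set (X ≃g X))) (htrans : IsLocallyInftyTransitive G)
    {g h : G} {x y : L.closed} (hx : (x : GeomComp X) ∈ geomVertices X)
    (hxy : g • (x : GeomComp X) = h • (y : GeomComp X)) : polRel G L (g, x) (h, y) := by
  obtain ⟨x, hxL⟩ := x
  obtain ⟨y, hyL⟩ := y
  dsimp only at hx hxy
  have hy : y ∈ geomVertices X :=
    smul_mem_geomVertices_iff.1 (hxy ▸ smul_mem_geomVertices hx)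
  have hyx : y = (h⁻¹ * g) • x := by rw [mul_smul, hxy, inv_smul_smul]
  rcases cases_of_mem_closed L hxL hx with ⟨i, rfl⟩ | ⟨L₁, hL₁, -, rfl⟩
  · have e : ∀ k : G, k • (GeomComp.vertex (L.toFun i) : GeomComp X) = .vertex (k • L.toFun i) :=
      fun k => GeomComp.smul_vertex k.1 _
    rw [e] at hyx
    subst hyx
    obtain ⟨j, hj⟩ := L.vertex_mem_closed_iff.1 hyL
    obtain ⟨n, hn⟩ := exists_smul_line hX.out hG htrans L L (i := i) (i' := j) ⟨_, hj.symm⟩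
    have hn0 := hn 0
    rw [add_zero, add_zero] at hn0
    refine ⟨n, L.mem_stabilizer_points_of_forall rfl rfl hn, ?_, ?_⟩
    · dsimp only
      rw [e, hn0, hj]
    · dsimp only
      rw [← toGeom_vertex, mem_pointGroup_vertex, mul_smul, hn0, hj, ← mul_smul]
      rw [show g⁻¹ * h * (h⁻¹ * g) = 1 by group, one_smul]
  · have e : ∀ (k : G) (r : GeodesicRay X),
        k • Horo.toGeom (ofRay r) = Horo.toGeom (ofRay (k.1 • r)) := fun k r => by
      rw [← smul_ofRay, toGeom_smul]
      rfl
    rcases cases_of_mem_closed L hyL hy with ⟨i, rfl⟩ | ⟨L₂, hL₂, -, rfl⟩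
    · rw [e, ← toGeom_vertex] at hyx
      exact (ofRay_ne_vertex _ _ (toGeom_injective hyx).symm).elim
    · rw [e] at hyx
      -- The half-line of `L₂` and the image of that of `L₁` merge; `n` is required to match them
      -- with this same shift.
      obtain ⟨j, i, hij⟩ := exists_merge (toGeom_injective hyx)
      have hij : ∀ k : ℕ, L₂.toFun (j + k : ℕ) = (h⁻¹ * g) • L₁.toFun (i + k : ℕ) := hij
      have h0 := hij 0
      rw [add_zero, add_zero] at h0
      obtain ⟨n, hn⟩ := exists_smul_line hX.out hG htrans L₁ L₂ ⟨_, h0.symm⟩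
      have hn' : ∀ k : ℕ, n • L₁.toFun (i + k : ℕ) = L₂.toFun (j + k : ℕ) := fun k => by
        have := hn k
        rwa [← Nat.cast_add, ← Nat.cast_add] at this
      refine ⟨n, L.mem_stabilizer_points_of_forall hL₁ hL₂ hn, ?_, ?_⟩
      · dsimp only
        rw [e, ← ofRay_drop (n.1 • L₁.ray) i, ← ofRay_drop L₂.ray j]
        exact congrArg (fun r => Horo.toGeom (ofRay r)) (GeodesicRay.ext fun k => (hn' k).symm)
      · refine mem_pointGroup_of_eventually (eventually_atTop.2 ⟨i, fun m hm => ?_⟩)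
        obtain ⟨k, rfl⟩ := Nat.exists_eq_add_of_le hm
        change (g⁻¹ * h * n) • L₁.toFun (i + k : ℕ) = L₁.toFun (i + k : ℕ)
        rw [mul_smul, hn', hij, ← mul_smul]
        rw [show g⁻¹ * h * (h⁻¹ * g) = 1 by group, one_smul]

lemma toGeom_injOn (hG : IsClosed (G : Set (X ≃g X))) (htrans : IsLocallyInftyTransitive G) :
    InjOn (toGeom : PolComp G L → GeomComp X) (polVertices G L) := by
  intro p hp q hq h
  induction p using ind with
  | h g x =>
    induction q using ind with
    | h k y =>
      rw [mem_polVertices_iff, toGeom_mk, smul_mem_geomVertices_iff] at hp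
      exact Quotient.sound (polRel_of_smul_eq hG htrans hp h)

open Horo in
-- Separation of the quotient is not needed beforehand: the source is compact as an image of `K ×
-- R`, and the target of `[g, x] ↦ g.x` is Hausdorff.
lemma exists_homeo (hleaf : ∀ v, 2 ≤ X.degree v) (hG : IsClosed (G : Set (X ≃g X)))
    (htrans : IsLocallyInftyTransitive G) (L : GeodesicLine X) :
    ∃ f : geomVertices X ≃ₜ polVertices G L,
      IsEquivariant (fun (g : G) x => g • x) (polAction G L) f ∧
      ∀ (g : G) (x : L.closed) (h : g • (x : GeomComp X) ∈ geomVertices X),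
        (f ⟨g • (x : GeomComp X), h⟩ : PolComp G L) = .mk g x := by
  let K : Set G := {k | k • L.ray.toFun 0 = L.ray.toFun 0}
  let R : Set (Horo X) := insert (ofRay L.ray) (range fun n => (vertex (L.ray.toFun n) : Horo X))
  have : CompactSpace K :=
    isCompact_iff_compactSpace.1 (isCompact_setOf_smul_eq hX.out.connected hG _ _)
  have : CompactSpace R := isCompact_iff_compactSpace.1 (isCompact_ray L.ray)
  let F : K × R → PolComp G L := fun a =>
    mk a.1.1 ⟨Horo.toGeom a.2.1, toGeom_mem_closed_of_mem L a.2.2⟩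
  have hF : Continuous F := by
    refine continuous_mk.comp (Continuous.prodMk (by fun_prop) (Continuous.subtype_mk ?_ _))
    exact Horo.continuous_toGeom.comp (continuous_subtype_val.comp continuous_snd)
  have hFmem : ∀ a, F a ∈ polVertices G L := fun a =>
    mem_polVertices_iff.2 (smul_mem_geomVertices (toGeom_mem _))
  have hsurj : ∀ x ∈ geomVertices X, ∃ a, toGeom (F a) = x := by
    intro x hx
    obtain ⟨c, rfl⟩ := geomVertices_eq_range.subset hx
    obtain ⟨k, hk, y, hy, rfl⟩ := exists_smul_eq hleaf hG htrans L.ray c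
    exact ⟨(⟨k, hk⟩, ⟨y, hy⟩), (toGeom_smul k.1 y).symm⟩
  have hrange : polVertices G L = range F := by
    refine Subset.antisymm (fun q hq => ?_) (range_subset_iff.2 hFmem)
    obtain ⟨a, ha⟩ := hsurj _ (mem_polVertices_iff.1 hq)
    exact ⟨a, toGeom_injOn hG htrans (hFmem a) hq ha⟩
  have hcomp : CompactSpace (polVertices G L) := by
    rw [← isCompact_iff_compactSpace, hrange]
    exact isCompact_range hF
  let φ : polVertices G L → geomVertices X := fun q => ⟨toGeom q.1, mem_polVertices_iff.1 q.2⟩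
  have hφ : Continuous φ := (continuous_toGeom.comp continuous_subtype_val).subtype_mk _
  have hbij : Function.Bijective φ := by
    refine ⟨fun p q h => Subtype.ext (toGeom_injOn hG htrans p.2 q.2 (congrArg Subtype.val h)), ?_⟩
    rintro ⟨x, hx⟩
    obtain ⟨a, ha⟩ := hsurj x hx
    exact ⟨⟨F a, hFmem a⟩, Subtype.ext ha⟩
  let f : geomVertices X ≃ₜ polVertices G L :=
    (Continuous.homeoOfEquivCompactToT2 (f := Equiv.ofBijective φ hbij) hφ).symm
  have hf : ∀ q (hq : q ∈ polVertices G L) h, f ⟨toGeom q, h⟩ = ⟨q, hq⟩ := fun q hq h =>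
    f.symm.injective (by
      rw [Homeomorph.symm_apply_apply]
      rfl)
  have hact : ∀ (g : G), ∀ z ∈ polVertices G L, polAction G L g z ∈ polVertices G L := by
    intro g z hz
    rw [mem_polVertices_iff, toGeom_polAction]
    exact smul_mem_geomVertices (mem_polVertices_iff.1 hz)
  refine ⟨f, ⟨hact, ?_⟩, ?_⟩
  · intro g y
    obtain ⟨⟨q, hq⟩, rfl⟩ := f.symm.surjective y
    refine ⟨smul_mem_geomVertices (f.symm ⟨q, hq⟩).2, ?_⟩
    rw [Homeomorph.apply_symm_apply]
    have := hf _ (hact g q hq) (mem_polVertices_iff.1 (hact g q hq))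
    refine Eq.trans (congrArg (fun x => (f x : PolComp G L)) (Subtype.ext ?_))
      (congrArg Subtype.val this)
    exact (toGeom_polAction g q).symm
  · intro g x h
    exact congrArg Subtype.val (hf (mk g x) (mem_polVertices_iff.2 h) h)

end PolComp

end Polyhedral

/-! ### Cylinders in the boundary. -/

section Cylinders

variable {V : Type*} {X : SimpleGraph V} [hX : Fact X.IsTree]

open Horo

/-- The points at infinity towards which the ray from `w` passes through `v`. -/
def cylinder (w v : V) : Set (Boundary X) := {ξ | ofBoundary ξ w v = X.dist w v}

lemma mem_cylinder {w v : V} {ξ : Boundary X} :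
    ξ ∈ cylinder w v ↔ ofBoundary ξ w v = X.dist w v := Iff.rfl

lemma exists_ray_from_of_boundary (ξ : Boundary X) (w : V) :
    ∃ r : GeodesicRay X, r.toFun 0 = w ∧ ofBoundary ξ = ofRay r := by
  induction ξ using Quotient.inductionOn with
  | h r => exact exists_ray_from r w

lemma disjoint_cylinder {w v v' : V} (hd : X.dist w v = X.dist w v') (hv : v ≠ v') :
    Disjoint (cylinder w v : Set (Boundary X)) (cylinder w v') :=
  Set.disjoint_left.2 fun ξ h h' => hv (eq_of_apply_eq_dist (ofBoundary ξ) h h' hd)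

lemma exists_mem_cylinder (ξ : Boundary X) (w : V) (n : ℕ) :
    ∃ v, X.dist w v = n ∧ ξ ∈ cylinder w v := by
  obtain ⟨r, rfl, hr⟩ := exists_ray_from_of_boundary ξ w
  refine ⟨r.toFun n, by rw [r.dist_of_le (Nat.zero_le n), Nat.sub_zero], ?_⟩
  rw [mem_cylinder, hr, ray_mem]

/-- If the sum of the two increments attains the sum of their bounds in `le_dist`, each increment
attains its own bound. -/
lemma cylinder_subset {w v v' : V} (h : X.dist w v' = X.dist w v + X.dist v v') :
    (cylinder w v' : Set (Boundary X)) ⊆ cylinder w v := by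
  intro ξ hξ
  rw [mem_cylinder] at hξ ⊢
  have h1 := (ofBoundary ξ).add w v v'
  have h2 := abs_le.1 ((ofBoundary ξ).le_dist hX.out.connected w v)
  have h3 := abs_le.1 ((ofBoundary ξ).le_dist hX.out.connected v v')
  omega

lemma cylinder_subset_of_mem {w v v' : V} {ξ : Boundary X} (h : ξ ∈ cylinder w v)
    (h' : ξ ∈ cylinder w v') (hd : X.dist w v ≤ X.dist w v') :
    (cylinder w v' : Set (Boundary X)) ⊆ cylinder w v := by
  obtain ⟨r, rfl, hr⟩ := exists_ray_from_of_boundary ξ w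
  rw [mem_cylinder, hr] at h h'
  refine cylinder_subset ?_
  have h1 := r.dist_of_le hd
  rw [eq_ray_of_apply_eq_dist r h, eq_ray_of_apply_eq_dist r h'] at h1
  omega

lemma preimage_smul_cylinder {G : Subgroup (X ≃g X)} (g : G) (w v : V) :
    (fun ξ : Boundary X => g • ξ) ⁻¹' cylinder (g • w) (g • v) = cylinder w v := by
  ext ξ
  rw [mem_preimage, mem_cylinder, mem_cylinder, dist_smul]
  have : ofBoundary (g • ξ) = g • ofBoundary ξ := ofBoundary_smul g.1 ξ
  rw [this, smul_apply_smul]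

lemma mem_cylinder_of_adj {a b : V} (hab : X.Adj a b) {ξ : Boundary X}
    (h : ofBoundary ξ a b = 1) : ξ ∈ cylinder a b := by
  rw [mem_cylinder, h, SimpleGraph.dist_eq_one_iff_adj.2 hab]
  rfl

lemma cylinder_ray_subset (r : GeodesicRay X) (n : ℕ) : (cylinder (r.toFun 0)
    (r.toFun (n + 1)) : Set (Boundary X)) ⊆
      {ξ | ofBoundary ξ (r.toFun n) (r.toFun (n + 1)) = 1} := by
  intro ξ hξ
  rw [mem_cylinder, r.dist_of_le (Nat.zero_le _)] at hξ
  have h1 := (ofBoundary ξ).add (r.toFun 0) (r.toFun n) (r.toFun (n + 1))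
  have h2 := abs_le.1 ((ofBoundary ξ).le_dist hX.out.connected (r.toFun 0) (r.toFun n))
  rw [r.dist_of_le (Nat.zero_le _)] at h2
  have h3 := (ofBoundary ξ).isHoro.adj _ _ (r.adj n)
  rw [mem_ofPred_eq]
  omega

lemma isPiSystem_cylinder (w : V) : IsPiSystem (range (cylinder w : V → Set (Boundary X))) := by
  rintro _ ⟨v, rfl⟩ _ ⟨v', rfl⟩ ⟨ξ, h, h'⟩
  rcases le_total (X.dist w v) (X.dist w v') with hd | hd
  · exact ⟨v', (inter_eq_right.2 (cylinder_subset_of_mem h h' hd)).symm⟩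
  · exact ⟨v, (inter_eq_left.2 (cylinder_subset_of_mem h' h hd)).symm⟩

variable [X.LocallyFinite]

lemma isClopen_cylinder (w v : V) : IsClopen (cylinder w v : Set (Boundary X)) :=
  (isClopen_setOf_apply_eq w v _).preimage isClosedEmbedding_ofBoundary.continuous

lemma isTopologicalBasis_cylinder (w : V) :
    TopologicalSpace.IsTopologicalBasis (range (cylinder w : V → Set (Boundary X))) := by
  refine TopologicalSpace.isTopologicalBasis_of_isOpen_of_nhds ?_ ?_
  · rintro _ ⟨v, rfl⟩
    exact (isClopen_cylinder w v).isOpen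
  · intro ξ U hξ hU
    obtain ⟨U', hU', rfl⟩ := isClosedEmbedding_ofBoundary.isInducing.isOpen_iff.1 hU
    obtain ⟨r, rfl, hr⟩ := exists_ray_from_of_boundary ξ w
    obtain ⟨N, hN⟩ := exists_setOf_apply_subset r (hr ▸ hU'.mem_nhds hξ)
    refine ⟨_, ⟨r.toFun (N + 1), rfl⟩, ?_, fun η hη => hN N le_rfl (cylinder_ray_subset r N hη)⟩
    rw [mem_cylinder, hr, ray_mem]

omit hX [X.LocallyFinite] in
lemma secondCountableTopology_horo [Countable V] : SecondCountableTopology (Horo X) :=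
  isInducing_toFun.secondCountableTopology

lemma secondCountableTopology_boundary [Countable V] : SecondCountableTopology (Boundary X) :=
  have := secondCountableTopology_horo (X := X)
  isClosedEmbedding_ofBoundary.isInducing.secondCountableTopology

end Cylinders

/-! ### Measures invariant under a vertex stabilizer. -/

section InvariantMeasures

variable {V : Type*} {X : SimpleGraph V} [hX : Fact X.IsTree] [X.LocallyFinite]
  {G : Subgroup (X ≃g X)}

open Horo

variable (G) in
/-- The measures on the boundary which are invariant under the stabilizer of a vertex. -/
def IsStabilizerInvariant (w : V) (ν : Measure (Boundary X)) : Prop :=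
  ∀ g : G, g • w = w → ν.map (fun ξ => g • ξ) = ν

omit hX [X.LocallyFinite] in
lemma measurable_smul_boundary (g : G) : Measurable fun ξ : Boundary X => g • ξ :=
  (continuous_const_smul (g : X ≃g X)).measurable

namespace IsStabilizerInvariant

variable {w : V} {ν : Measure (Boundary X)}

lemma measure_cylinder_eq (hν : IsStabilizerInvariant G w ν) (htrans : IsLocallyInftyTransitive G)
    {v v' : V} (h : X.dist w v = X.dist w v') : ν (cylinder w v) = ν (cylinder w v') := by
  obtain ⟨g, hg, rfl⟩ := htrans.exists_smul h
  nth_rw 2 [← hν g hg]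
  rw [Measure.map_apply (measurable_smul_boundary g) (isClopen_cylinder _ _).isOpen.measurableSet]
  conv_rhs => rw [← hg]
  rw [preimage_smul_cylinder]

lemma sum_measure_cylinder_le {n : ℕ} {T : Finset V} (hT : ∀ v ∈ T, X.dist w v = n)
    {A : Set (Boundary X)} (hA : ∀ v ∈ T, cylinder w v ⊆ A) :
    ∑ v ∈ T, ν (cylinder w v) ≤ ν A := by
  rw [← measure_biUnion_finset]
  · exact measure_mono (iUnion₂_subset hA)
  · intro v hv v' hv' hne
    exact disjoint_cylinder ((hT v hv).trans (hT v' hv').symm) hne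
  · exact fun v _ => (isClopen_cylinder _ _).isOpen.measurableSet

lemma card_mul_measure_cylinder_le (hν : IsStabilizerInvariant G w ν)
    (htrans : IsLocallyInftyTransitive G) {v : V} {T : Finset V}
    (hT : ∀ u ∈ T, X.dist w u = X.dist w v) {A : Set (Boundary X)}
    (hA : ∀ u ∈ T, cylinder w u ⊆ A) : T.card * ν (cylinder w v) ≤ ν A := by
  have h := sum_measure_cylinder_le (ν := ν) hT hA
  rwa [Finset.sum_congr rfl fun u hu => hν.measure_cylinder_eq htrans (hT u hu),
    Finset.sum_const, nsmul_eq_mul] at h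

variable [IsProbabilityMeasure ν]

/-- `N` is the cardinality of the sphere through `v`, whose cylinders partition the boundary into
pieces of equal mass. It does not depend on `ν`, which is what `unique` needs. -/
lemma exists_card_mul_measure_cylinder_eq (htrans : IsLocallyInftyTransitive G) (w v : V) :
    ∃ N : ℕ, ∀ ν : Measure (Boundary X), IsProbabilityMeasure ν → IsStabilizerInvariant G w ν →
      N * ν (cylinder w v) = 1 := by
  have hfin : {u | X.dist w u = X.dist w v}.Finite :=
    (finite_closedBall hX.out.connected w (X.dist w v)).subset fun u hu => by
      rw [mem_ofPred_eq, SimpleGraph.dist_comm]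
      exact le_of_eq hu
  have hT : ∀ u ∈ hfin.toFinset, X.dist w u = X.dist w v := fun u hu => hfin.mem_toFinset.1 hu
  refine ⟨hfin.toFinset.card, fun ν _ hν => le_antisymm ?_ ?_⟩
  · exact (hν.card_mul_measure_cylinder_le htrans hT fun u _ => subset_univ _).trans prob_le_one
  · have h1 : (univ : Set (Boundary X)) ⊆ ⋃ u ∈ hfin.toFinset, cylinder w u := by
      intro ξ _
      obtain ⟨u, hu, hξ⟩ := exists_mem_cylinder ξ w (X.dist w v)
      exact mem_biUnion (hfin.mem_toFinset.2 hu) hξ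
    have h2 := (measure_mono (μ := ν) h1).trans (measure_biUnion_finset_le _ _)
    rwa [measure_univ, Finset.sum_congr rfl fun u hu => hν.measure_cylinder_eq htrans (hT u hu),
      Finset.sum_const, nsmul_eq_mul] at h2

lemma measure_cylinder_ne_zero (hν : IsStabilizerInvariant G w ν)
    (htrans : IsLocallyInftyTransitive G) (v : V) : ν (cylinder w v) ≠ 0 := by
  obtain ⟨N, hN⟩ := exists_card_mul_measure_cylinder_eq htrans w v
  intro h
  have := hN ν inferInstance hν
  rw [h, mul_zero] at this
  exact zero_ne_one this

lemma unique (hν : IsStabilizerInvariant G w ν) (htrans : IsLocallyInftyTransitive G)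
    {ν' : Measure (Boundary X)} [IsProbabilityMeasure ν'] (hν' : IsStabilizerInvariant G w ν') :
    ν = ν' := by
  have := countable_of_connected hX.out.connected
  have := secondCountableTopology_boundary (X := X)
  refine ext_of_generate_finite (range (cylinder w))
    ((isTopologicalBasis_cylinder w).borel_eq_generateFrom) (isPiSystem_cylinder w) ?_ ?_
  · rintro _ ⟨v, rfl⟩
    obtain ⟨N, hN⟩ := exists_card_mul_measure_cylinder_eq htrans w v
    rw [ENNReal.eq_inv_of_mul_eq_one_left ((mul_comm _ _).trans (hN ν inferInstance hν)),
      ENNReal.eq_inv_of_mul_eq_one_left ((mul_comm _ _).trans (hN ν' inferInstance hν'))]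
  · rw [measure_univ, measure_univ]

omit [X.LocallyFinite] in
lemma exists_forward (w v : V) : ∃ p, ∀ b, X.Adj v b → b ≠ p → X.dist w b = X.dist w v + 1 := by
  by_cases h : v = w
  · subst h
    -- At `w` itself all directions lead away; `v` is a dummy value that excludes no neighbour.
    exact ⟨v, fun b hb _ => by rw [SimpleGraph.dist_eq_one_iff_adj.2 hb, SimpleGraph.dist_self]⟩
  · obtain ⟨p, hp, hpw⟩ := exists_adj_dist_eq hX.out.connected h
    refine ⟨p, fun b hb hbp => ?_⟩
    rw [SimpleGraph.dist_comm, SimpleGraph.dist_comm (u := w)]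
    exact (dist_adj_cases hX.out hb w).resolve_left
      fun h' => hbp (adj_unique_of_dist hX.out hb hp h' hpw)

/-- A vertex `v` has two vertices at distance two on its far side from `w`: of two adjacent
vertices, one is a branch point. -/
lemma exists_two_forward (hsemi : IsSemiHomogeneous X) (hleaf : ∀ v, 2 ≤ X.degree v)
    (hline : ∃ v, 3 ≤ X.degree v) (w v : V) : ∃ u₁ u₂, u₁ ≠ u₂ ∧
      (X.dist w u₁ = X.dist w v + 2 ∧ X.dist v u₁ = 2) ∧
      (X.dist w u₂ = X.dist w v + 2 ∧ X.dist v u₂ = 2) := by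
  have two : ∀ {b u}, X.Adj v b → X.dist w b = X.dist w v + 1 → X.Adj b u →
      X.dist w u = X.dist w b + 1 → X.dist w u = X.dist w v + 2 ∧ X.dist v u = 2 := by
    intro b u hb hwb hu hwu
    have h1 := hX.out.connected.dist_triangle (u := w) (v := v) (w := u)
    have h2 := hX.out.connected.dist_triangle (u := v) (v := b) (w := u)
    rw [SimpleGraph.dist_eq_one_iff_adj.2 hb, SimpleGraph.dist_eq_one_iff_adj.2 hu] at h2
    omega
  obtain ⟨p, hp⟩ := exists_forward (X := X) w v
  obtain ⟨b, hb, hbp⟩ := exists_adj_ne hleaf v p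
  obtain ⟨q, hq⟩ := exists_forward (X := X) w b
  -- If `v` is a branch vertex, use two forward neighbours of `v`; otherwise `b` is one, and has two
  -- forward neighbours.
  rcases three_le_degree_or hsemi hline hb with h | h
  · obtain ⟨b', hb', hb'p, hne⟩ := exists_adj_ne_ne h p b
    obtain ⟨q', hq'⟩ := exists_forward (X := X) w b'
    obtain ⟨u, hu, huq⟩ := exists_adj_ne hleaf b q
    obtain ⟨u', hu', huq'⟩ := exists_adj_ne hleaf b' q'
    refine ⟨u, u', ?_, two hb (hp b hb hbp) hu (hq u hu huq),
      two hb' (hp b' hb' hb'p) hu' (hq' u' hu' huq')⟩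
    rintro rfl
    refine hne (adj_unique_of_dist hX.out hu'.symm hu.symm (w := w) ?_ ?_)
    · rw [SimpleGraph.dist_comm, hq' u hu' huq', SimpleGraph.dist_comm]
    · rw [SimpleGraph.dist_comm, hq u hu huq, SimpleGraph.dist_comm]
  · obtain ⟨u, hu, huq⟩ := exists_adj_ne hleaf b q
    obtain ⟨u', hu', huq', hne⟩ := exists_adj_ne_ne h q u
    exact ⟨u, u', hne.symm, two hb (hp b hb hbp) hu (hq u hu huq),
      two hb (hp b hb hbp) hu' (hq u' hu' huq')⟩

/-- Mass depends only on depth, so one ray from `w` suffices. Two steps further, a cylinder contains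
two disjoint cylinders of equal mass, so the mass is at least halved. -/
lemma measure_cylinder_le_pow (hν : IsStabilizerInvariant G w ν)
    (htrans : IsLocallyInftyTransitive G) (hsemi : IsSemiHomogeneous X)
    (hleaf : ∀ v, 2 ≤ X.degree v) (hline : ∃ v, 3 ≤ X.degree v) {k : ℕ} {v : V}
    (hv : 2 * k ≤ X.dist w v) : ν (cylinder w v) ≤ 2⁻¹ ^ k := by
  classical
  obtain ⟨b, hb, -⟩ := exists_adj_ne hleaf w w
  obtain ⟨r, rfl, -⟩ := exists_ray_of_adj hX.out hleaf hb
  have hd : ∀ n, X.dist (r.toFun 0) (r.toFun n) = n := fun n => by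
    rw [r.dist_of_le (Nat.zero_le n), Nat.sub_zero]
  have key : ∀ k, ν (cylinder (r.toFun 0) (r.toFun (2 * k))) ≤ 2⁻¹ ^ k := by
    intro k
    induction k with
    | zero => simpa using prob_le_one
    | succ k ih =>
      obtain ⟨u₁, u₂, hne, ⟨h1, h1'⟩, h2, h2'⟩ :=
        exists_two_forward hsemi hleaf hline (r.toFun 0) (r.toFun (2 * k))
      have h := hν.card_mul_measure_cylinder_le htrans (v := r.toFun (2 * (k + 1)))
        (T := {u₁, u₂}) (A := cylinder (r.toFun 0) (r.toFun (2 * k))) (by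
          intro u hu
          rw [Finset.mem_insert, Finset.mem_singleton] at hu
          rcases hu with rfl | rfl <;> rw [hd] <;> rw [hd] at h1 h2 <;> omega) (by
          intro u hu
          rw [Finset.mem_insert, Finset.mem_singleton] at hu
          rcases hu with rfl | rfl <;> exact cylinder_subset (by omega))
      rw [Finset.card_pair hne] at h
      rw [pow_succ', ← ENNReal.div_eq_inv_mul]
      rw [ENNReal.le_div_iff_mul_le (by simp) (by simp), mul_comm]
      exact h.trans ih
  rw [hν.measure_cylinder_eq htrans (hd _).symm]
  refine (measure_mono ?_).trans (key k)
  exact cylinder_subset (by rw [hd, hd, r.dist_of_le hv]; omega)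

omit hX [X.LocallyFinite] [IsProbabilityMeasure ν] in
lemma smul (hν : IsStabilizerInvariant G w ν) (g : G) :
    IsStabilizerInvariant G (g • w) (ν.map fun ξ => g • ξ) := by
  intro k hk
  have h := hν (g⁻¹ * k * g) (by rw [mul_smul, mul_smul, hk, inv_smul_smul])
  nth_rw 2 [← h]
  rw [Measure.map_map (measurable_smul_boundary _) (measurable_smul_boundary _),
    Measure.map_map (measurable_smul_boundary _) (measurable_smul_boundary _)]
  congr 1
  funext ξ
  simp only [Function.comp_apply, ← mul_smul]
  congr 1
  group

/-- For `v ≠ w`, the cylinder at `v` towards `w` and the one at `w` towards `v` cover the boundary.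
Each has mass at most the inverse of a valency, hence at most one half. So both valencies are two
and the overlap is null, yet a branch off the geodesic between them gives the overlap positive mass.
-/
lemma eq_of_both (hν : IsStabilizerInvariant G w ν)
    (htrans : IsLocallyInftyTransitive G) (hsemi : IsSemiHomogeneous X)
    (hleaf : ∀ v, 2 ≤ X.degree v) (hline : ∃ v, 3 ≤ X.degree v) {v : V}
    (hν' : IsStabilizerInvariant G v ν) : v = w := by
  by_contra hvw
  have hcon := hX.out.connected
  have deg : ∀ {v b}, IsStabilizerInvariant G v ν → X.Adj v b → ∀ n ≤ X.degree v,
      n * ν.real (cylinder v b) ≤ 1 := by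
    intro v b hν hb n hn
    have h := hν.card_mul_measure_cylinder_le htrans (v := b) (T := X.neighborFinset v)
      (A := univ) (fun u hu => by
        rw [SimpleGraph.dist_eq_one_iff_adj.2 hb,
          SimpleGraph.dist_eq_one_iff_adj.2 ((X.mem_neighborFinset v u).1 hu)])
      fun u _ => subset_univ _
    rw [SimpleGraph.card_neighborFinset_eq_degree, measure_univ] at h
    have h' := ENNReal.toReal_mono ENNReal.one_ne_top h
    rw [ENNReal.toReal_mul, ENNReal.toReal_natCast, ENNReal.toReal_one, ← measureReal_def] at h'
    refine le_trans ?_ h'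
    gcongr
  obtain ⟨b, hb, hbw⟩ := exists_adj_dist_eq hcon hvw
  obtain ⟨b', hb', hbv⟩ := exists_adj_dist_eq hcon (Ne.symm hvw)
  -- A point outside both would climb from `v` to `w` and also from `w` to `v`, against
  -- antisymmetry.
  have hcover : (univ : Set (Boundary X)) ⊆ cylinder v b ∪ cylinder w b' := by
    intro ξ _
    by_contra hξ
    rw [mem_union, not_or] at hξ
    have h1 := ((ofBoundary ξ).isHoro.adj v b hb).resolve_left
      fun h => hξ.1 (mem_cylinder_of_adj hb h)
    have h2 := ((ofBoundary ξ).isHoro.adj w b' hb').resolve_left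
      fun h => hξ.2 (mem_cylinder_of_adj hb' h)
    have h3 := (ofBoundary ξ).ascend hX.out hb h1 hbw
    have h4 := (ofBoundary ξ).ascend hX.out hb' h2 hbv
    have h5 := (ofBoundary ξ).swap v w
    omega
  have hsum := measureReal_union_add_inter (μ := ν) (s := cylinder v b)
    (isClopen_cylinder w b').isOpen.measurableSet
  rw [univ_subset_iff.1 hcover, probReal_univ] at hsum
  have hv2 := deg hν' hb 2 (hleaf v)
  have hw2 := deg hν hb' 2 (hleaf w)
  have hinter : 0 ≤ ν.real (cylinder v b ∩ cylinder w b') := measureReal_nonneg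
  have hw3 : ¬3 ≤ X.degree w := fun h => by
    have := deg hν hb' 3 h
    push_cast at this hv2
    linarith
  have hv3 : ¬3 ≤ X.degree v := fun h => by
    have := deg hν' hb 3 h
    push_cast at this hw2
    linarith
  have hb3 := (three_le_degree_or hsemi hline hb).resolve_left hv3
  -- As `v` is not a branch vertex, its neighbour `b` is one, so it is not `w`. A third neighbour
  -- `u` of `b` then lies off the geodesic from `v` to `w`.
  have hbw' : b ≠ w := fun h => hw3 (h ▸ hb3)
  obtain ⟨p, hp, hpw⟩ := exists_adj_dist_eq hcon hbw'
  obtain ⟨u, hu, huv, hup⟩ := exists_adj_ne_ne hb3 v p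
  have huw := (dist_adj_cases hX.out hu w).resolve_left
    fun h => hup (adj_unique_of_dist hX.out hu hp h hpw)
  have huv2 := (dist_adj_cases hX.out hu v).resolve_left fun h =>
    huv (adj_unique_of_dist hX.out hu hb.symm h (by
      rw [SimpleGraph.dist_self, SimpleGraph.dist_eq_one_iff_adj.2 hb.symm]))
  rw [SimpleGraph.dist_eq_one_iff_adj.2 hb.symm] at huv2
  have hsub : (cylinder v u : Set (Boundary X)) ⊆ cylinder v b ∩ cylinder w b' := by
    intro ξ hξ
    refine ⟨cylinder_subset ?_ hξ, ?_⟩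
    · rw [SimpleGraph.dist_eq_one_iff_adj.2 hb, SimpleGraph.dist_eq_one_iff_adj.2 hu,
        SimpleGraph.dist_comm, huv2]
    · rw [mem_cylinder, SimpleGraph.dist_comm, huv2] at hξ
      by_contra h
      have h2 := ((ofBoundary ξ).isHoro.adj w b' hb').resolve_left
        fun h' => h (mem_cylinder_of_adj hb' h')
      have h3 := (ofBoundary ξ).ascend hX.out hb' h2 hbv
      have h4 := (ofBoundary ξ).add v b u
      have h5 := (ofBoundary ξ).isHoro.adj v b hb
      have h6 := (ofBoundary ξ).isHoro.adj b u hu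
      have h7 := (ofBoundary ξ).swap b u
      have h8 := (ofBoundary ξ).ascend hX.out hu.symm (by omega) huw
      have h9 := (ofBoundary ξ).add v u w
      have h10 := (ofBoundary ξ).swap v w
      have h11 := hcon.pos_dist_of_ne hbw'
      have h12 := SimpleGraph.dist_comm (G := X) (u := v) (v := w)
      omega
  have hpos : 0 < ν.real (cylinder v u) :=
    ENNReal.toReal_pos (hν'.measure_cylinder_ne_zero htrans u) (measure_ne_top _ _)
  have := measureReal_mono (μ := ν) hsub
  push_cast at hv2 hw2
  linarith

end IsStabilizerInvariant

/-- Push the Haar probability measure of the compact group `K_w` forward by the orbit map of any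
point at infinity; left invariance becomes invariance under `K_w`. -/
lemma exists_isStabilizerInvariant (hG : IsClosed (G : Set (X ≃g X)))
    (hleaf : ∀ v, 2 ≤ X.degree v) (w : V) :
    ∃ ν : Measure (Boundary X), IsProbabilityMeasure ν ∧ IsStabilizerInvariant G w ν := by
  obtain ⟨b, hb, -⟩ := exists_adj_ne hleaf w w
  obtain ⟨r, -, -⟩ := exists_ray_of_adj hX.out hleaf hb
  let K := MulAction.stabilizer G w
  have : CompactSpace K :=
    isCompact_iff_compactSpace.1 (isCompact_setOf_smul_eq hX.out.connected hG w w)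
  let _ : MeasurableSpace K := borel K
  have : BorelSpace K := ⟨rfl⟩
  let m : Measure K := Measure.haarMeasure ⊤
  have hm : IsProbabilityMeasure m := ⟨Measure.haarMeasure_self (K₀ := ⊤)⟩
  have hf : Continuous fun k : K => k.1 • r.endpoint := by fun_prop
  refine ⟨m.map fun k : K => k.1 • r.endpoint, Measure.isProbabilityMeasure_map hf.aemeasurable,
    fun g hg => ?_⟩
  rw [Measure.map_map (measurable_smul_boundary g) hf.measurable]
  have h1 := MeasureTheory.map_mul_left_eq_self m (⟨g, hg⟩ : K)
  conv_rhs => rw [← h1]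
  rw [Measure.map_map hf.measurable (measurable_const_mul _)]
  congr 1

end InvariantMeasures

/-! ### The measure-theoretic compactification. -/

section MeasureCompactification

variable {V : Type*} {X : SimpleGraph V} [hX : Fact X.IsTree] [X.LocallyFinite]
  {G : Subgroup (X ≃g X)}

open Horo

omit [X.LocallyFinite] in
lemma Horo.exists_extend {Z : Type*} (a : V → Z) (b : Boundary X → Z) :
    ∃ F : Horo X → Z, (∀ w, F (vertex w) = a w) ∧ ∀ ξ, F (ofBoundary ξ) = b ξ := by
  have h : ∀ c : Horo X, ∃ z, (∀ w, c = vertex w → z = a w) ∧ ∀ ξ, c = ofBoundary ξ → z = b ξ := by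
    intro c
    rcases c.cases_boundary with ⟨w, rfl⟩ | ⟨ξ, rfl⟩
    · exact ⟨a w, fun v h => congrArg a (vertex_injective h),
        fun ξ h => (ofBoundary_ne_vertex ξ w h.symm).elim⟩
    · exact ⟨b ξ, fun w h => (ofBoundary_ne_vertex ξ w h).elim,
        fun η h => congrArg b (ofBoundary_injective h)⟩
  choose F hF using h
  exact ⟨F, fun w => (hF _).1 w rfl, fun ξ => (hF _).2 ξ rfl⟩

omit hX [X.LocallyFinite] in
lemma measAction_diracProba (g : G) (ξ : Boundary X) :
    measAction G g (diracProba ξ) = diracProba (g • ξ) :=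
  Subtype.ext (Measure.map_dirac' (measurable_smul_boundary g) ξ)

omit hX [X.LocallyFinite] in
lemma isStabilizerInvariant_iff {w : V} {ν : ProbabilityMeasure (Boundary X)} :
    IsStabilizerInvariant G w (ν : Measure (Boundary X)) ↔
      ∀ g : G, g • w = w → measAction G g ν = ν :=
  forall₂_congr fun _ _ => (Subtype.ext_iff (a1 := measAction G _ ν)).symm

lemma t2Space_probabilityMeasure_boundary : T2Space (ProbabilityMeasure (Boundary X)) := by
  have := countable_of_connected hX.out.connected
  have := secondCountableTopology_boundary (X := X)
  infer_instance

/-- The measure of the complement of a neighbourhood of a point at infinity, with respect to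
the invariant measure of a vertex, is small if the vertex is close to this point. -/
lemma eventually_one_sub_le_measure (htrans : IsLocallyInftyTransitive G)
    (hsemi : IsSemiHomogeneous X) (hleaf : ∀ v, 2 ≤ X.degree v) (hline : ∃ v, 3 ≤ X.degree v)
    {F : Horo X → ProbabilityMeasure (Boundary X)}
    (hvertex : ∀ w, IsStabilizerInvariant G w (F (vertex w) : Measure (Boundary X)))
    (hboundary : ∀ ξ, F (ofBoundary ξ) = diracProba ξ) {U : Set (Boundary X)} (hU : IsOpen U)
    {ξ : Boundary X} (hξ : ξ ∈ U) (k : ℕ) :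
    ∀ᶠ c in 𝓝 (ofBoundary ξ), 1 - 2⁻¹ ^ k ≤ (F c : Measure (Boundary X)) U := by
  obtain ⟨U', hU', rfl⟩ := isClosedEmbedding_ofBoundary.isInducing.isOpen_iff.1 hU
  induction ξ using Quotient.inductionOn with
  | h r =>
  change ∀ᶠ c in 𝓝 (ofRay r), _
  obtain ⟨N, hN⟩ := exists_setOf_apply_subset r (hU'.mem_nhds hξ)
  -- Everything at infinity beyond the edge at `N` lies in `U`. A vertex beyond the edge at `N + 2 *
  -- k` sees the rest of the boundary through `r N`, at distance at least `2 * k`, whence mass at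
  -- most `2⁻¹ ^ k`.
  filter_upwards [eventually_apply_eq (ofRay r) (r.toFun (N + 2 * k))
    (r.toFun (N + 2 * k + 1))] with c hc
  rw [ofRay_ray] at hc
  have hc : c (r.toFun (N + 2 * k)) (r.toFun (N + 2 * k + 1)) = 1 := by
    rw [hc]
    push_cast
    ring
  rcases c.cases_boundary with ⟨w, rfl⟩ | ⟨η, rfl⟩
  · rw [tsub_le_iff_right, ← prob_add_prob_compl (μ := (F (vertex w) : Measure (Boundary X)))
      hU.measurableSet]
    gcongr
    have hd := r.dist_of_le (m := N) (n := N + 2 * k) (by omega)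
    have hd' := r.dist_of_le (m := N) (n := N + 2 * k + 1) (by omega)
    have hd'' := r.dist_of_le (m := N + 1) (n := N + 2 * k + 1) (by omega)
    rw [SimpleGraph.dist_comm] at hd hd'
    have h1 := (vertex w : Horo X).ascend hX.out (r.adj (N + 2 * k)).symm
      (by rw [Horo.swap, hc]) (x := r.toFun N) (by omega)
    rw [vertex_apply] at h1
    have h2 := hX.out.connected.dist_triangle (u := r.toFun (N + 1))
      (v := r.toFun (N + 2 * k + 1)) (w := w)
    have h3 := (dist_adj_cases hX.out (r.adj N) w).resolve_right (by omega)
    refine (measure_mono fun η hη => ?_).trans ((hvertex w).measure_cylinder_le_pow htrans hsemi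
      hleaf hline (v := r.toFun N) (by rw [SimpleGraph.dist_comm]; omega))
    have h4 := ((ofBoundary η).isHoro.adj _ _ (r.adj N)).resolve_left
      fun h => hη (hN N le_rfl h)
    have h5 := (ofBoundary η).ascend hX.out (r.adj N) h4 h3
    rw [mem_cylinder, Horo.swap, h5, neg_neg, SimpleGraph.dist_comm]
  · rw [hboundary]
    have : η ∈ ofBoundary ⁻¹' U' := hN _ (by omega) hc
    change _ ≤ Measure.dirac η _
    rw [Measure.dirac_apply' _ hU.measurableSet, indicator_of_mem this]
    exact tsub_le_self

lemma continuous_of_isStabilizerInvariant (htrans : IsLocallyInftyTransitive G)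
    (hsemi : IsSemiHomogeneous X) (hleaf : ∀ v, 2 ≤ X.degree v) (hline : ∃ v, 3 ≤ X.degree v)
    {F : Horo X → ProbabilityMeasure (Boundary X)}
    (hvertex : ∀ w, IsStabilizerInvariant G w (F (vertex w) : Measure (Boundary X)))
    (hboundary : ∀ ξ, F (ofBoundary ξ) = diracProba ξ) : Continuous F := by
  have := countable_of_connected hX.out.connected
  have := secondCountableTopology_horo (X := X)
  refine continuous_iff_continuousAt.2 fun c => ?_
  rcases c.cases_boundary with ⟨w, rfl⟩ | ⟨ξ, rfl⟩
  · rw [ContinuousAt, (isOpen_singleton_iff_nhds_eq_pure _).1 (isOpen_singleton_vertex w)]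
    exact tendsto_pure_nhds _ _
  -- Portmanteau criterion: as the limit is a Dirac mass, only the open sets containing `ξ` give a
  -- condition.
  · refine tendsto_of_forall_isOpen_le_liminf' fun U hU => ?_
    rw [hboundary]
    change Measure.dirac ξ U ≤ _
    rw [Measure.dirac_apply' _ hU.measurableSet]
    refine indicator_apply_le' (fun hξ => ?_) fun _ => zero_le
    have hlim : Tendsto (fun k : ℕ => (1 : ENNReal) - 2⁻¹ ^ k) atTop (𝓝 (1 - 0)) :=
      ENNReal.Tendsto.sub tendsto_const_nhds
        (ENNReal.tendsto_pow_atTop_nhds_zero_of_lt_one (by simp)) (Or.inl ENNReal.one_ne_top)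
    rw [tsub_zero] at hlim
    exact le_of_tendsto' hlim fun k => le_liminf_of_le (by isBoundedDefault)
      (eventually_one_sub_le_measure htrans hsemi hleaf hline hvertex hboundary hU hξ k)

/-- An invariant measure of `w` is not a Dirac mass, since `K_w` fixes no point at infinity; two
vertices are distinguished by `eq_of_both`. -/
lemma injective_of_isStabilizerInvariant (htrans : IsLocallyInftyTransitive G)
    (hG : IsClosed (G : Set (X ≃g X)))
    (hsemi : IsSemiHomogeneous X) (hleaf : ∀ v, 2 ≤ X.degree v) (hline : ∃ v, 3 ≤ X.degree v)
    {F : Horo X → ProbabilityMeasure (Boundary X)}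
    (hvertex : ∀ w, IsStabilizerInvariant G w (F (vertex w) : Measure (Boundary X)))
    (hboundary : ∀ ξ, F (ofBoundary ξ) = diracProba ξ) : Function.Injective F := by
  have hinj : Function.Injective fun ξ : Boundary X => diracProba ξ := injective_diracProba
  have hne : ∀ w ξ, F (vertex w) ≠ F (ofBoundary ξ) := by
    intro w ξ h
    obtain ⟨r, -, hr⟩ := exists_ray_from_of_boundary ξ w
    obtain ⟨g, hg, hgr⟩ := exists_smul_eq_self_smul_ofRay_ne hleaf hG htrans w r
    have h1 := isStabilizerInvariant_iff.1 (hvertex w) g hg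
    rw [h, hboundary, measAction_diracProba] at h1
    have h2 : ofBoundary (g • ξ) = g • ofBoundary ξ := ofBoundary_smul g.1 ξ
    rw [hinj h1, hr] at h2
    exact hgr h2.symm
  intro c d h
  rcases c.cases_boundary with ⟨w, rfl⟩ | ⟨ξ, rfl⟩ <;>
    rcases d.cases_boundary with ⟨v, rfl⟩ | ⟨η, rfl⟩
  · have h' := hvertex v
    rw [← h] at h'
    rw [(hvertex w).eq_of_both htrans hsemi hleaf hline h']
  · exact (hne w η h).elim
  · exact (hne v ξ h.symm).elim
  · rw [hboundary, hboundary] at h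
    rw [hinj h]

lemma exists_homeo_measures (htrans : IsLocallyInftyTransitive G)
    (hG : IsClosed (G : Set (X ≃g X))) (hsemi : IsSemiHomogeneous X)
    (hleaf : ∀ v, 2 ≤ X.degree v) (hline : ∃ v, 3 ≤ X.degree v) :
    ∃ μ : V → ProbabilityMeasure (Boundary X),
      (∀ v, (∀ g : G, measAction G g (μ v) = μ v ↔ g • v = v) ∧
        ∀ ν, (∀ g : G, g • v = v → measAction G g ν = ν) → ν = μ v) ∧
      closure (range μ) = range μ ∪ range diracProba ∧
      Disjoint (range μ) (range diracProba) ∧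
      ∃ f : geomVertices X ≃ₜ closure (range μ),
        IsEquivariant (fun (g : G) x => g • x) (measAction G) f ∧
        (∀ v h, (f ⟨.vertex v, h⟩ : ProbabilityMeasure (Boundary X)) = μ v) ∧
        ∀ ξ h, (f ⟨.boundary ξ, h⟩ : ProbabilityMeasure (Boundary X)) = diracProba ξ := by
  have := t2Space_probabilityMeasure_boundary (X := X)
  choose m hm hinv using exists_isStabilizerInvariant hG hleaf
  let μ : V → ProbabilityMeasure (Boundary X) := fun v => ⟨m v, hm v⟩
  have hμ : ∀ v, IsStabilizerInvariant G v (μ v : Measure (Boundary X)) := hinv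
  -- The push-forward is invariant under the conjugate group `K_{g.v}`, so uniqueness identifies it.
  -- With injectivity, this also computes the stabilizer of `μ v`.
  have hsmul : ∀ (g : G) v, measAction G g (μ v) = μ (g • v) := fun g v =>
    Subtype.ext (IsStabilizerInvariant.unique (ν := (measAction G g (μ v) : Measure (Boundary X)))
      ((hμ v).smul g) htrans (hμ (g • v)))
  obtain ⟨F, hv, hb⟩ := Horo.exists_extend (X := X) μ diracProba
  have hvertex : ∀ w, IsStabilizerInvariant G w (F (vertex w) : Measure (Boundary X)) :=
    fun w => (hv w).symm ▸ hμ w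
  have hinj := injective_of_isStabilizerInvariant htrans hG hsemi hleaf hline hvertex hb
  obtain ⟨hcl, f, hf, hfF⟩ := Horo.exists_homeo (G := G)
    (continuous_of_isStabilizerInvariant htrans hsemi hleaf hline hvertex hb)
    hinj hv (β := measAction G) (by
      intro g c
      rcases c.cases_boundary with ⟨w, rfl⟩ | ⟨ξ, rfl⟩
      · rw [smul_vertex', hv, hv, hsmul]
      · have : g • ofBoundary ξ = ofBoundary (g • ξ) := (ofBoundary_smul g.1 ξ).symm
        rw [this, hb, hb, measAction_diracProba])
  refine ⟨μ, fun v => ⟨fun g => ⟨fun h => ?_, fun h => by rw [hsmul, h]⟩, fun ν hν => ?_⟩,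
    ?_, ?_, f, hf, fun v h => ?_, fun ξ h => ?_⟩
  · rw [hsmul, ← hv, ← hv] at h
    exact vertex_injective (hinj h)
  · exact Subtype.ext ((isStabilizerInvariant_iff.2 hν).unique htrans (hμ v))
  · rw [hcl]
    ext ν
    constructor
    · rintro ⟨c, rfl⟩
      rcases c.cases_boundary with ⟨w, rfl⟩ | ⟨ξ, rfl⟩
      · exact Or.inl ⟨w, (hv w).symm⟩
      · exact Or.inr ⟨ξ, (hb ξ).symm⟩
    · rintro (⟨w, rfl⟩ | ⟨ξ, rfl⟩)
      · exact ⟨_, hv w⟩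
      · exact ⟨_, hb ξ⟩
  · refine Set.disjoint_left.2 ?_
    rintro _ ⟨w, rfl⟩ ⟨ξ, h⟩
    rw [← hv, ← hb] at h
    exact ofBoundary_ne_vertex ξ w (hinj h)
  · have h' := h
    rw [← toGeom_vertex] at h'
    have := hfF _ h'
    rw [hv] at this
    rw [← this]
    simp only [toGeom_vertex]
  · have h' := h
    rw [← toGeom_ofBoundary] at h'
    have := hfF _ h'
    rw [hb] at this
    rw [← this]
    simp only [toGeom_ofBoundary]

end MeasureCompactification

/-! ### Assembly of the compactifications. -/

section Compactifications

variable {V : Type*} {X : SimpleGraph V} [hX : Fact X.IsTree] [X.LocallyFinite]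
  {G : Subgroup (X ≃g X)}

open Horo

lemma isCompactification_vertex : IsCompactification (GeomComp.vertex (X := X)) := by
  have hcl : closure (range (GeomComp.vertex (X := X))) = range toGeom := geomVertices_eq_range
  have hcomp : toGeom ∘ vertex = GeomComp.vertex (X := X) := funext toGeom_vertex
  refine ⟨hcl ▸ isCompact_range continuous_toGeom, (homeo X).t2Space, ?_⟩
  rw [← hcomp]
  let _ : TopologicalSpace V := ⊥
  have : DiscreteTopology V := ⟨rfl⟩
  refine isEmbedding_toGeom.comp (IsOpenEmbedding.of_continuous_injective_isOpenMap
    continuous_of_discreteTopology vertex_injective fun s _ => ?_).isEmbedding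
  rw [← biUnion_of_singleton s, image_iUnion₂]
  refine isOpen_biUnion fun w _ => ?_
  rw [image_singleton]
  exact isOpen_singleton_vertex w

lemma exists_homeo_closedGroup (htrans : IsLocallyInftyTransitive G)
    (hG : IsClosed (G : Set (X ≃g X))) (hsemi : IsSemiHomogeneous X)
    (hleaf : ∀ v, 2 ≤ X.degree v) (hline : ∃ v, 3 ≤ X.degree v) :
    (∀ H : ClosedSubgroup G, H ∈ gpVertices G ↔
        (∃ v, H = vertexStabilizer G v) ∨ ∃ ξ, H.toSubgroup = horosphereStabilizer G ξ) ∧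
      (∀ v ξ, (vertexStabilizer G v).toSubgroup ≠ horosphereStabilizer G ξ) ∧
      ∃ f : geomVertices X ≃ₜ gpVertices G,
        IsEquivariant (fun (g : G) x => g • x) conjAction f ∧
        (∀ v h, (f ⟨.vertex v, h⟩ : ClosedSubgroup G) = vertexStabilizer G v) ∧
        ∀ ξ h, (f ⟨.boundary ξ, h⟩ : ClosedSubgroup G).toSubgroup =
          horosphereStabilizer G ξ := by
  have := t2Space_closedSubgroup hX.out.connected hG
  have hinj := closedGroup_injective hsemi hleaf hline hG htrans
  obtain ⟨hcl, f, hf, hfF⟩ := Horo.exists_homeo (continuous_closedGroup hleaf hG htrans) hinj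
    closedGroup_vertex closedGroup_smul
  refine ⟨fun H => ?_, fun v ξ h => ?_, f, hf, fun v h => ?_, fun ξ h => ?_⟩
  · rw [gpVertices, hcl]
    constructor
    · rintro ⟨c, rfl⟩
      rcases c.cases_boundary with ⟨w, rfl⟩ | ⟨ξ, rfl⟩
      · exact Or.inl ⟨w, closedGroup_vertex w⟩
      · exact Or.inr ⟨ξ, closedGroup_ofBoundary ξ⟩
    · rintro (⟨w, rfl⟩ | ⟨ξ, h⟩)
      · exact ⟨_, closedGroup_vertex w⟩
      · exact ⟨_, ClosedSubgroup.toSubgroup_injective ((closedGroup_ofBoundary ξ).trans h.symm)⟩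
  · rw [← closedGroup_vertex, ← closedGroup_ofBoundary] at h
    exact ofBoundary_ne_vertex ξ v (hinj (ClosedSubgroup.toSubgroup_injective h)).symm
  · have h' := h
    rw [← toGeom_vertex] at h'
    have := hfF _ h'
    rw [closedGroup_vertex] at this
    rw [← this]
    simp only [toGeom_vertex]
    rfl
  · have h' := h
    rw [← toGeom_ofBoundary] at h'
    have := hfF _ h'
    rw [← closedGroup_ofBoundary, ← this]
    simp only [toGeom_ofBoundary]
    rfl

omit [hX : Fact X.IsTree] in
lemma nonempty_geodesicLine (hX : X.IsTree) (hleaf : ∀ v, 2 ≤ X.degree v) :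
    Nonempty (GeodesicLine X) := by
  have v := hX.connected.nonempty.some
  obtain ⟨b, hb, -⟩ := exists_adj_ne hleaf v v
  obtain ⟨r, -, -⟩ := exists_ray_of_adj hX hleaf hb
  obtain ⟨L, -⟩ := exists_line_of_ray hX hleaf r
  exact ⟨L⟩

end Compactifications

end TreeComp

theorem mainTheorem10 {V : Type*} (X : SimpleGraph V) [X.LocallyFinite] (hX : X.IsTree)
    (hsemi : TreeComp.IsSemiHomogeneous X)
    (hleaf : ∀ v, 2 ≤ X.degree v) (hline : ∃ v, 3 ≤ X.degree v)
    (G : Subgroup (X ≃g X)) (hG : IsClosed (G : Set (X ≃g X)))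
    (htrans : TreeComp.IsLocallyInftyTransitive G) :
    -- the geometric compactification
    (TreeComp.IsCompactification (TreeComp.GeomComp.vertex (X := X)) ∧
      TreeComp.geomVertices X = range TreeComp.GeomComp.vertex ∪ range TreeComp.GeomComp.boundary) ∧
    -- the polyhedral compactification
    (Nonempty (TreeComp.GeodesicLine X) ∧
      ∀ L : TreeComp.GeodesicLine X,
        ∃ f : TreeComp.geomVertices X ≃ₜ TreeComp.polVertices G L,
          TreeComp.IsEquivariant (fun (g : G) x => g • x) (TreeComp.polAction G L) f ∧
          ∀ (g : G) (x : L.closed) (h : g • (x : TreeComp.GeomComp X) ∈ TreeComp.geomVertices X),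
            (f ⟨g • (x : TreeComp.GeomComp X), h⟩ : TreeComp.PolComp G L) = .mk g x) ∧
    -- the group-theoretic compactification
    ((∀ H : ClosedSubgroup G, H ∈ TreeComp.gpVertices G ↔
        (∃ v, H = TreeComp.vertexStabilizer G v) ∨
        ∃ ξ, H.toSubgroup = TreeComp.horosphereStabilizer G ξ) ∧
      (∀ v ξ, (TreeComp.vertexStabilizer G v).toSubgroup ≠ TreeComp.horosphereStabilizer G ξ) ∧
      ∃ f : TreeComp.geomVertices X ≃ₜ TreeComp.gpVertices G,
        TreeComp.IsEquivariant (fun (g : G) x => g • x) TreeComp.conjAction f ∧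
        (∀ v h, (f ⟨.vertex v, h⟩ : ClosedSubgroup G) = TreeComp.vertexStabilizer G v) ∧
        ∀ ξ h, (f ⟨.boundary ξ, h⟩ : ClosedSubgroup G).toSubgroup =
          TreeComp.horosphereStabilizer G ξ) ∧
    -- the measure-theoretic compactification
    ∃ μ : V → ProbabilityMeasure (TreeComp.Boundary X),
      (∀ v, (∀ g : G, TreeComp.measAction G g (μ v) = μ v ↔ g • v = v) ∧
        ∀ ν, (∀ g : G, g • v = v → TreeComp.measAction G g ν = ν) → ν = μ v) ∧
      closure (range μ) = range μ ∪ range diracProba ∧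
      Disjoint (range μ) (range diracProba) ∧
      ∃ f : TreeComp.geomVertices X ≃ₜ closure (range μ),
        TreeComp.IsEquivariant (fun (g : G) x => g • x) (TreeComp.measAction G) f ∧
        (∀ v h, (f ⟨.vertex v, h⟩ : ProbabilityMeasure (TreeComp.Boundary X)) = μ v) ∧
        ∀ ξ h, (f ⟨.boundary ξ, h⟩ : ProbabilityMeasure (TreeComp.Boundary X)) =
          diracProba ξ := by
  have : Fact X.IsTree := ⟨hX⟩
  exact ⟨⟨TreeComp.isCompactification_vertex,
      TreeComp.Horo.geomVertices_eq_range.trans TreeComp.Horo.range_toGeom⟩,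
    ⟨TreeComp.nonempty_geodesicLine hX hleaf, TreeComp.PolComp.exists_homeo hleaf hG htrans⟩,
    TreeComp.exists_homeo_closedGroup htrans hG hsemi hleaf hline,
    TreeComp.exists_homeo_measures htrans hG hsemi hleaf hline⟩
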